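/- **Setting.** Let $CT$ be a first-order theory that contains Clark's equality theory. Built-in constraints are first-order formulas of the language of $CT$ (with $=$); conjunctions of them are written as finite multisets, `true` is the empty one and `false` is any one that is inconsistent with $CT$. A CHR constraint is $p(t_1,\dots,t_k)$ with $p$ a user-defined symbol; $h\#i$ is the constraint $h$ with identifier $i\in\mathbb N$. A goal is a finite multiset of CHR and built-in constraints. A CHR program is a finite set of rules $r@H_1\backslash H_2\Leftrightarrow D\,|\,B$ with distinct names, $(H_1,H_2)\ne\emptyset$ sequences of CHR constraints, $D$ a multiset of built-in constraints and $B$ a goal. An annotated rule $r@H_1\backslash H_2\Leftrightarrow D\,|\,\tilde B;T$ has a body with identified CHR constraints and a finite set $T$ of tokens $v@i_1,\dots,i_l$. $Ann(P)$ is obtained from $P$ by numbering the CHR constraints of each body $1,\dots,m$ and taking $T=\emptyset$. $H=H'$ denotes the set of equalities between the arguments of two sequences of constraints with the same symbols (undefined otherwise). Rules are taken up to renaming of variables. **Semantics.** For a program $P$, configurations $\langle G,\tilde S,C,T\rangle_n$ have the transitions: *Solve* $\langle\{c\}\uplus G,\tilde S,C,T\rangle_n\to\langle G,\tilde S,C',T\rangle_n$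 if $c$ is built-in and $CT\models c\wedge C\leftrightarrow C'$; *Introduce* $\langle\{h\}\uplus G,\tilde S,C,T\rangle_n\to\langle G,\{h\#n\}\cup\tilde S,C,T\rangle_{n+1}$ for a CHR constraint $h$; *Apply* $\langle G,\tilde H_1\cup\tilde H_2\cup\tilde S,C,T\rangle_n\to\langle B\uplus G,\tilde H_1\cup\tilde S,E\wedge C,T'\rangle_n$ if $r@H_1'\backslash H_2'\Leftrightarrow D|B$ is a rule of $P$ with fresh variables, $E$ is $chr(\tilde H_1,\tilde H_2)=(H_1',H_2')$, $CT\models C\to\exists_{Fv(H_1',H_2')}(E\wedge D)$ and $r@id(\tilde H_1,\tilde H_2)\notin T$, where $T'=T\cup\{r@id(\tilde H_1)\}$ if $\tilde H_2=\emptyset$ and $T'=T$ otherwise. The computation of a goal $G$ starts in $\langle G,\emptyset,\mathtt{true},\emptyset\rangle_1$. For an annotated program, configurations are $\langle\tilde S,C,T\rangle_n$ ($\tilde S$ contains identified CHR constraints and built-in constraints); *Solve'* is as *Solve*, and *Apply'* is $\langle\tilde H_1\cup\tilde H_2\cup\tilde S,C,T\rangle_n\to\langle\tilde B'\cup\tilde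 H_1\cup\tilde S,E\wedge C,T'\cup T_r'\rangle_{m}$ for an annotated rule with body $\tilde B;T_r$, under the same conditions and with the same $E$, $T'$, where $(\tilde B',T'_r)$ is $(\tilde B,T_r)$ with all identifiers increased by $n$ and $m$ is $n$ plus the greatest identifier of $(\tilde B,T_r)$ (or plus $0$). The computation of $G$ starts with its $m$ CHR constraints numbered $1,\dots,m$, store `true`, no tokens and counter $m$. A configuration is failed if its built-in store is `false`; computations end there. $\mathcal{QA}_P(G)$ is the set of all $\exists_{-Fv(G)}(chr(\tilde K)\wedge d)$ such that the computation of $G$ can reach $\langle\emptyset,\tilde K,d,T\rangle_n$ from which no transition is possible, together with `false` if a failed configuration can be reached; $\mathcal{QA}'_{P}(G)$ is defined likewise for an annotated $P$, with final configurations $\langle\tilde K,d,T\rangle_n$. **Normal termination and confluence.** A configuration is built-in free if it is failed or its goal has no built-in constraint; a derivation is normal if *Apply* is used only on built-in free configurations. $P$ is normal terminating if there is no infinite normal computation. Configurations range over those in which the identifiers of $\tilde S$ are distinct and the identifiers of $\tilde S$ and $T$ are smaller than $n$. $P$ is normal confluent if, whenever two normal derivations lead from $\sigma$ to $\sigma_1$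 and to $\sigma_2$, there are derivations $\sigma_1\to^*\tau_1$ and $\sigma_2\to^*\tau_2$ such that $\tau_1,\tau_2$ are both failed, or identical up to renaming of variables not in $Fv(\sigma)$, renaming of identifiers, deletion of tokens with an identifier that does not occur in the CHR store, and logical equivalence of the built-in constraints. Answers are compared in the same way (both `false`, or identical up to renaming of variables not in $Fv(G)$ and logical equivalence of built-in constraints). The phrase "identical up to renaming of variables not in $V$ and logical equivalence of built-in constraints" may be read in two ways, and the result is asserted for each of them, used throughout: (a) a permutation of the variables that fixes $V$ makes the CHR constraints equal and the conjunctions of built-in constraints equivalent in $CT$; (b) in each model of $CT$ and for each valuation of $V$, the multisets of values of the (identified) CHR constraints, when the remaining variables range over all solutions of the built-in constraints, are the same. **Unfolding.** Let $r@H_1\backslash H_2\Leftrightarrow D\,|\,\tilde K,\tilde S_1,\tilde S_2,C;T$ be an annotated rule, $C$ being all the built-in constraints of its body, and $v@H_1'\backslash H_2'\Leftrightarrow D'\,|\,\tilde B;T'$ an annotated rule without common variables. Let $\theta$ be a substitution of the variables of $(H_1',H_2')$ with $CT\models(C\wedge D)\to chr(\tilde S_1,\tilde S_2)=(H_1',H_2')\theta$,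 let $v@id(\tilde S_1,\tilde S_2)\notin T$, let $D''$ consist of those $c$ in $D'$ with $CT\not\models C\wedge D\to c\theta$, and let $D\wedge D''\theta$ be satisfiable. Let $(\tilde B_1,T_1)$ be $(\tilde B,T')$ with identifiers increased by the greatest identifier of $r$. Then $r$ can be unfolded to $r@H_1\backslash H_2\Leftrightarrow D,D''\theta\,|\,\tilde K,\tilde S_1,\tilde B_1,C,chr(\tilde S_1,\tilde S_2)=(H_1',H_2');T''$, where $T''$ consists of the tokens of $T$ all of whose identifiers are in $(\tilde K,\tilde S_1)$, of $T_1$ and, if $H_2'=\emptyset$, of $v@id(\tilde S_1)$. $Unf_P(r)$ is the set of all rules obtained by unfolding $r$ with a rule of $P$. A rule $r\in P$ with guard $D$ can be weakly safely replaced in $P$ if some rule in $Unf_P(r)$ has a guard $D'$ with $CT\models D\leftrightarrow D'$. A WU-sequence from an annotated program $P$ is a sequence $P_0,\dots,P_n$ with $P_0=P$ and $P_{i+1}=(P_i\setminus\{r\})\cup Unf_{P_i}(r)$ for some $r\in P_i$ that can be weakly safely replaced in $P_i$. **Statement.** Let $P$ be a normal terminating and normal confluent CHR program and let $P_0,\dots,P_n$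 be a WU-sequence starting from $Ann(P)$. Then $\mathcal{QA}_P(G)=\mathcal{QA}'_{P_n}(G)$ for every goal $G$. -/

import Mathlib

universe u v w z

namespace CHR

open FirstOrder FirstOrder.Language

/-! ### Constraints.  Variables are natural numbers, terms are terms of a first-order language `L`,
built-in constraints are first-order formulas of `L` (with equality), and a conjunction of built-in
constraints is a finite multiset of them: `0` is `true`, any inconsistent one is `false`. -/

section Constraints

variable {L : FirstOrder.Language.{u, v}} {κ : Type w}

/-- A conjunction of built-in constraints. -/
abbrev Con (L : FirstOrder.Language.{u, v}) := Multiset (L.Formula ℕ)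

/-- A user-defined (CHR) constraint `p(t₁, …, tₖ)`. -/
structure Atom (L : FirstOrder.Language.{u, v}) (κ : Type w) where
  pred : κ
  args : List (L.Term ℕ)

/-- An identified CHR constraint `h#i`. -/
abbrev IdAtom (L : FirstOrder.Language.{u, v}) (κ : Type w) := Atom L κ × ℕ

/-- The constraint with all its variables replaced according to `θ`. -/
def Atom.subst (θ : ℕ → L.Term ℕ) (a : Atom L κ) : Atom L κ :=
  ⟨a.pred, a.args.map (fun t => t.subst θ)⟩

def Atom.rename (ρ : Equiv.Perm ℕ) (a : Atom L κ) : Atom L κ :=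
  ⟨a.pred, a.args.map (fun t => t.relabel ρ)⟩

def Atom.vars (a : Atom L κ) : Set ℕ := {x | ∃ t ∈ a.args, x ∈ t.varFinset}

/-- The value of a CHR constraint in a structure: its symbol and the values of its arguments. -/
def Atom.eval {M : Type z} [L.Structure M] (e : ℕ → M) (a : Atom L κ) : κ × List M :=
  (a.pred, a.args.map (fun t => t.realize e))

def Con.subst (θ : ℕ → L.Term ℕ) (C : Con L) : Con L :=
  C.map (fun c => BoundedFormula.subst c θ)

def Con.rename (ρ : Equiv.Perm ℕ) (C : Con L) : Con L :=
  C.map (fun c => Formula.relabel ρ c)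

def Con.vars (C : Con L) : Set ℕ := {x | ∃ c ∈ C, x ∈ BoundedFormula.freeVarFinset c}

/-- The conjunction `C` holds in the structure `M` under the valuation `e`. -/
def Con.Holds {M : Type z} [L.Structure M] (C : Con L) (e : ℕ → M) : Prop :=
  ∀ c ∈ C, Formula.Realize c e

/-- `CT ⊨ C → D`. -/
def Entails (CT : L.Theory) (C D : Con L) : Prop :=
  ∀ (M : Theory.ModelType.{u, v, max u v} CT) (e : ℕ → M), C.Holds e → D.Holds e

/-- `CT ⊨ C → ∃ X, D`. -/
def EntailsEx (CT : L.Theory) (C : Con L) (X : Set ℕ) (D : Con L) : Prop :=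
  ∀ (M : Theory.ModelType.{u, v, max u v} CT) (e : ℕ → M), C.Holds e →
    ∃ e' : ℕ → M, (∀ y, y ∉ X → e' y = e y) ∧ D.Holds e'

/-- `CT ⊨ C ↔ D`. -/
def Equivalent (CT : L.Theory) (C D : Con L) : Prop := Entails CT C D ∧ Entails CT D C

/-- `C` is inconsistent with `CT`, that is, `C` is one of the constraints written `false`. -/
def Inconsistent (CT : L.Theory) (C : Con L) : Prop :=
  ∀ (M : Theory.ModelType.{u, v, max u v} CT) (e : ℕ → M), ¬ C.Holds e

/-- `CT` entails Clark's equality theory: function symbols are injective, have disjoint ranges, and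
a variable is different from every other term in which it occurs. -/
structure ClarkEquality (CT : L.Theory) : Prop where
  injective : ∀ (M : Theory.ModelType.{u, v, max u v} CT) (n : ℕ) (f : L.Functions n)
    (a b : Fin n → M), Structure.funMap f a = Structure.funMap f b → a = b
  clash : ∀ (M : Theory.ModelType.{u, v, max u v} CT) (n m : ℕ) (f : L.Functions n)
    (g : L.Functions m) (a : Fin n → M) (b : Fin m → M),
    (⟨n, f⟩ : Σ k, L.Functions k) ≠ ⟨m, g⟩ → Structure.funMap f a ≠ Structure.funMap g b
  occurs : ∀ (M : Theory.ModelType.{u, v, max u v} CT) (x : ℕ) (t : L.Term ℕ) (e : ℕ → M),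
    x ∈ t.varFinset → t ≠ Term.var x → e x ≠ t.realize e

/-- The set of equalities `as = bs` between two sequences of CHR constraints is defined. -/
def Matches (as bs : List (Atom L κ)) : Prop :=
  List.Forall₂ (fun a b => a.pred = b.pred ∧ a.args.length = b.args.length) as bs

/-- The set of equalities `as = bs`; meaningful when `Matches as bs`. -/
def eqs (as bs : List (Atom L κ)) : Con L :=
  ((List.zipWith (fun a b => List.zipWith (fun s t => Term.equal s t) a.args b.args) as bs).flatten :
    List (L.Formula ℕ))

end Constraints

/-! ### Programs. -/

section Programs

variable {L : FirstOrder.Language.{u, v}} {κ : Type w} {ν : Type z}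

/-- A goal: CHR constraints (listed in the order in which they get numbered) and built-in ones. -/
structure Goal (L : FirstOrder.Language.{u, v}) (κ : Type w) where
  chr : List (Atom L κ)
  bi : Con L

def Goal.vars (G : Goal L κ) : Set ℕ := {x | (∃ a ∈ G.chr, x ∈ a.vars) ∨ x ∈ G.bi.vars}

/-- A (simpagation) rule `name @ kept \ removed ⇔ guard | body`. -/
structure Rule (L : FirstOrder.Language.{u, v}) (κ : Type w) (ν : Type z) where
  name : ν
  kept : List (Atom L κ)
  removed : List (Atom L κ)
  guard : Con L
  body : Goal L κ

def Rule.rename (ρ : Equiv.Perm ℕ) (r : Rule L κ ν) : Rule L κ ν where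
  name := r.name
  kept := r.kept.map (Atom.rename ρ)
  removed := r.removed.map (Atom.rename ρ)
  guard := r.guard.rename ρ
  body := ⟨r.body.chr.map (Atom.rename ρ), r.body.bi.rename ρ⟩

def Rule.headVars (r : Rule L κ ν) : Set ℕ := {x | ∃ a ∈ r.kept ++ r.removed, x ∈ a.vars}

def Rule.vars (r : Rule L κ ν) : Set ℕ := r.headVars ∪ r.guard.vars ∪ r.body.vars

/-- A CHR program: a finite set of rules with non-empty heads and pairwise different names. -/
structure IsProgram (P : Set (Rule L κ ν)) : Prop where
  finite : P.Finite
  unique_names : ∀ r ∈ P, ∀ s ∈ P, r.name = s.name → r = s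
  heads : ∀ r ∈ P, r.kept ++ r.removed ≠ []

/-- A token `r@i₁,…,iₗ`. -/
abbrev Token (ν : Type z) := ν × List ℕ

/-- An annotated rule `name @ kept \ removed ⇔ guard | chr, bi; tokens`. -/
structure ARule (L : FirstOrder.Language.{u, v}) (κ : Type w) (ν : Type z) where
  name : ν
  kept : List (Atom L κ)
  removed : List (Atom L κ)
  guard : Con L
  chr : Multiset (IdAtom L κ)
  bi : Con L
  tokens : Finset (Token ν)

def ARule.rename (ρ : Equiv.Perm ℕ) (r : ARule L κ ν) : ARule L κ ν where
  name := r.name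
  kept := r.kept.map (Atom.rename ρ)
  removed := r.removed.map (Atom.rename ρ)
  guard := r.guard.rename ρ
  chr := r.chr.map (fun p => (p.1.rename ρ, p.2))
  bi := r.bi.rename ρ
  tokens := r.tokens

def ARule.headVars (r : ARule L κ ν) : Set ℕ := {x | ∃ a ∈ r.kept ++ r.removed, x ∈ a.vars}

def ARule.vars (r : ARule L κ ν) : Set ℕ :=
  r.headVars ∪ r.guard.vars ∪ {x | ∃ p ∈ r.chr, x ∈ p.1.vars} ∪ r.bi.vars

/-- The identified version `I_0^m` of a sequence of `m` CHR constraints: identifiers `1, …, m`. -/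
def number (B : List (Atom L κ)) : Multiset (IdAtom L κ) := (B.zipIdx 1 : List (IdAtom L κ))

def Rule.annotate (r : Rule L κ ν) : ARule L κ ν where
  name := r.name
  kept := r.kept
  removed := r.removed
  guard := r.guard
  chr := number r.body.chr
  bi := r.body.bi
  tokens := ∅

/-- The annotated version of a program. -/
def Ann (P : Set (Rule L κ ν)) : Set (ARule L κ ν) := Rule.annotate '' P

/-- The greatest identifier in `(B, T)`, and `0` if there is none. -/
def maxId (B : Multiset (IdAtom L κ)) (T : Finset (Token ν)) : ℕ :=
  max (B.map Prod.snd).sup (T.sup (fun t => t.2.foldr max 0))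

/-! The function `inst` increments all identifiers by `n`; the new greatest identifier is then
`n + maxId B T`. -/

def shift (n : ℕ) (B : Multiset (IdAtom L κ)) : Multiset (IdAtom L κ) :=
  B.map (fun p => (p.1, p.2 + n))

def shiftTokens [DecidableEq ν] (n : ℕ) (T : Finset (Token ν)) : Finset (Token ν) :=
  T.image (fun t => (t.1, t.2.map (· + n)))

/-- Delete from `T` the tokens having an identifier that does not occur in `B`. -/
def clean (B : Multiset (IdAtom L κ)) (T : Finset (Token ν)) : Finset (Token ν) :=
  T.filter (fun t => ∀ i ∈ t.2, i ∈ B.map Prod.snd)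

end Programs

/-! ### The semantics of programs.  In a transition, `V` is the set of variables of the configuration
in which the computation starts; the variables of a rule are renamed away from `V` and from the
current configuration. -/

section Semantics

variable {L : FirstOrder.Language.{u, v}} {κ : Type w} {ν : Type z}

/-- Configurations `⟨goalChr ⊎ goalBi, chr, store, tokens⟩_counter`. -/
structure State (L : FirstOrder.Language.{u, v}) (κ : Type w) (ν : Type z) where
  goalChr : Multiset (Atom L κ)
  goalBi : Con L
  chr : Multiset (IdAtom L κ)
  store : Con L
  tokens : Finset (Token ν)
  counter : ℕ

/-- Identifiers distinguish the constraints of the store, and the counter is a free integer. -/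
structure State.WellFormed (σ : State L κ ν) : Prop where
  nodup : (σ.chr.map Prod.snd).Nodup
  chr_lt : ∀ p ∈ σ.chr, p.2 < σ.counter
  tokens_lt : ∀ t ∈ σ.tokens, ∀ i ∈ t.2, i < σ.counter

def State.vars (σ : State L κ ν) : Set ℕ :=
  {x | ∃ a ∈ σ.goalChr, x ∈ a.vars} ∪ σ.goalBi.vars ∪ {x | ∃ p ∈ σ.chr, x ∈ p.1.vars} ∪ σ.store.vars

def Goal.start (G : Goal L κ) : State L κ ν := ⟨G.chr, G.bi, 0, 0, ∅, 1⟩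

def State.Failed (CT : L.Theory) (σ : State L κ ν) : Prop := Inconsistent CT σ.store

def State.BuiltInFree (CT : L.Theory) (σ : State L κ ν) : Prop := σ.Failed CT ∨ σ.goalBi = 0

inductive Solve (CT : L.Theory) : State L κ ν → State L κ ν → Prop
  | intro (c : L.Formula ℕ) (A : Multiset (Atom L κ)) (B : Con L) (S : Multiset (IdAtom L κ))
      (C C' : Con L) (T : Finset (Token ν)) (n : ℕ) (h : Equivalent CT (c ::ₘ C) C') :
      Solve CT ⟨A, c ::ₘ B, S, C, T, n⟩ ⟨A, B, S, C', T, n⟩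

inductive Introduce : State L κ ν → State L κ ν → Prop
  | intro (h : Atom L κ) (A : Multiset (Atom L κ)) (B : Con L) (S : Multiset (IdAtom L κ))
      (C : Con L) (T : Finset (Token ν)) (n : ℕ) :
      Introduce ⟨h ::ₘ A, B, S, C, T, n⟩ ⟨A, B, (h, n) ::ₘ S, C, T, n + 1⟩

inductive Apply [DecidableEq ν] (CT : L.Theory) (P : Set (Rule L κ ν)) (V : Set ℕ) :
    State L κ ν → State L κ ν → Prop
  | intro (r₀ r : Rule L κ ν) (ρ : Equiv.Perm ℕ) (A : Multiset (Atom L κ)) (B : Con L)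
      (H₁ H₂ : List (IdAtom L κ)) (S : Multiset (IdAtom L κ)) (C : Con L) (T : Finset (Token ν))
      (n : ℕ) (hr₀ : r₀ ∈ P) (hr : r = r₀.rename ρ)
      (fresh_start : Disjoint r.vars V)
      (fresh_state : Disjoint r.vars
        (⟨A, B, (H₁ : Multiset (IdAtom L κ)) + H₂ + S, C, T, n⟩ : State L κ ν).vars)
      (match₁ : Matches (H₁.map Prod.fst) r.kept) (match₂ : Matches (H₂.map Prod.fst) r.removed)
      (guard : EntailsEx CT C r.headVars
        (eqs ((H₁ ++ H₂).map Prod.fst) (r.kept ++ r.removed) + r.guard))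
      (token : (r.name, (H₁ ++ H₂).map Prod.snd) ∉ T) :
      Apply CT P V ⟨A, B, (H₁ : Multiset (IdAtom L κ)) + H₂ + S, C, T, n⟩
        ⟨(r.body.chr : Multiset (Atom L κ)) + A, r.body.bi + B, (H₁ : Multiset (IdAtom L κ)) + S,
          eqs ((H₁ ++ H₂).map Prod.fst) (r.kept ++ r.removed) + C,
          if H₂ = [] then insert (r.name, H₁.map Prod.snd) T else T, n⟩

def Step [DecidableEq ν] (CT : L.Theory) (P : Set (Rule L κ ν)) (V : Set ℕ) (σ τ : State L κ ν) :
    Prop :=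
  Solve CT σ τ ∨ Introduce σ τ ∨ Apply CT P V σ τ

/-- The steps of normal derivations: `Apply` is used on built-in free configurations only. -/
def NormalStep [DecidableEq ν] (CT : L.Theory) (P : Set (Rule L κ ν)) (V : Set ℕ)
    (σ τ : State L κ ν) : Prop :=
  Solve CT σ τ ∨ Introduce σ τ ∨ (σ.BuiltInFree CT ∧ Apply CT P V σ τ)

/-- No infinite normal computations (a failed configuration is final, so a computation ends there). -/
def NormalTerminating [DecidableEq ν] (CT : L.Theory) (P : Set (Rule L κ ν)) : Prop :=
  ¬ ∃ s : ℕ → State L κ ν, (s 0).WellFormed ∧ (∀ i, ¬ (s i).Failed CT) ∧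
    ∀ i, NormalStep CT P (s 0).vars (s i) (s (i + 1))

/-- The two ways of reading `identical up to renaming of local variables and logical equivalence of
built-in constraints`: by means of an actual renaming, or as logical equivalence of the formulas
that consist of the CHR constraints and of the built-in ones, with local variables quantified. -/
inductive Reading
  | renaming
  | logical

/-- `A, D` and `A', D'` are the same up to renaming of the variables outside `V` and logical
equivalence.  In the second reading, for each model of `CT` and each valuation of `V`, the multisets
of values of the (tagged) CHR constraints, as the other variables range over the solutions of the
built-in constraints, are the same. -/
def Same {τ : Type*} (CT : L.Theory) (V : Set ℕ) :
    Reading → Multiset (Atom L κ × τ) → Con L → Multiset (Atom L κ × τ) → Con L → Prop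
  | .renaming, A, D, A', D' => ∃ ρ : Equiv.Perm ℕ, (∀ x ∈ V, ρ x = x) ∧
      A.map (fun p => (p.1.rename ρ, p.2)) = A' ∧ Equivalent CT (D.rename ρ) D'
  | .logical, A, D, A', D' => ∀ (M : Theory.ModelType.{u, v, max u v} CT) (e : ℕ → M),
      {m | ∃ e' : ℕ → M, (∀ x ∈ V, e' x = e x) ∧ D.Holds e' ∧
        A.map (fun p => (p.1.eval e', p.2)) = m} =
      {m | ∃ e' : ℕ → M, (∀ x ∈ V, e' x = e x) ∧ D'.Holds e' ∧
        A'.map (fun p => (p.1.eval e', p.2)) = m}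

/-- The CHR constraints of a configuration: those of the goal without an identifier, those of the
store with their identifiers renamed by `π`. -/
def State.tagged (σ : State L κ ν) (π : Equiv.Perm ℕ) : Multiset (Atom L κ × Option ℕ) :=
  σ.goalChr.map (fun a => (a, none)) + σ.chr.map (fun p => (p.1, some (π p.2)))

/-- Equivalence of configurations with respect to `V`: both are failed, or they are identical up to
renaming of variables not in `V`, renaming of identifiers, cleaning of the token store and logical
equivalence of the built-in constraints. -/
def StateEquiv [DecidableEq ν] (CT : L.Theory) (E : Reading) (V : Set ℕ) (σ τ : State L κ ν) :
    Prop :=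
  (σ.Failed CT ∧ τ.Failed CT) ∨
    ∃ π : Equiv.Perm ℕ,
      (clean σ.chr σ.tokens).image (fun t => (t.1, t.2.map π)) = clean τ.chr τ.tokens ∧
      Same CT V E (σ.tagged π) (σ.goalBi + σ.store) (τ.tagged 1) (τ.goalBi + τ.store)

def NormalConfluent [DecidableEq ν] (CT : L.Theory) (E : Reading) (P : Set (Rule L κ ν)) : Prop :=
  ∀ σ σ₁ σ₂ : State L κ ν, σ.WellFormed →
    Relation.ReflTransGen (NormalStep CT P σ.vars) σ σ₁ →
    Relation.ReflTransGen (NormalStep CT P σ.vars) σ σ₂ →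
    ∃ τ₁ τ₂ : State L κ ν, Relation.ReflTransGen (Step CT P σ.vars) σ₁ τ₁ ∧
      Relation.ReflTransGen (Step CT P σ.vars) σ₂ τ₂ ∧ StateEquiv CT E σ.vars τ₁ τ₂

/-- An answer `∃_{-V} (chr ∧ bi)`, where `V` is the set of variables of the goal. -/
structure Answer (L : FirstOrder.Language.{u, v}) (κ : Type w) where
  chr : Multiset (Atom L κ)
  bi : Con L

/-- The answer `false`. -/
def Answer.fail : Answer L κ := ⟨0, {⊥}⟩

/-- Two answers are the same: both are `false`, or they are identical up to renaming of the variables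
not in `V` and logical equivalence of built-in constraints. -/
def AnswerEquiv (CT : L.Theory) (E : Reading) (V : Set ℕ) (a b : Answer L κ) : Prop :=
  (Inconsistent CT a.bi ∧ Inconsistent CT b.bi) ∨
    Same CT V E (a.chr.map (fun h => (h, ()))) a.bi (b.chr.map (fun h => (h, ()))) b.bi

/-- The answers computed by a program. -/
inductive Computed [DecidableEq ν] (CT : L.Theory) (P : Set (Rule L κ ν)) (G : Goal L κ) :
    Answer L κ → Prop
  | success (K : Multiset (IdAtom L κ)) (d : Con L) (T : Finset (Token ν)) (n : ℕ)
      (h : Relation.ReflTransGen (Step CT P G.vars) G.start ⟨0, 0, K, d, T, n⟩)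
      (final : ∀ τ, ¬ Step CT P G.vars ⟨0, 0, K, d, T, n⟩ τ) :
      Computed CT P G ⟨K.map Prod.fst, d⟩
  | failure (σ : State L κ ν) (h : Relation.ReflTransGen (Step CT P G.vars) G.start σ)
      (failed : σ.Failed CT) : Computed CT P G Answer.fail

/-- The qualified answers of `G` in the program `P`, closed under sameness of answers. -/
def QA [DecidableEq ν] (CT : L.Theory) (E : Reading) (P : Set (Rule L κ ν)) (G : Goal L κ) :
    Set (Answer L κ) :=
  {a | ∃ b, Computed CT P G b ∧ AnswerEquiv CT E G.vars b a}

end Semantics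

/-! ### The semantics of annotated programs. -/

section AnnotatedSemantics

variable {L : FirstOrder.Language.{u, v}} {κ : Type w} {ν : Type z}

/-- Configurations `⟨chr ⊎ bi, store, tokens⟩_counter`. -/
structure AState (L : FirstOrder.Language.{u, v}) (κ : Type w) (ν : Type z) where
  chr : Multiset (IdAtom L κ)
  bi : Con L
  store : Con L
  tokens : Finset (Token ν)
  counter : ℕ

def AState.vars (σ : AState L κ ν) : Set ℕ :=
  {x | ∃ p ∈ σ.chr, x ∈ p.1.vars} ∪ σ.bi.vars ∪ σ.store.vars

def Goal.astart (G : Goal L κ) : AState L κ ν := ⟨number G.chr, G.bi, 0, ∅, G.chr.length⟩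

inductive ASolve (CT : L.Theory) : AState L κ ν → AState L κ ν → Prop
  | intro (c : L.Formula ℕ) (S : Multiset (IdAtom L κ)) (B : Con L)
      (C C' : Con L) (T : Finset (Token ν)) (n : ℕ) (h : Equivalent CT (c ::ₘ C) C') :
      ASolve CT ⟨S, c ::ₘ B, C, T, n⟩ ⟨S, B, C', T, n⟩

inductive AApply [DecidableEq ν] (CT : L.Theory) (P : Set (ARule L κ ν)) (V : Set ℕ) :
    AState L κ ν → AState L κ ν → Prop
  | intro (r₀ r : ARule L κ ν) (ρ : Equiv.Perm ℕ) (B : Con L)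
      (H₁ H₂ : List (IdAtom L κ)) (S : Multiset (IdAtom L κ)) (C : Con L) (T : Finset (Token ν))
      (n : ℕ) (hr₀ : r₀ ∈ P) (hr : r = r₀.rename ρ)
      (fresh_start : Disjoint r.vars V)
      (fresh_state : Disjoint r.vars
        (⟨(H₁ : Multiset (IdAtom L κ)) + H₂ + S, B, C, T, n⟩ : AState L κ ν).vars)
      (match₁ : Matches (H₁.map Prod.fst) r.kept) (match₂ : Matches (H₂.map Prod.fst) r.removed)
      (guard : EntailsEx CT C r.headVars
        (eqs ((H₁ ++ H₂).map Prod.fst) (r.kept ++ r.removed) + r.guard))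
      (token : (r.name, (H₁ ++ H₂).map Prod.snd) ∉ T) :
      AApply CT P V ⟨(H₁ : Multiset (IdAtom L κ)) + H₂ + S, B, C, T, n⟩
        ⟨shift n r.chr + (H₁ : Multiset (IdAtom L κ)) + S, r.bi + B,
          eqs ((H₁ ++ H₂).map Prod.fst) (r.kept ++ r.removed) + C,
          (if H₂ = [] then insert (r.name, H₁.map Prod.snd) T else T) ∪ shiftTokens n r.tokens,
          n + maxId r.chr r.tokens⟩

def AStep [DecidableEq ν] (CT : L.Theory) (P : Set (ARule L κ ν)) (V : Set ℕ)
    (σ τ : AState L κ ν) : Prop :=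
  ASolve CT σ τ ∨ AApply CT P V σ τ

/-- The answers computed by an annotated program. -/
inductive AComputed [DecidableEq ν] (CT : L.Theory) (P : Set (ARule L κ ν)) (G : Goal L κ) :
    Answer L κ → Prop
  | success (K : Multiset (IdAtom L κ)) (d : Con L) (T : Finset (Token ν)) (n : ℕ)
      (h : Relation.ReflTransGen (AStep CT P G.vars) G.astart ⟨K, 0, d, T, n⟩)
      (final : ∀ τ, ¬ AStep CT P G.vars ⟨K, 0, d, T, n⟩ τ) :
      AComputed CT P G ⟨K.map Prod.fst, d⟩
  | failure (σ : AState L κ ν) (h : Relation.ReflTransGen (AStep CT P G.vars) G.astart σ)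
      (failed : Inconsistent CT σ.store) : AComputed CT P G Answer.fail

/-- The qualified answers of `G` in the annotated program `P`, closed under sameness of answers. -/
def AQA [DecidableEq ν] (CT : L.Theory) (E : Reading) (P : Set (ARule L κ ν)) (G : Goal L κ) :
    Set (Answer L κ) :=
  {a | ∃ b, AComputed CT P G b ∧ AnswerEquiv CT E G.vars b a}

end AnnotatedSemantics

/-! ### Unfolding and weak safe replacement. -/

section Unfolding

variable {L : FirstOrder.Language.{u, v}} {κ : Type w} {ν : Type z}

open Classical in
/-- The part of the guard `D'θ` that is not entailed by `C`. -/
noncomputable def residualGuard (CT : L.Theory) (C D' : Con L) (θ : ℕ → L.Term ℕ) : Con L :=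
  Con.subst θ (D'.filter (fun c => ¬ Entails CT C (Con.subst θ {c})))

/-- `r'` is the result of unfolding `r` with `v`, which has no variable in common with `r`. -/
inductive Unfolds [DecidableEq ν] (CT : L.Theory) (r v : ARule L κ ν) : ARule L κ ν → Prop
  | intro (K : Multiset (IdAtom L κ)) (S₁ S₂ : List (IdAtom L κ)) (θ : ℕ → L.Term ℕ)
      (apart : Disjoint r.vars v.vars)
      (body : r.chr = K + (S₁ : Multiset (IdAtom L κ)) + (S₂ : Multiset (IdAtom L κ)))
      (match₁ : Matches (S₁.map Prod.fst) v.kept) (match₂ : Matches (S₂.map Prod.fst) v.removed)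
      (dom : ∀ x, x ∉ v.headVars → θ x = Term.var x)
      (matching : Entails CT (r.bi + r.guard)
        (eqs ((S₁ ++ S₂).map Prod.fst) ((v.kept ++ v.removed).map (Atom.subst θ))))
      (token : (v.name, (S₁ ++ S₂).map Prod.snd) ∉ r.tokens)
      (satisfiable : ¬ Inconsistent CT (r.guard + residualGuard CT (r.bi + r.guard) v.guard θ)) :
      Unfolds CT r v
        { name := r.name
          kept := r.kept
          removed := r.removed
          guard := r.guard + residualGuard CT (r.bi + r.guard) v.guard θ
          chr := K + (S₁ : Multiset (IdAtom L κ)) + shift (maxId r.chr r.tokens) v.chr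
          bi := v.bi + r.bi + eqs ((S₁ ++ S₂).map Prod.fst) (v.kept ++ v.removed)
          tokens := clean (K + (S₁ : Multiset (IdAtom L κ))) r.tokens ∪ shiftTokens (maxId r.chr r.tokens) v.tokens ∪
            (if v.removed = [] then {(v.name, S₁.map Prod.snd)} else ∅) }

/-- All rules obtained by unfolding `r` with a (renamed) rule of `P`. -/
def Unf [DecidableEq ν] (CT : L.Theory) (P : Set (ARule L κ ν)) (r : ARule L κ ν) :
    Set (ARule L κ ν) :=
  {r' | ∃ v ∈ P, ∃ ρ : Equiv.Perm ℕ, Unfolds CT r (v.rename ρ) r'}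

/-- The rule `r` of `P` can be weakly safely replaced in `P`. -/
def WeaklySafe [DecidableEq ν] (CT : L.Theory) (P : Set (ARule L κ ν)) (r : ARule L κ ν) : Prop :=
  r ∈ P ∧ ∃ r' ∈ Unf CT P r, Equivalent CT r.guard r'.guard

/-- Rules are considered up to renaming of their variables. -/
def Variant (r s : ARule L κ ν) : Prop := ∃ ρ : Equiv.Perm ℕ, s = r.rename ρ

/-- The two sets of rules are the same up to renaming of the variables of each rule. -/
def SameRules (P Q : Set (ARule L κ ν)) : Prop :=
  (∀ r ∈ P, ∃ s ∈ Q, Variant r s) ∧ ∀ s ∈ Q, ∃ r ∈ P, Variant r s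

/-- `Q 0, …, Q n` is a sequence of weak safe replacements that starts from `P`. -/
def IsWUSequence [DecidableEq ν] (CT : L.Theory) (P : Set (ARule L κ ν)) (n : ℕ)
    (Q : ℕ → Set (ARule L κ ν)) : Prop :=
  Q 0 = P ∧ ∀ i < n, ∃ r, WeaklySafe CT (Q i) r ∧
    SameRules (Q (i + 1)) ((Q i \ {s | Variant r s}) ∪ Unf CT (Q i) r)

end Unfolding

end CHR

namespace CHR

open FirstOrder FirstOrder.Language

/-! ### Variables of terms and formulas -/

section Relabelling

variable {L : FirstOrder.Language.{u, v}}

/-! Both programs are compared on configurations (`Conf`) in which all goal constraints are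
introduced and all built-in constraints are solved, so that the only move left is a rule
application, `Fire`. Introducing and solving early loses nothing: it enlarges the CHR store and
strengthens the built-in store, and neither disables a rule. Hence every derivation, plain or
annotated, projects to a sequence of `Fire` steps (`Represents.step`, `ARepresents.step`).
Conversely, every sequence of `Fire` steps from a goal lifts to a derivation, which for a plain
program can be chosen normal (`Sim.normal_of_transGen`, `Outcome.acomputed`). All this is up to
`Sim`: renaming of local variables and of identifiers, equivalence of stores, and tokens that
mention dead identifiers. `Sim.fire` shows that `Fire` respects `Sim`.

Two facts link a program to its replacement. Applying an unfolded rule has the same effect as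
applying the original rule and then the unfolding one (`Unfolds.decompose`). Clark's theory enters
here: function symbols are injective, so the equations of a match determine the head variables, and
a guard that was satisfiable by some choice of them holds in the new store. In the other direction,
weak safety provides an unfolding with the same head and an equivalent guard, so if the old program
can fire, the new one can as well (`exists_fire_of_fire`). By induction along the sequence, each
step of the last program amounts to one or more steps of `Ann P`, and its final configurations are
final for `Ann P`. Its outcomes are therefore outcomes of `P` (`Outcome.of_simulates`).

Replacement may lose derivations, so the converse inclusion comes from elsewhere. By confluence all
outcomes of `P` carry the same answer (`Outcome.answerEquiv`). By termination the last program has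
at least one outcome, because each of its steps costs at least one normal step of `P`
(`exists_outcome`). That outcome is also an outcome of `P`, so it carries the only answer there is.
-/

theorem Term.mem_varFinset_relabel {α β : Type*} [DecidableEq α] [DecidableEq β] (g : α → β)
    (t : L.Term α) (x : β) :
    x ∈ (t.relabel g).varFinset ↔ ∃ y ∈ t.varFinset, g y = x := by
  induction t with
  | var a => simp [Term.varFinset, eq_comm]
  | func f ts ih =>
    simp only [Term.relabel, Term.varFinset, Finset.mem_biUnion, Finset.mem_univ, true_and, ih]
    tauto

theorem Term.relabel_congr {α β : Type*} [DecidableEq α] {g h : α → β} (t : L.Term α)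
    (H : ∀ x ∈ t.varFinset, g x = h x) : t.relabel g = t.relabel h := by
  induction t with
  | var a => simpa using H a (by simp)
  | func f ts ih =>
    simp only [Term.relabel, Term.func.injEq, heq_eq_eq, true_and]
    funext i
    exact ih i fun x hx => H x (by
      simp only [Term.varFinset, Finset.mem_biUnion]; exact ⟨i, by simp, hx⟩)

theorem Term.realize_congr {α M : Type*} [L.Structure M] [DecidableEq α] {e e' : α → M}
    (t : L.Term α) (H : ∀ x ∈ t.varFinset, e x = e' x) : t.realize e = t.realize e' := by
  induction t with
  | var a => simpa using H a (by simp)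
  | func f ts ih =>
    simp only [Term.realize]
    congr 1
    funext i
    exact ih i fun x hx => H x (by
      simp only [Term.varFinset, Finset.mem_biUnion]; exact ⟨i, by simp, hx⟩)

theorem Term.mem_varFinsetLeft_relabel_map {α β γ δ : Type*} [DecidableEq α] [DecidableEq β]
    (g : α → β) (f : γ → δ) (t : L.Term (α ⊕ γ)) (x : β) :
    x ∈ (t.relabel (Sum.map g f)).varFinsetLeft ↔ ∃ y ∈ t.varFinsetLeft, g y = x := by
  induction t with
  | var a => cases a <;> simp [eq_comm]
  | func f ts ih =>
    simp only [Term.relabel, Term.varFinsetLeft, Finset.mem_biUnion, Finset.mem_univ, true_and, ih]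
    tauto

theorem Term.relabel_map_congr {α β γ δ : Type*} [DecidableEq α] {g h : α → β} (f : γ → δ)
    (t : L.Term (α ⊕ γ)) (H : ∀ x ∈ t.varFinsetLeft, g x = h x) :
    t.relabel (Sum.map g f) = t.relabel (Sum.map h f) := by
  induction t with
  | var a =>
    cases a with
    | inl a => simpa using H a (by simp)
    | inr a => simp
  | func f ts ih =>
    simp only [Term.relabel, Term.func.injEq, heq_eq_eq, true_and]
    funext i
    exact ih i fun x hx => H x (by
      simp only [Term.varFinsetLeft, Finset.mem_biUnion]; exact ⟨i, by simp, hx⟩)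

theorem Term.realize_elim_congr {α γ M : Type*} [L.Structure M] [DecidableEq α] {e e' : α → M}
    (xs : γ → M) (t : L.Term (α ⊕ γ)) (H : ∀ x ∈ t.varFinsetLeft, e x = e' x) :
    t.realize (Sum.elim e xs) = t.realize (Sum.elim e' xs) := by
  induction t with
  | var a =>
    cases a with
    | inl a => simpa using H a (by simp)
    | inr a => simp
  | func f ts ih =>
    simp only [Term.realize]
    congr 1
    funext i
    exact ih i fun x hx => H x (by
      simp only [Term.varFinsetLeft, Finset.mem_biUnion]; exact ⟨i, by simp, hx⟩)

/-- Renames the free variables of a bounded formula, without any cast. -/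
def mapVars {α β : Type*} (g : α → β) {n : ℕ} (φ : L.BoundedFormula α n) : L.BoundedFormula β n :=
  φ.mapTermRel (fun _ t => t.relabel (Sum.map g id)) (fun _ => id) fun _ => id

theorem mapVars_mapVars {α β γ : Type*} (g : α → β) (h : β → γ) {n : ℕ}
    (φ : L.BoundedFormula α n) : mapVars h (mapVars g φ) = mapVars (h ∘ g) φ := by
  unfold mapVars
  rw [BoundedFormula.mapTermRel_mapTermRel]
  congr 1
  funext n t
  simp [Term.relabel_relabel, Sum.map_comp_map]

theorem mapVars_id {α : Type*} {n : ℕ} (φ : L.BoundedFormula α n) : mapVars id φ = φ := by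
  unfold mapVars
  convert BoundedFormula.mapTermRel_id_id_id φ
  simp

/-- `Formula.relabel` passes through `β ⊕ Fin 0` and the index `0 + n`. Removing this detour once
reduces all facts about it to structural inductions on `mapVars`. -/
theorem boundedFormula_relabel_eq {α β : Type*} (g : α → β) {n : ℕ} (φ : L.BoundedFormula α n) :
    BoundedFormula.relabel (Sum.inl ∘ g : α → β ⊕ Fin 0) φ =
      (mapVars g φ).castLE (zero_add n).ge := by
  have aux : ∀ k, BoundedFormula.relabelAux (Sum.inl ∘ g : α → β ⊕ Fin 0) k =
      Sum.map id (Fin.castLE (zero_add k).ge) ∘ Sum.map g id := by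
    intro k
    funext x
    cases x with
    | inl x => simp [BoundedFormula.relabelAux]
    | inr x => simp [BoundedFormula.relabelAux]; ext; simp
  induction φ with
  | falsum => rfl
  | equal => simp [BoundedFormula.relabel, BoundedFormula.mapTermRel, mapVars, aux]
  | rel =>
    simp [BoundedFormula.relabel, BoundedFormula.mapTermRel, mapVars, aux]
    funext i
    simp [Term.relabel_relabel, Sum.map_comp_map]
  | imp _ _ ih1 ih2 => rw [BoundedFormula.relabel_imp, ih1, ih2]; rfl
  | all _ ih => rw [BoundedFormula.relabel_all, ih]; rfl

theorem relabel_eq_mapVars {α β : Type*} (g : α → β) (φ : L.Formula α) :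
    Formula.relabel g φ = mapVars g φ := by
  unfold Formula.relabel
  rw [boundedFormula_relabel_eq]
  exact BoundedFormula.castLE_rfl _ _

theorem Formula.relabel_relabel {α β γ : Type*} (g : α → β) (h : β → γ) (φ : L.Formula α) :
    Formula.relabel h (Formula.relabel g φ) = Formula.relabel (h ∘ g) φ := by
  simp only [relabel_eq_mapVars]
  exact mapVars_mapVars g h φ

theorem Formula.relabel_id {α : Type*} (φ : L.Formula α) : Formula.relabel id φ = φ := by
  rw [relabel_eq_mapVars, mapVars_id]

theorem mem_freeVarFinset_mapVars {α β : Type*} [DecidableEq α] [DecidableEq β] (g : α → β) {n : ℕ}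
    (φ : L.BoundedFormula α n) (x : β) :
    x ∈ (mapVars g φ).freeVarFinset ↔ ∃ y ∈ φ.freeVarFinset, g y = x := by
  induction φ with
  | falsum => simp [mapVars, BoundedFormula.mapTermRel]
  | equal =>
    simp only [mapVars, BoundedFormula.mapTermRel, BoundedFormula.freeVarFinset, Finset.mem_union,
      Term.mem_varFinsetLeft_relabel_map]
    grind
  | rel =>
    simp only [mapVars, BoundedFormula.mapTermRel, BoundedFormula.freeVarFinset,
      Finset.mem_biUnion, Finset.mem_univ, true_and, Term.mem_varFinsetLeft_relabel_map]
    grind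
  | imp _ _ ih1 ih2 =>
    simp only [mapVars, BoundedFormula.mapTermRel, BoundedFormula.freeVarFinset,
      Finset.mem_union] at *
    rw [ih1, ih2]
    grind
  | all _ ih => exact ih

theorem mapVars_congr {α β : Type*} [DecidableEq α] {g h : α → β} {n : ℕ}
    (φ : L.BoundedFormula α n) (H : ∀ x ∈ φ.freeVarFinset, g x = h x) :
    mapVars g φ = mapVars h φ := by
  induction φ with
  | falsum => rfl
  | equal =>
    simp only [BoundedFormula.freeVarFinset, Finset.mem_union] at H
    simp only [mapVars, BoundedFormula.mapTermRel]
    rw [Term.relabel_map_congr _ _ fun x hx => H x (Or.inl hx),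
      Term.relabel_map_congr _ _ fun x hx => H x (Or.inr hx)]
  | rel =>
    simp only [BoundedFormula.freeVarFinset, Finset.mem_biUnion, Finset.mem_univ, true_and] at H
    simp only [mapVars, BoundedFormula.mapTermRel]
    congr 1
    funext i
    exact Term.relabel_map_congr _ _ fun x hx => H x ⟨i, hx⟩
  | imp _ _ ih1 ih2 =>
    simp only [BoundedFormula.freeVarFinset, Finset.mem_union] at H
    have h1 := ih1 fun x hx => H x (Or.inl hx)
    have h2 := ih2 fun x hx => H x (Or.inr hx)
    simp only [mapVars, BoundedFormula.mapTermRel] at *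
    rw [h1, h2]
  | all _ ih =>
    have h1 := ih H
    simp only [mapVars, BoundedFormula.mapTermRel] at *
    rw [h1]

theorem BoundedFormula.realize_congr {α M : Type*} [L.Structure M] [DecidableEq α] {n : ℕ}
    {e e' : α → M} (φ : L.BoundedFormula α n) (H : ∀ x ∈ φ.freeVarFinset, e x = e' x)
    (xs : Fin n → M) : φ.Realize e xs ↔ φ.Realize e' xs := by
  induction φ with
  | falsum => rfl
  | equal =>
    simp only [BoundedFormula.freeVarFinset, Finset.mem_union] at H
    simp only [BoundedFormula.Realize]
    rw [Term.realize_elim_congr _ _ fun x hx => H x (Or.inl hx),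
      Term.realize_elim_congr _ _ fun x hx => H x (Or.inr hx)]
  | rel =>
    simp only [BoundedFormula.freeVarFinset, Finset.mem_biUnion, Finset.mem_univ, true_and] at H
    simp only [BoundedFormula.Realize]
    refine iff_of_eq (congrArg _ ?_)
    funext i
    exact Term.realize_elim_congr _ _ fun x hx => H x ⟨i, hx⟩
  | imp _ _ ih1 ih2 =>
    simp only [BoundedFormula.freeVarFinset, Finset.mem_union] at H
    simp only [BoundedFormula.Realize]
    rw [ih1 (fun x hx => H x (Or.inl hx)), ih2 (fun x hx => H x (Or.inr hx))]
  | all _ ih =>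
    simp only [BoundedFormula.Realize]
    exact forall_congr' fun a => ih H _

end Relabelling

/-! ### Renaming of atoms and constraints -/

section Renaming

variable {L : FirstOrder.Language.{u, v}} {κ : Type w}

theorem Atom.mem_vars_rename {ρ : Equiv.Perm ℕ} {a : Atom L κ} {x : ℕ} :
    x ∈ (a.rename ρ).vars ↔ ∃ y ∈ a.vars, ρ y = x := by
  simp only [Atom.vars, Atom.rename, List.mem_map, Set.mem_ofPred_eq]
  constructor
  · rintro ⟨_, ⟨t, ht, rfl⟩, hx⟩
    obtain ⟨y, hy, rfl⟩ := (Term.mem_varFinset_relabel _ _ _).1 hx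
    exact ⟨y, ⟨t, ht, hy⟩, rfl⟩
  · rintro ⟨y, ⟨t, ht, hy⟩, rfl⟩
    exact ⟨_, ⟨t, ht, rfl⟩, (Term.mem_varFinset_relabel _ _ _).2 ⟨y, hy, rfl⟩⟩

theorem Atom.rename_congr {ρ σ : Equiv.Perm ℕ} {a : Atom L κ} (h : ∀ x ∈ a.vars, ρ x = σ x) :
    a.rename ρ = a.rename σ := by
  simp only [Atom.rename, Atom.mk.injEq, true_and]
  exact List.map_congr_left fun t ht => Term.relabel_congr t fun x hx => h x ⟨t, ht, hx⟩

@[simp]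
theorem Atom.rename_one (a : Atom L κ) : a.rename 1 = a := by
  cases a
  simp [Atom.rename, Equiv.Perm.coe_one, Term.relabel_id_eq_id]

theorem Atom.rename_rename (ρ σ : Equiv.Perm ℕ) (a : Atom L κ) :
    (a.rename ρ).rename σ = a.rename (σ * ρ) := by
  simp [Atom.rename, Equiv.Perm.coe_mul, Term.relabel_comp_relabel]

theorem Atom.eval_rename {M : Type z} [L.Structure M] (e : ℕ → M) (ρ : Equiv.Perm ℕ)
    (a : Atom L κ) : (a.rename ρ).eval e = a.eval (e ∘ ρ) := by
  simp [Atom.rename, Atom.eval, Function.comp_def, Term.realize_relabel]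

theorem Atom.eval_congr {M : Type z} [L.Structure M] {e e' : ℕ → M} {a : Atom L κ}
    (h : ∀ x ∈ a.vars, e x = e' x) : a.eval e = a.eval e' := by
  simp only [Atom.eval, Prod.mk.injEq, true_and]
  exact List.map_congr_left fun t ht => Term.realize_congr t fun x hx => h x ⟨t, ht, hx⟩

theorem Atom.eval_subst {M : Type z} [L.Structure M] (e : ℕ → M) (θ : ℕ → L.Term ℕ)
    (a : Atom L κ) : (a.subst θ).eval e = a.eval fun x => (θ x).realize e := by
  simp [Atom.subst, Atom.eval, Function.comp_def, Term.realize_subst]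

theorem Con.mem_vars_rename {ρ : Equiv.Perm ℕ} {C : Con L} {x : ℕ} :
    x ∈ Con.vars (Con.rename ρ C) ↔ ∃ y ∈ Con.vars C, ρ y = x := by
  simp only [Con.vars, Con.rename, Multiset.mem_map, Set.mem_ofPred_eq]
  constructor
  · rintro ⟨_, ⟨c, hc, rfl⟩, hx⟩
    rw [relabel_eq_mapVars, mem_freeVarFinset_mapVars] at hx
    obtain ⟨y, hy, rfl⟩ := hx
    exact ⟨y, ⟨c, hc, hy⟩, rfl⟩
  · rintro ⟨y, ⟨c, hc, hy⟩, rfl⟩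
    refine ⟨_, ⟨c, hc, rfl⟩, ?_⟩
    rw [relabel_eq_mapVars, mem_freeVarFinset_mapVars]
    exact ⟨y, hy, rfl⟩

theorem Con.rename_congr {ρ σ : Equiv.Perm ℕ} {C : Con L} (h : ∀ x ∈ Con.vars C, ρ x = σ x) :
    Con.rename ρ C = Con.rename σ C := by
  refine Multiset.map_congr rfl fun c hc => ?_
  rw [relabel_eq_mapVars, relabel_eq_mapVars]
  exact mapVars_congr c fun x hx => h x ⟨c, hc, hx⟩

@[simp]
theorem Con.rename_one (C : Con L) : Con.rename 1 C = C := by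
  simp [Con.rename, Equiv.Perm.coe_one, Formula.relabel_id]

theorem Con.rename_rename (ρ σ : Equiv.Perm ℕ) (C : Con L) :
    Con.rename σ (Con.rename ρ C) = Con.rename (σ * ρ) C := by
  simp [Con.rename, Equiv.Perm.coe_mul, Formula.relabel_relabel]

@[simp]
theorem Con.rename_add (ρ : Equiv.Perm ℕ) (C D : Con L) :
    Con.rename ρ (C + D) = Con.rename ρ C + Con.rename ρ D := Multiset.map_add _ _ _

@[simp]
theorem Con.vars_add (C D : Con L) : Con.vars (C + D) = Con.vars C ∪ Con.vars D := by
  ext x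
  simp only [Con.vars, Multiset.mem_add, Set.mem_ofPred_eq, Set.mem_union]
  grind

theorem Con.holds_rename {M : Type z} [L.Structure M] (ρ : Equiv.Perm ℕ) (C : Con L)
    (e : ℕ → M) : Con.Holds (Con.rename ρ C) e ↔ C.Holds (e ∘ ρ) := by
  simp [Con.Holds, Con.rename, Formula.realize_relabel]

theorem Con.holds_congr {M : Type z} [L.Structure M] {C : Con L} {e e' : ℕ → M}
    (h : ∀ x ∈ Con.vars C, e x = e' x) : C.Holds e ↔ C.Holds e' :=
  forall₂_congr fun c hc =>
    BoundedFormula.realize_congr (e := e) (e' := e') c (fun x hx => h x ⟨c, hc, hx⟩) _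

@[simp]
theorem Con.holds_add {M : Type z} [L.Structure M] {C D : Con L} {e : ℕ → M} :
    Con.Holds (C + D) e ↔ C.Holds e ∧ D.Holds e := by
  simp only [Con.Holds, Multiset.mem_add]
  grind

@[simp]
theorem Con.holds_zero {M : Type z} [L.Structure M] {e : ℕ → M} :
    Con.Holds (0 : Con L) e := by
  simp [Con.Holds]

@[simp]
theorem Con.holds_cons {M : Type z} [L.Structure M] {c : L.Formula ℕ} {D : Con L} {e : ℕ → M} :
    Con.Holds (c ::ₘ D) e ↔ Formula.Realize c e ∧ D.Holds e := by
  simp [Con.Holds]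

theorem Con.holds_subst {M : Type z} [L.Structure M] (θ : ℕ → L.Term ℕ) (C : Con L)
    (e : ℕ → M) : Con.Holds (Con.subst θ C) e ↔ C.Holds fun x => (θ x).realize e := by
  simp only [Con.Holds, Con.subst, Multiset.mem_map, forall_exists_index, and_imp,
    forall_apply_eq_imp_iff₂]
  exact forall₂_congr fun c _ => BoundedFormula.realize_subst

theorem Atom.finite_vars (a : Atom L κ) : a.vars.Finite := by
  have : a.vars = ⋃ t ∈ {t | t ∈ a.args}, (t.varFinset : Set ℕ) := by
    ext x; simp [Atom.vars]
  rw [this]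
  exact (List.finite_toSet a.args).biUnion fun t _ => t.varFinset.finite_toSet

theorem Con.finite_vars (C : Con L) : (Con.vars C).Finite := by
  have : Con.vars C = ⋃ c ∈ {c | c ∈ C}, (BoundedFormula.freeVarFinset c : Set ℕ) := by
    ext x; simp [Con.vars]
  rw [this]
  exact (Multiset.finite_toSet C).biUnion fun t _ => (BoundedFormula.freeVarFinset t).finite_toSet

/-! Sets of equalities. -/

theorem matches_map_rename {ρ : Equiv.Perm ℕ} {as bs : List (Atom L κ)} (h : Matches as bs) :
    Matches (as.map (Atom.rename ρ)) (bs.map (Atom.rename ρ)) := by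
  unfold Matches at *
  rw [List.forall₂_map_left_iff, List.forall₂_map_right_iff]
  exact h.imp fun a b h => by simpa [Atom.rename] using h

theorem Matches.append {as bs cs ds : List (Atom L κ)} (h : Matches as bs) (h' : Matches cs ds) :
    Matches (as ++ cs) (bs ++ ds) := by
  unfold Matches at *
  induction h with
  | nil => exact h'
  | cons h _ ih => exact List.Forall₂.cons h ih

theorem eqs_map_rename (ρ : Equiv.Perm ℕ) (as bs : List (Atom L κ)) :
    eqs (as.map (Atom.rename ρ)) (bs.map (Atom.rename ρ)) = Con.rename ρ (eqs as bs) := by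
  have key : ∀ s t : L.Term ℕ, Formula.relabel ρ (Term.equal s t) =
      Term.equal (s.relabel ρ) (t.relabel ρ) := by
    intro s t
    rw [relabel_eq_mapVars]
    simp only [mapVars, Term.equal, Term.bdEqual, BoundedFormula.mapTermRel,
      Term.relabel_relabel]
    rfl
  unfold eqs Con.rename
  rw [Multiset.map_coe, List.map_flatten]
  congr 2
  rw [List.zipWith_map, List.map_zipWith]
  congr 1
  funext a b
  rw [List.map_zipWith]
  simp only [Atom.rename, List.zipWith_map, key]

theorem eqs_cons (a b : Atom L κ) (as bs : List (Atom L κ)) :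
    eqs (a :: as) (b :: bs) =
      ((List.zipWith (fun s t => Term.equal s t) a.args b.args : List (L.Formula ℕ)) : Con L) +
        eqs as bs := by
  simp [eqs]

theorem holds_zipWith_equal {M : Type z} [L.Structure M] {e : ℕ → M} {l l' : List (L.Term ℕ)}
    (h : l.length = l'.length) :
    Con.Holds ((List.zipWith (fun s t => Term.equal s t) l l' : List (L.Formula ℕ)) : Con L) e ↔
      l.map (fun t => t.realize e) = l'.map (fun t => t.realize e) := by
  induction l generalizing l' with
  | nil => cases l' <;> simp_all
  | cons t l ih =>
    cases l' with
    | nil => simp at h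
    | cons t' l' =>
      simp only [List.zipWith_cons_cons, ← Multiset.cons_coe, Con.holds_cons,
        Formula.realize_equal, List.map_cons, List.cons.injEq]
      rw [ih (by simpa using h)]

/-- `zipWith` truncates, so it is `Matches` that guarantees that no argument is dropped and that the
symbols agree. -/
theorem holds_eqs {M : Type z} [L.Structure M] {e : ℕ → M} {as bs : List (Atom L κ)}
    (h : Matches as bs) :
    (eqs as bs).Holds e ↔ as.map (Atom.eval e) = bs.map (Atom.eval e) := by
  unfold Matches at h
  induction h with
  | nil => simp [eqs]
  | cons h _ ih =>
    rw [eqs_cons, Con.holds_add, ih, holds_zipWith_equal h.2]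
    simp [Atom.eval, h.1]

theorem mem_vars_zipWith_equal {l l' : List (L.Term ℕ)} (h : l.length = l'.length) {x : ℕ} :
    x ∈ Con.vars ((List.zipWith (fun s t => Term.equal s t) l l' : List (L.Formula ℕ)) : Con L) ↔
      (∃ t ∈ l, x ∈ t.varFinset) ∨ ∃ t ∈ l', x ∈ t.varFinset := by
  have key : ∀ t : L.Term ℕ,
      (t.relabel (Sum.inl : ℕ → ℕ ⊕ Fin 0)).varFinsetLeft = t.varFinset := by
    intro t
    induction t with
    | var a => simp
    | func f ts ih => simp [Term.varFinset, ih]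
  induction l generalizing l' with
  | nil => cases l' <;> simp_all [Con.vars]
  | cons t l ih =>
    cases l' with
    | nil => simp at h
    | cons t' l' =>
      have ih := ih (l' := l') (by simpa using h)
      simp only [Con.vars, List.zipWith_cons_cons, ← Multiset.cons_coe, Multiset.mem_cons,
        Set.mem_ofPred_eq, exists_eq_or_imp, List.mem_cons] at ih ⊢
      refine (or_congr ?_ ih).trans or_or_or_comm
      simp only [Term.equal, Term.bdEqual, BoundedFormula.freeVarFinset, key, Finset.mem_union]

/-- Used for two purposes: an application introduces no variables beyond those of the rule and the
configuration, and the variables of constraints consumed by unfolding still occur in the unfolded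
rule. -/
theorem mem_vars_eqs {as bs : List (Atom L κ)} (h : Matches as bs) {x : ℕ} :
    x ∈ Con.vars (eqs as bs) ↔ (∃ a ∈ as, x ∈ a.vars) ∨ ∃ b ∈ bs, x ∈ b.vars := by
  unfold Matches at h
  induction h with
  | nil => simp [eqs, Con.vars]
  | cons h _ ih =>
    rw [eqs_cons, Con.vars_add, Set.mem_union, ih, mem_vars_zipWith_equal h.2]
    simp only [List.mem_cons, exists_eq_or_imp]
    exact or_or_or_comm

end Renaming

/-! ### Entailment -/

section Entailment

variable {L : FirstOrder.Language.{u, v}} {κ : Type w} {CT : L.Theory}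

theorem Entails.trans {C D D' : Con L} (h : Entails CT C D) (h' : Entails CT D D') :
    Entails CT C D' := fun M e hC => h' M e (h M e hC)

theorem Equivalent.refl (C : Con L) : Equivalent CT C C := ⟨fun _ _ h => h, fun _ _ h => h⟩

theorem Equivalent.symm {C D : Con L} (h : Equivalent CT C D) : Equivalent CT D C := ⟨h.2, h.1⟩

theorem Equivalent.trans {C D D' : Con L} (h : Equivalent CT C D) (h' : Equivalent CT D D') :
    Equivalent CT C D' := ⟨h.1.trans h'.1, h'.2.trans h.2⟩

theorem Entails.rename {C D : Con L} (h : Entails CT C D) (ρ : Equiv.Perm ℕ) :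
    Entails CT (Con.rename ρ C) (Con.rename ρ D) := by
  intro M e hC
  rw [Con.holds_rename] at hC ⊢
  exact h M _ hC

theorem Equivalent.rename {C D : Con L} (h : Equivalent CT C D) (ρ : Equiv.Perm ℕ) :
    Equivalent CT (Con.rename ρ C) (Con.rename ρ D) := ⟨h.1.rename ρ, h.2.rename ρ⟩

theorem Equivalent.add {C D C' D' : Con L} (h : Equivalent CT C D) (h' : Equivalent CT C' D') :
    Equivalent CT (C + C') (D + D') := by
  constructor
  · intro M e hC
    rw [Con.holds_add] at hC ⊢
    exact ⟨h.1 M e hC.1, h'.1 M e hC.2⟩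
  · intro M e hC
    rw [Con.holds_add] at hC ⊢
    exact ⟨h.2 M e hC.1, h'.2 M e hC.2⟩

theorem Inconsistent.of_entails {C D : Con L} (h : Inconsistent CT C) (h' : Entails CT D C) :
    Inconsistent CT D := fun M e hD => h M e (h' M e hD)

theorem Inconsistent.rename {C : Con L} (h : Inconsistent CT C) (ρ : Equiv.Perm ℕ) :
    Inconsistent CT (Con.rename ρ C) := by
  intro M e hC
  rw [Con.holds_rename] at hC
  exact h M _ hC

theorem EntailsEx.mono {C C' D D' : Con L} {X : Set ℕ} (h : EntailsEx CT C X D)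
    (hC : Entails CT C' C) (hD : Entails CT D D') : EntailsEx CT C' X D' := by
  intro M e he
  obtain ⟨e', h1, h2⟩ := h M e (hC M e he)
  exact ⟨e', h1, hD M e' h2⟩

theorem EntailsEx.rename {C D : Con L} {X : Set ℕ} (h : EntailsEx CT C X D) (ρ : Equiv.Perm ℕ) :
    EntailsEx CT (Con.rename ρ C) (ρ '' X) (Con.rename ρ D) := by
  intro M e he
  rw [Con.holds_rename] at he
  obtain ⟨e', h1, h2⟩ := h M _ he
  refine ⟨e' ∘ ρ.symm, fun y hy => ?_, ?_⟩
  · have := h1 (ρ.symm y) fun hx => hy ⟨_, hx, by simp⟩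
    simpa using this
  · rw [Con.holds_rename]
    convert h2
    funext x
    simp

/-- In a model of Clark's equality theory the value of a term determines the values of its
variables. -/
theorem ClarkEquality.eq_of_realize_eq (hCT : ClarkEquality CT)
    (M : Theory.ModelType.{u, v, max u v} CT) {e e' : ℕ → M} (t : L.Term ℕ)
    (h : t.realize e = t.realize e') : ∀ x ∈ t.varFinset, e x = e' x := by
  induction t with
  | var a => simpa using h
  | func f ts ih =>
    simp only [Term.realize] at h
    have := hCT.injective M _ f _ _ h
    intro x hx
    simp only [Term.varFinset, Finset.mem_biUnion] at hx
    obtain ⟨i, -, hi⟩ := hx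
    exact ih i (congrFun this i) x hi

theorem ClarkEquality.eq_of_eval_eq (hCT : ClarkEquality CT)
    (M : Theory.ModelType.{u, v, max u v} CT) {e e' : ℕ → M} {a : Atom L κ}
    (h : a.eval e = a.eval e') : ∀ x ∈ a.vars, e x = e' x := by
  rintro x ⟨t, ht, hx⟩
  simp only [Atom.eval, Prod.mk.injEq, true_and] at h
  exact hCT.eq_of_realize_eq M t (List.map_inj_left.1 h t ht) x hx

end Entailment

/-! ### Extending finite renamings -/

/-- The complements of a finite set and of its finite image are both countably infinite, so any
bijection between them completes `f`. -/
theorem exists_perm_eqOn {s : Set ℕ} (hs : s.Finite) {f : ℕ → ℕ} (hf : Set.InjOn f s) :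
    ∃ ρ : Equiv.Perm ℕ, ∀ x ∈ s, ρ x = f x := by
  classical
  have h1 : Infinite ↥(sᶜ) := hs.infinite_compl.to_subtype
  have h2 : Infinite ↥((f '' s)ᶜ) := (hs.image f).infinite_compl.to_subtype
  obtain ⟨e⟩ := nonempty_equiv_of_countable (α := ↥(sᶜ)) (β := ↥((f '' s)ᶜ))
  refine ⟨(Equiv.Set.sumCompl s).symm.trans
    (((Equiv.Set.imageOfInjOn f s hf).sumCongr e).trans (Equiv.Set.sumCompl (f '' s))),
    fun x hx => ?_⟩
  simp [Equiv.Set.sumCompl_symm_apply_of_mem hx, Equiv.Set.imageOfInjOn]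

/-- A renaming can be changed outside `A` so that it maps `R` away from `F`. -/
theorem exists_perm_fresh {A R F : Set ℕ} (hA : A.Finite) (hR : R.Finite) (hF : F.Finite)
    (hAR : Disjoint A R) (ρ : Equiv.Perm ℕ) :
    ∃ σ : Equiv.Perm ℕ, (∀ x ∈ A, σ x = ρ x) ∧ ∀ x ∈ R, σ x ∉ F := by
  classical
  -- Beyond `N` there is neither a forbidden variable nor a value of `ρ` on `A`, so shifting the
  -- rest by `N + 1` keeps the map injective and avoids `F`.
  obtain ⟨N, hN⟩ := (hF.union (hA.image ρ)).bddAbove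
  obtain ⟨σ, hσ⟩ := exists_perm_eqOn (hA.union hR)
    (f := fun x => if x ∈ A then ρ x else x + (N + 1)) (by
      intro x _ y _ hxy
      by_cases hxA : x ∈ A <;> by_cases hyA : y ∈ A <;> simp only [hxA, hyA, if_true, if_false] at hxy
      · exact ρ.injective hxy
      · have := hN (Or.inr ⟨x, hxA, rfl⟩)
        omega
      · have := hN (Or.inr ⟨y, hyA, rfl⟩)
        omega
      · omega)
  refine ⟨σ, fun x hx => by rw [hσ x (Or.inl hx), if_pos hx], fun x hx hxF => ?_⟩
  rw [hσ x (Or.inr hx), if_neg (fun h => Set.disjoint_left.1 hAR h hx)] at hxF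
  have := hN (Or.inl hxF)
  omega

/-! ### Configurations, their sameness, and rule applications -/

section Conf

variable {L : FirstOrder.Language.{u, v}} {κ : Type w} {ν : Type z}

/-! ### Rules -/

theorem mem_vars_list_rename {ρ : Equiv.Perm ℕ} {l : List (Atom L κ)} {x : ℕ} :
    (∃ a ∈ l.map (Atom.rename ρ), x ∈ a.vars) ↔ ∃ y, (∃ a ∈ l, y ∈ a.vars) ∧ ρ y = x := by
  simp only [List.mem_map]
  constructor
  · rintro ⟨_, ⟨a, ha, rfl⟩, hx⟩
    obtain ⟨y, hy, rfl⟩ := Atom.mem_vars_rename.1 hx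
    exact ⟨y, ⟨a, ha, hy⟩, rfl⟩
  · rintro ⟨y, ⟨a, ha, hy⟩, rfl⟩
    exact ⟨_, ⟨a, ha, rfl⟩, Atom.mem_vars_rename.2 ⟨y, hy, rfl⟩⟩

theorem ARule.headVars_rename (ρ : Equiv.Perm ℕ) (r : ARule L κ ν) :
    (r.rename ρ).headVars = ρ '' r.headVars := by
  ext x
  simp only [ARule.headVars, ARule.rename, ← List.map_append]
  exact mem_vars_list_rename

theorem Con.vars_rename (ρ : Equiv.Perm ℕ) (C : Con L) :
    Con.vars (Con.rename ρ C) = ρ '' Con.vars C := by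
  ext x
  exact Con.mem_vars_rename

/-- Renames the variables of an identified constraint by `ρ` and its identifier by `π`. -/
def renameId (ρ π : Equiv.Perm ℕ) (p : IdAtom L κ) : IdAtom L κ := (p.1.rename ρ, π p.2)

/-- The variables of a multiset of identified constraints. -/
def chrVars (S : Multiset (IdAtom L κ)) : Set ℕ := {x | ∃ p ∈ S, x ∈ p.1.vars}

theorem chrVars_map_renameId (ρ π : Equiv.Perm ℕ) (S : Multiset (IdAtom L κ)) :
    chrVars (S.map (renameId ρ π)) = ρ '' chrVars S := by
  ext x
  simp only [chrVars, Multiset.mem_map, Set.mem_ofPred_eq, Set.mem_image]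
  constructor
  · rintro ⟨_, ⟨p, hp, rfl⟩, hx⟩
    obtain ⟨y, hy, rfl⟩ := Atom.mem_vars_rename.1 hx
    exact ⟨y, ⟨p, hp, hy⟩, rfl⟩
  · rintro ⟨y, ⟨p, hp, hy⟩, rfl⟩
    exact ⟨_, ⟨p, hp, rfl⟩, Atom.mem_vars_rename.2 ⟨y, hy, rfl⟩⟩

theorem finite_chrVars (S : Multiset (IdAtom L κ)) : (chrVars S).Finite := by
  have : chrVars S = ⋃ p ∈ {p | p ∈ S}, p.1.vars := by
    ext x; simp [chrVars]
  rw [this]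
  exact (Multiset.finite_toSet S).biUnion fun p _ => p.1.finite_vars

theorem finite_listVars (l : List (Atom L κ)) : {x | ∃ a ∈ l, x ∈ a.vars}.Finite := by
  have : {x | ∃ a ∈ l, x ∈ a.vars} = ⋃ a ∈ {a | a ∈ l}, a.vars := by
    ext x; simp
  rw [this]
  exact (List.finite_toSet l).biUnion fun p _ => p.finite_vars

theorem ARule.vars_eq (r : ARule L κ ν) :
    r.vars = r.headVars ∪ Con.vars r.guard ∪ chrVars r.chr ∪ Con.vars r.bi := rfl

theorem ARule.rename_chr (ρ : Equiv.Perm ℕ) (r : ARule L κ ν) :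
    (r.rename ρ).chr = r.chr.map (renameId ρ 1) := rfl

theorem ARule.vars_rename (ρ : Equiv.Perm ℕ) (r : ARule L κ ν) :
    (r.rename ρ).vars = ρ '' r.vars := by
  rw [ARule.vars_eq, ARule.vars_eq, ARule.headVars_rename, ARule.rename_chr, chrVars_map_renameId]
  simp only [ARule.rename, Con.vars_rename, Set.image_union]

theorem ARule.finite_vars (r : ARule L κ ν) : r.vars.Finite :=
  (((finite_listVars _).union (Con.finite_vars _)).union (finite_chrVars _)).union
    (Con.finite_vars _)

theorem ARule.rename_rename (ρ σ : Equiv.Perm ℕ) (r : ARule L κ ν) :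
    (r.rename ρ).rename σ = r.rename (σ * ρ) := by
  simp [ARule.rename, Function.comp_def, Atom.rename_rename, Con.rename_rename]

@[simp]
theorem ARule.rename_one (r : ARule L κ ν) : r.rename 1 = r := by
  have : (Atom.rename 1 : Atom L κ → Atom L κ) = id := funext Atom.rename_one
  simp [ARule.rename, this]

theorem ARule.rename_inv_rename (ρ : Equiv.Perm ℕ) (r : ARule L κ ν) :
    (r.rename ρ).rename ρ⁻¹ = r := by
  simp [ARule.rename_rename]

/-- The identifiers of a rule are positive and its head is not empty. -/
structure ARule.Good (r : ARule L κ ν) : Prop where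
  heads : r.kept ++ r.removed ≠ []
  chr_pos : ∀ p ∈ r.chr, 1 ≤ p.2
  tokens_pos : ∀ t ∈ r.tokens, ∀ i ∈ t.2, 1 ≤ i

theorem ARule.Good.rename {r : ARule L κ ν} (h : r.Good) (ρ : Equiv.Perm ℕ) :
    (r.rename ρ).Good where
  heads := by
    have := h.heads
    simpa [ARule.rename] using this
  chr_pos := by
    intro p hp
    simp only [ARule.rename, Multiset.mem_map] at hp
    obtain ⟨q, hq, rfl⟩ := hp
    exact h.chr_pos q hq
  tokens_pos := h.tokens_pos

theorem le_foldr_max {l : List ℕ} {i : ℕ} (h : i ∈ l) : i ≤ l.foldr max 0 := by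
  induction l with
  | nil => simp at h
  | cons j l ih =>
    simp only [List.mem_cons, List.foldr_cons] at h ⊢
    rcases h with rfl | h
    · exact le_max_left _ _
    · exact (ih h).trans (le_max_right _ _)

theorem le_maxId_of_mem {B : Multiset (IdAtom L κ)} {T : Finset (Token ν)} {p : IdAtom L κ}
    (h : p ∈ B) : p.2 ≤ maxId B T :=
  (Multiset.le_sup (Multiset.mem_map_of_mem Prod.snd h)).trans (le_max_left _ _)

theorem le_maxId_of_mem_token {B : Multiset (IdAtom L κ)} {T : Finset (Token ν)} {t : Token ν}
    (h : t ∈ T) {i : ℕ} (hi : i ∈ t.2) : i ≤ maxId B T :=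
  (le_foldr_max hi).trans
    ((Finset.le_sup (f := fun t : Token ν => t.2.foldr max 0) h).trans (le_max_right _ _))

theorem ARule.maxId_rename (ρ : Equiv.Perm ℕ) (r : ARule L κ ν) :
    maxId (r.rename ρ).chr (r.rename ρ).tokens = maxId r.chr r.tokens := by
  simp [maxId, ARule.rename]

theorem disjoint_image_of_forall {ρ : Equiv.Perm ℕ} {R F : Set ℕ} (h : ∀ x ∈ R, ρ x ∉ F) :
    Disjoint (ρ '' R) F := by
  rw [Set.disjoint_left]
  rintro _ ⟨x, hx, rfl⟩
  exact h x hx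

/-! ### Abstract configurations: all constraints of the goal are introduced, and all built-in
constraints are in the store. -/

structure Conf (L : FirstOrder.Language.{u, v}) (κ : Type w) (ν : Type z) where
  chr : Multiset (IdAtom L κ)
  con : Con L
  tokens : Finset (Token ν)

def Conf.vars (X : Conf L κ ν) : Set ℕ := chrVars X.chr ∪ Con.vars X.con

def Conf.rename (ρ : Equiv.Perm ℕ) (X : Conf L κ ν) : Conf L κ ν :=
  ⟨X.chr.map (renameId ρ 1), Con.rename ρ X.con, X.tokens⟩

/-- No identifier of the configuration is greater than `k`. -/
structure Conf.Bounded (X : Conf L κ ν) (k : ℕ) : Prop where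
  chr : ∀ p ∈ X.chr, p.2 ≤ k
  tokens : ∀ t ∈ X.tokens, ∀ i ∈ t.2, i ≤ k

theorem Conf.finite_vars (X : Conf L κ ν) : X.vars.Finite :=
  (finite_chrVars _).union (Con.finite_vars _)

theorem Conf.vars_rename (ρ : Equiv.Perm ℕ) (X : Conf L κ ν) :
    (X.rename ρ).vars = ρ '' X.vars := by
  simp [Conf.vars, Conf.rename, chrVars_map_renameId, Con.vars_rename, Set.image_union]

theorem Conf.Bounded.mono {X : Conf L κ ν} {k m : ℕ} (h : X.Bounded k) (hkm : k ≤ m) :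
    X.Bounded m :=
  ⟨fun p hp => (h.chr p hp).trans hkm, fun t ht i hi => (h.tokens t ht i hi).trans hkm⟩

theorem Conf.exists_bounded (X : Conf L κ ν) : ∃ k, X.Bounded k :=
  ⟨maxId X.chr X.tokens, fun _ hp => le_maxId_of_mem hp,
    fun _ ht _ hi => le_maxId_of_mem_token ht hi⟩

theorem Conf.Bounded.rename {X : Conf L κ ν} {k : ℕ} (h : X.Bounded k) (ρ : Equiv.Perm ℕ) :
    (X.rename ρ).Bounded k := by
  refine ⟨fun p hp => ?_, h.tokens⟩
  simp only [Conf.rename, Multiset.mem_map] at hp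
  obtain ⟨q, hq, rfl⟩ := hp
  exact h.chr q hq

/-- The configurations are the same when `X` is renamed by `ρ` (variables) and `π` (identifiers), up
to logical equivalence and tokens with identifiers that do not occur. -/
structure SimWith (CT : L.Theory) (ρ π : Equiv.Perm ℕ) (X Y : Conf L κ ν) : Prop where
  chr : X.chr.map (renameId ρ π) = Y.chr
  con : Equivalent CT (Con.rename ρ X.con) Y.con
  tokens : ∀ (a : ν) (l : List ℕ), (∀ i ∈ l, i ∈ X.chr.map Prod.snd) →
    ((a, l) ∈ X.tokens ↔ (a, l.map π) ∈ Y.tokens)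

/-- Sameness of configurations, up to renaming of variables outside `V`. -/
def Sim (CT : L.Theory) (V : Set ℕ) (X Y : Conf L κ ν) : Prop :=
  ∃ ρ π : Equiv.Perm ℕ, (∀ x ∈ V, ρ x = x) ∧ SimWith CT ρ π X Y

variable {CT : L.Theory} {V : Set ℕ}

theorem renameId_renameId (ρ π σ τ : Equiv.Perm ℕ) (p : IdAtom L κ) :
    renameId σ τ (renameId ρ π p) = renameId (σ * ρ) (τ * π) p := by
  simp [renameId, Atom.rename_rename]

@[simp]
theorem renameId_one_one (p : IdAtom L κ) : renameId 1 1 p = p := by simp [renameId]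

theorem SimWith.refl (X : Conf L κ ν) : SimWith CT 1 1 X X where
  chr := by simp
  con := by simpa using Equivalent.refl _
  tokens := by simp

theorem SimWith.trans {ρ π σ τ : Equiv.Perm ℕ} {X Y Z : Conf L κ ν} (h : SimWith CT ρ π X Y)
    (h' : SimWith CT σ τ Y Z) : SimWith CT (σ * ρ) (τ * π) X Z where
  chr := by
    rw [← h'.chr, ← h.chr, Multiset.map_map]
    exact Multiset.map_congr rfl fun p _ => (renameId_renameId _ _ _ _ _).symm
  con := by
    rw [← Con.rename_rename]
    exact (h.con.rename σ).trans h'.con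
  tokens := by
    intro a l hl
    rw [h.tokens a l hl, h'.tokens a (l.map π), List.map_map]
    · rfl
    · intro i hi
      obtain ⟨j, hj, rfl⟩ := List.mem_map.1 hi
      obtain ⟨p, hp, rfl⟩ := Multiset.mem_map.1 (hl j hj)
      rw [← h.chr]
      exact Multiset.mem_map.2 ⟨renameId ρ π p, Multiset.mem_map_of_mem _ hp, rfl⟩

theorem SimWith.symm {ρ π : Equiv.Perm ℕ} {X Y : Conf L κ ν} (h : SimWith CT ρ π X Y) :
    SimWith CT ρ⁻¹ π⁻¹ Y X where
  chr := by
    rw [← h.chr, Multiset.map_map]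
    conv_rhs => rw [← Multiset.map_id X.chr]
    refine Multiset.map_congr rfl fun p _ => ?_
    simp [Function.comp, renameId_renameId]
  con := by
    have := h.con.symm.rename ρ⁻¹
    simpa [Con.rename_rename] using this
  tokens := by
    intro a l hl
    rw [h.tokens a (l.map ⇑π⁻¹)]
    · simp [Function.comp_def]
    · intro i hi
      obtain ⟨j, hj, rfl⟩ := List.mem_map.1 hi
      have := hl j hj
      rw [← h.chr, Multiset.map_map] at this
      obtain ⟨p, hp, rfl⟩ := Multiset.mem_map.1 this
      exact Multiset.mem_map.2 ⟨p, hp, by simp [renameId]⟩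

/-- Only the values on occurring variables and identifiers matter. This leaves the renamings free
elsewhere, where fresh rule variables and new identifiers have to be placed. -/
theorem SimWith.congr {ρ π σ τ : Equiv.Perm ℕ} {X Y : Conf L κ ν} (h : SimWith CT ρ π X Y)
    (hσ : ∀ x ∈ X.vars, σ x = ρ x) (hτ : ∀ p ∈ X.chr, τ p.2 = π p.2) : SimWith CT σ τ X Y where
  chr := by
    rw [← h.chr]
    refine Multiset.map_congr rfl fun p hp => ?_
    simp only [renameId, hτ p hp, Prod.mk.injEq, and_true]
    exact Atom.rename_congr fun x hx => hσ x (Or.inl ⟨p, hp, hx⟩)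
  con := by
    rw [Con.rename_congr (fun x hx => hσ x (Or.inr hx))]
    exact h.con
  tokens := by
    intro a l hl
    rw [h.tokens a l hl, List.map_congr_left (g := τ)]
    intro i hi
    obtain ⟨p, hp, rfl⟩ := Multiset.mem_map.1 (hl i hi)
    exact (hτ p hp).symm

theorem SimWith.rename (ρ : Equiv.Perm ℕ) (X : Conf L κ ν) : SimWith CT ρ 1 X (X.rename ρ) where
  chr := rfl
  con := Equivalent.refl _
  tokens := by simp [Conf.rename]

theorem Sim.refl (X : Conf L κ ν) : Sim CT V X X := ⟨1, 1, fun _ _ => rfl, SimWith.refl X⟩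

theorem Sim.symm {X Y : Conf L κ ν} (h : Sim CT V X Y) : Sim CT V Y X := by
  obtain ⟨ρ, π, hV, h⟩ := h
  exact ⟨_, _, fun x hx => Equiv.Perm.inv_eq_iff_eq.2 (hV x hx).symm, h.symm⟩

theorem Sim.trans {X Y Z : Conf L κ ν} (h : Sim CT V X Y) (h' : Sim CT V Y Z) :
    Sim CT V X Z := by
  obtain ⟨ρ, π, hV, h⟩ := h
  obtain ⟨σ, τ, hV', h'⟩ := h'
  exact ⟨_, _, fun x hx => by simp [hV x hx, hV' x hx], h.trans h'⟩

theorem Sim.of_equivalent {S : Multiset (IdAtom L κ)} {C D : Con L} {T : Finset (Token ν)}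
    (h : Equivalent CT C D) : Sim CT V ⟨S, C, T⟩ ⟨S, D, T⟩ :=
  ⟨1, 1, fun _ _ => rfl, by simp, by simpa using h, by simp⟩

theorem Sim.inconsistent {X Y : Conf L κ ν} (h : Sim CT V X Y) (hX : Inconsistent CT X.con) :
    Inconsistent CT Y.con := by
  obtain ⟨ρ, π, -, h⟩ := h
  exact (hX.rename ρ).of_entails h.con.2

/-! ### Rule applications -/

/-- The rule `r`, with fresh variables, can be applied to `H₁` and `H₂`. -/
structure Enabled (CT : L.Theory) (r : ARule L κ ν) (V : Set ℕ) (H₁ H₂ : List (IdAtom L κ))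
    (S : Multiset (IdAtom L κ)) (X : Conf L κ ν) : Prop where
  chr_eq : X.chr = (H₁ : Multiset (IdAtom L κ)) + H₂ + S
  fresh_start : Disjoint r.vars V
  fresh_state : Disjoint r.vars X.vars
  match₁ : Matches (H₁.map Prod.fst) r.kept
  match₂ : Matches (H₂.map Prod.fst) r.removed
  guard : EntailsEx CT X.con r.headVars
    (eqs ((H₁ ++ H₂).map Prod.fst) (r.kept ++ r.removed) + r.guard)
  token : (r.name, (H₁ ++ H₂).map Prod.snd) ∉ X.tokens

/-- The result of applying `r`, when its identifiers are increased by `k`. -/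
def ARule.result [DecidableEq ν] (r : ARule L κ ν) (k : ℕ) (H₁ H₂ : List (IdAtom L κ))
    (S : Multiset (IdAtom L κ)) (X : Conf L κ ν) : Conf L κ ν where
  chr := shift k r.chr + (H₁ : Multiset (IdAtom L κ)) + S
  con := r.bi + (eqs ((H₁ ++ H₂).map Prod.fst) (r.kept ++ r.removed) + X.con)
  tokens := (if H₂ = [] then insert (r.name, H₁.map Prod.snd) X.tokens else X.tokens) ∪
    shiftTokens k r.tokens

theorem map_fst_map_renameId (ρ π : Equiv.Perm ℕ) (H : List (IdAtom L κ)) :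
    (H.map (renameId ρ π)).map Prod.fst = (H.map Prod.fst).map (Atom.rename ρ) := by
  simp [Function.comp_def, renameId]

theorem map_snd_map_renameId (ρ π : Equiv.Perm ℕ) (H : List (IdAtom L κ)) :
    (H.map (renameId ρ π)).map Prod.snd = (H.map Prod.snd).map π := by
  simp [Function.comp_def, renameId]

/-- An application can be carried over to a configuration with a stronger store. -/
theorem Enabled.transfer {r : ARule L κ ν} {V V' : Set ℕ} {H₁ H₂ : List (IdAtom L κ)}
    {S : Multiset (IdAtom L κ)} {X Y : Conf L κ ν} (h : Enabled CT r V H₁ H₂ S X)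
    {ρ π : Equiv.Perm ℕ} (hXY : SimWith CT ρ π X Y)
    (hV : Disjoint (r.rename ρ).vars V') (hY : Disjoint (r.rename ρ).vars Y.vars) :
    Enabled CT (r.rename ρ) V' (H₁.map (renameId ρ π)) (H₂.map (renameId ρ π))
      (S.map (renameId ρ π)) Y where
  chr_eq := by
    rw [← hXY.chr, h.chr_eq]
    simp
  fresh_start := hV
  fresh_state := hY
  match₁ := by
    rw [map_fst_map_renameId]
    exact matches_map_rename h.match₁
  match₂ := by
    rw [map_fst_map_renameId]
    exact matches_map_rename h.match₂
  guard := by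
    rw [← List.map_append, map_fst_map_renameId, ARule.headVars_rename]
    simp only [ARule.rename, ← List.map_append]
    rw [eqs_map_rename, ← Con.rename_add]
    -- It suffices that the store of `Y` entails the renamed store of `X`.
    exact (h.guard.rename ρ).mono hXY.con.2 fun _ _ h => h
  token := by
    rw [← List.map_append, map_snd_map_renameId]
    simp only [ARule.rename]
    rw [← hXY.tokens]
    · exact h.token
    · intro i hi
      rw [h.chr_eq, Multiset.coe_add, Multiset.map_add, Multiset.mem_add]
      exact Or.inl (by simpa using hi)

variable [DecidableEq ν]

theorem mem_shiftTokens {k : ℕ} {T : Finset (Token ν)} {a : ν} {l : List ℕ} :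
    (a, l) ∈ shiftTokens k T ↔ ∃ l', (a, l') ∈ T ∧ l'.map (· + k) = l := by
  simp only [shiftTokens, Finset.mem_image, Prod.mk.injEq, Prod.exists]
  constructor
  · rintro ⟨a, l', h, rfl, rfl⟩
    exact ⟨l', h, rfl⟩
  · rintro ⟨l', h, rfl⟩
    exact ⟨a, l', h, rfl, rfl⟩

theorem mem_result_tokens {r : ARule L κ ν} {k : ℕ} {H₁ H₂ : List (IdAtom L κ)}
    {S : Multiset (IdAtom L κ)} {X : Conf L κ ν} {a : ν} {l : List ℕ} :
    (a, l) ∈ (r.result k H₁ H₂ S X).tokens ↔ (a, l) ∈ X.tokens ∨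
      (H₂ = [] ∧ a = r.name ∧ l = H₁.map Prod.snd) ∨
      ∃ l', (a, l') ∈ r.tokens ∧ l'.map (· + k) = l := by
  simp only [ARule.result, Finset.mem_union, mem_shiftTokens]
  split_ifs with h
  · simp only [Finset.mem_insert, Prod.mk.injEq, h, true_and]
    tauto
  · simp [h]

/-- The identifiers of the body are positive, so after the shifts they lie above `k` and `m` and
cannot collide with those of `X` and `Y`. The hypothesis on `π` makes it carry one new block onto
the other. -/
theorem SimWith.result {r : ARule L κ ν} (hr : r.Good) {H₁ H₂ : List (IdAtom L κ)}
    {S : Multiset (IdAtom L κ)} {X Y : Conf L κ ν} {ρ π : Equiv.Perm ℕ}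
    (h : SimWith CT ρ π X Y) (hchr : X.chr = (H₁ : Multiset (IdAtom L κ)) + H₂ + S)
    {k m : ℕ} (hk : X.Bounded k) (hm : Y.Bounded m)
    (hπ : ∀ i, 1 ≤ i → i ≤ maxId r.chr r.tokens → π (i + k) = i + m) :
    SimWith CT ρ π (r.result k H₁ H₂ S X) ((r.rename ρ).result m (H₁.map (renameId ρ π))
      (H₂.map (renameId ρ π)) (S.map (renameId ρ π)) Y) where
  chr := by
    simp only [ARule.result, shift, ARule.rename, Multiset.map_add, Multiset.map_map,
      Multiset.map_coe]
    congr 2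
    refine Multiset.map_congr rfl fun p hp => ?_
    simp [renameId, hπ p.2 (hr.chr_pos p hp) (le_maxId_of_mem hp)]
  con := by
    simp only [ARule.result, Con.rename_add]
    rw [← List.map_append (f := renameId ρ π), map_fst_map_renameId]
    simp only [ARule.rename, ← List.map_append]
    rw [eqs_map_rename]
    exact (Equivalent.refl _).add ((Equivalent.refl _).add h.con)
  tokens := by
    intro a l hl
    -- A live identifier of the result is at most `k` and then occurs in `X`, or it is new and then
    -- `π` sends it above `m`. So a token of the old stores is seen to be old from either side.
    have hold : ∀ i ∈ l, i ≤ k → i ∈ X.chr.map Prod.snd := by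
      intro i hi hik
      obtain ⟨p, hp, rfl⟩ := Multiset.mem_map.1 (hl i hi)
      simp only [ARule.result, Multiset.mem_add, shift, Multiset.mem_map, Multiset.mem_coe] at hp
      rcases hp with (⟨q, hq, rfl⟩ | hp) | hp
      · have := hr.chr_pos q hq
        simp only at hik
        omega
      · rw [hchr]
        exact Multiset.mem_map_of_mem _ (by simp [hp])
      · rw [hchr]
        exact Multiset.mem_map_of_mem _ (by simp [hp])
    have hnew : ∀ i ∈ l, ¬ i ≤ k → ¬ π i ≤ m := by
      intro i hi hik
      obtain ⟨p, hp, rfl⟩ := Multiset.mem_map.1 (hl i hi)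
      simp only [ARule.result, Multiset.mem_add, shift, Multiset.mem_map, Multiset.mem_coe] at hp
      rcases hp with (⟨q, hq, rfl⟩ | hp) | hp
      · have := hr.chr_pos q hq
        simp only [hπ q.2 this (le_maxId_of_mem hq)]
        omega
      · exact absurd (hk.chr p (by rw [hchr]; simp [hp])) hik
      · exact absurd (hk.chr p (by rw [hchr]; simp [hp])) hik
    rw [mem_result_tokens, mem_result_tokens]
    refine or_congr ?_ (or_congr ?_ ?_)
    · constructor
      · intro ht
        exact (h.tokens a l fun i hi => hold i hi (hk.tokens _ ht i hi)).1 ht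
      · intro ht
        refine (h.tokens a l fun i hi => hold i hi ?_).2 ht
        by_contra hik
        exact hnew i hi hik (hm.tokens _ ht _ (List.mem_map_of_mem hi))
    · rw [map_snd_map_renameId, List.map_inj_right π.injective]
      simp [ARule.rename]
    · simp only [ARule.rename]
      refine exists_congr fun l' => and_congr_right fun hl' => ?_
      have : l'.map (· + m) = (l'.map (· + k)).map π := by
        rw [List.map_map]
        refine List.map_congr_left fun i hi => ?_
        simp [hπ i (hr.tokens_pos _ hl' i hi) (le_maxId_of_mem_token hl' hi)]
      rw [this, List.map_inj_right π.injective]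

theorem Enabled.result_bounded {r : ARule L κ ν} {H₁ H₂ : List (IdAtom L κ)}
    {S : Multiset (IdAtom L κ)} {X : Conf L κ ν} (h : Enabled CT r V H₁ H₂ S X)
    {k : ℕ} (hk : X.Bounded k) :
    (r.result k H₁ H₂ S X).Bounded (k + maxId r.chr r.tokens) := by
  have hX : ∀ p, p ∈ X.chr → p.2 ≤ k + maxId r.chr r.tokens := fun p hp =>
    (hk.chr p hp).trans (Nat.le_add_right _ _)
  rw [h.chr_eq] at hX
  constructor
  · intro p hp
    simp only [ARule.result, Multiset.mem_add, shift, Multiset.mem_map, Multiset.mem_coe] at hp hX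
    rcases hp with (⟨q, hq, rfl⟩ | hp) | hp
    · have : q.2 ≤ maxId r.chr r.tokens := le_maxId_of_mem hq
      simp only
      omega
    · exact hX p (by simp [hp])
    · exact hX p (by simp [hp])
  · rintro ⟨a, l⟩ ht i hi
    rw [mem_result_tokens] at ht
    rcases ht with ht | ⟨-, -, rfl⟩ | ⟨l', hl', rfl⟩
    · exact (hk.tokens _ ht i hi).trans (Nat.le_add_right _ _)
    · obtain ⟨p, hp, rfl⟩ := List.mem_map.1 hi
      exact hX p (by simp [hp])
    · obtain ⟨j, hj, rfl⟩ := List.mem_map.1 hi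
      have : j ≤ maxId r.chr r.tokens := le_maxId_of_mem_token hl' hj
      omega

/-- One application of a rule of `Q`. -/
def Fire (CT : L.Theory) (Q : Set (ARule L κ ν)) (V : Set ℕ) (X Y : Conf L κ ν) : Prop :=
  ∃ r₀ ∈ Q, ∃ (ρ : Equiv.Perm ℕ) (k : ℕ) (H₁ H₂ : List (IdAtom L κ)) (S : Multiset (IdAtom L κ)),
    X.Bounded k ∧ Enabled CT (r₀.rename ρ) V H₁ H₂ S X ∧ Y = (r₀.rename ρ).result k H₁ H₂ S X

/-- Rule applications respect sameness of configurations. -/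
theorem Sim.fire {Q : Set (ARule L κ ν)} (hQ : ∀ r ∈ Q, r.Good) (hV : V.Finite)
    {X X' Y : Conf L κ ν} (hXY : Sim CT V X Y) (h : Fire CT Q V X X') {m : ℕ} (hm : Y.Bounded m) :
    ∃ r₀ ∈ Q, ∃ (ρ : Equiv.Perm ℕ) (H₁ H₂ : List (IdAtom L κ)) (S : Multiset (IdAtom L κ)),
      Enabled CT (r₀.rename ρ) V H₁ H₂ S Y ∧
        Sim CT V X' ((r₀.rename ρ).result m H₁ H₂ S Y) := by
  obtain ⟨r₀, hr₀, ρ₀, k, H₁, H₂, S, hk, hen, rfl⟩ := h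
  obtain ⟨ρ, π, hρV, hsim⟩ := hXY
  set r := r₀.rename ρ₀ with hr
  have hgood : r.Good := (hQ r₀ hr₀).rename ρ₀
  obtain ⟨σ, hσ, hσF⟩ := exists_perm_fresh (A := V ∪ X.vars) (R := r.vars) (F := V ∪ Y.vars)
    (hV.union X.finite_vars) r.finite_vars (hV.union Y.finite_vars)
    ((Set.disjoint_union_left.2 ⟨hen.fresh_start.symm, hen.fresh_state.symm⟩)) ρ
  have hids : ∀ p ∈ X.chr, π p.2 ≤ m := by
    intro p hp
    have : renameId ρ π p ∈ Y.chr := by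
      rw [← hsim.chr]
      exact Multiset.mem_map_of_mem _ hp
    exact hm.chr _ this
  -- `τ` agrees with `π` on the identifiers of `X`, whose images are at most `m`, and maps the new
  -- block starting after `k` onto the one starting after `m`. The bound `m` is arbitrary because a
  -- concrete derivation prescribes the shift through its counter.
  obtain ⟨τ, hτ⟩ := exists_perm_eqOn (s := {i | i ∈ X.chr.map Prod.snd} ∪
      {i | k < i ∧ i ≤ maxId r.chr r.tokens + k})
    ((Multiset.finite_toSet _).union ((Set.finite_Iic (maxId r.chr r.tokens + k)).subset
      fun i hi => hi.2)) (f := fun i => if i ≤ k then π i else i - k + m) (by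
      have hle : ∀ i ∈ X.chr.map Prod.snd, i ≤ k ∧ π i ≤ m := by
        intro i hi
        obtain ⟨p, hp, rfl⟩ := Multiset.mem_map.1 hi
        exact ⟨hk.chr p hp, hids p hp⟩
      rintro i hi j hj hij
      by_cases h1 : i ≤ k <;> by_cases h2 : j ≤ k <;>
        simp only [h1, h2, if_true, if_false] at hij
      · exact π.injective hij
      · rcases hi with hi | hi
        · have := (hle i hi).2
          omega
        · exact absurd h1 (not_le.2 hi.1)
      · rcases hj with hj | hj
        · have := (hle j hj).2
          omega
        · exact absurd h2 (not_le.2 hj.1)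
      · omega)
  have hsim' : SimWith CT σ τ X Y := by
    refine hsim.congr (fun x hx => hσ x (Or.inr hx)) fun p hp => ?_
    rw [hτ p.2 (Or.inl (Multiset.mem_map_of_mem _ hp))]
    simp [hk.chr p hp]
  have hd : Disjoint (r.rename σ).vars (V ∪ Y.vars) := by
    rw [ARule.vars_rename]
    exact disjoint_image_of_forall hσF
  refine ⟨r₀, hr₀, σ * ρ₀, H₁.map (renameId σ τ), H₂.map (renameId σ τ), S.map (renameId σ τ), ?_⟩
  rw [← ARule.rename_rename, ← hr]
  refine ⟨hen.transfer hsim' (Set.disjoint_union_right.1 hd).1 (Set.disjoint_union_right.1 hd).2,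
    σ, τ, fun x hx => by rw [hσ x (Or.inl hx), hρV x hx],
    hsim'.result hgood hen.chr_eq hk hm fun i hi hi' => ?_⟩
  rw [hτ (i + k) (Or.inr ⟨by omega, by omega⟩), if_neg (by omega)]
  omega

end Conf

/-! ### Unfolded rules as two successive applications -/

section Unfold

variable {L : FirstOrder.Language.{u, v}} {κ : Type w} {ν : Type z} {CT : L.Theory} {V : Set ℕ}

/-! ### Renaming of rule applications -/

theorem Enabled.rename {r : ARule L κ ν} {H₁ H₂ : List (IdAtom L κ)} {S : Multiset (IdAtom L κ)}
    {X : Conf L κ ν} (h : Enabled CT r V H₁ H₂ S X) (ρ : Equiv.Perm ℕ) :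
    Enabled CT (r.rename ρ) (ρ '' V) (H₁.map (renameId ρ 1)) (H₂.map (renameId ρ 1))
      (S.map (renameId ρ 1)) (X.rename ρ) :=
  h.transfer (SimWith.rename ρ X)
    (by rw [ARule.vars_rename, Set.disjoint_image_iff ρ.injective]; exact h.fresh_start)
    (by
      rw [ARule.vars_rename, Conf.vars_rename, Set.disjoint_image_iff ρ.injective]
      exact h.fresh_state)

theorem ARule.result_rename [DecidableEq ν] (r : ARule L κ ν) (k : ℕ) (H₁ H₂ : List (IdAtom L κ))
    (S : Multiset (IdAtom L κ)) (X : Conf L κ ν) (ρ : Equiv.Perm ℕ) :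
    (r.result k H₁ H₂ S X).rename ρ = (r.rename ρ).result k (H₁.map (renameId ρ 1))
      (H₂.map (renameId ρ 1)) (S.map (renameId ρ 1)) (X.rename ρ) := by
  simp only [ARule.result, Conf.rename, Conf.mk.injEq]
  refine ⟨?_, ?_, ?_⟩
  · simp [shift, ARule.rename, renameId, Function.comp_def]
  · rw [← List.map_append (f := renameId ρ 1), map_fst_map_renameId]
    simp only [ARule.rename, ← List.map_append, eqs_map_rename, Con.rename_add]
  · simp [ARule.rename, renameId, Function.comp_def]

theorem Conf.rename_rename_inv (X : Conf L κ ν) (ρ : Equiv.Perm ℕ) :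
    (X.rename ρ⁻¹).rename ρ = X := by
  simp [Conf.rename, Con.rename_rename, renameId_renameId]

theorem map_renameId_rename_inv (H : List (IdAtom L κ)) (ρ : Equiv.Perm ℕ) :
    (H.map (renameId ρ⁻¹ 1)).map (renameId ρ 1) = H := by
  simp [Function.comp_def, renameId_renameId]

theorem multiset_map_renameId_rename_inv (H : Multiset (IdAtom L κ)) (ρ : Equiv.Perm ℕ) :
    (H.map (renameId ρ⁻¹ 1)).map (renameId ρ 1) = H := by
  simp [renameId_renameId]

theorem Enabled.vars_result_subset [DecidableEq ν] {r : ARule L κ ν} {H₁ H₂ : List (IdAtom L κ)}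
    {S : Multiset (IdAtom L κ)} {X : Conf L κ ν} (h : Enabled CT r V H₁ H₂ S X) (k : ℕ) :
    (r.result k H₁ H₂ S X).vars ⊆ r.vars ∪ X.vars := by
  have hX : ∀ p ∈ (H₁ : Multiset (IdAtom L κ)) + H₂ + S, p.1.vars ⊆ X.vars := by
    intro p hp x hx
    rw [← h.chr_eq] at hp
    exact Or.inl ⟨p, hp, hx⟩
  have hm : Matches ((H₁ ++ H₂).map Prod.fst) (r.kept ++ r.removed) := by
    rw [List.map_append]
    exact h.match₁.append h.match₂
  rintro x (⟨p, hp, hx⟩ | hx)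
  · simp only [ARule.result, Multiset.mem_add, shift, Multiset.mem_map, Multiset.mem_coe] at hp hX
    rcases hp with (⟨q, hq, rfl⟩ | hp) | hp
    · exact Or.inl (Or.inl (Or.inr ⟨q, hq, hx⟩))
    · exact Or.inr (hX p (by simp [hp]) hx)
    · exact Or.inr (hX p (by simp [hp]) hx)
  · simp only [ARule.result, Con.vars_add, Set.mem_union] at hx
    rcases hx with hx | hx | hx
    · exact Or.inl (Or.inr hx)
    · rcases (mem_vars_eqs hm).1 hx with ⟨a, ha, hx⟩ | ⟨a, ha, hx⟩
      · obtain ⟨p, hp, rfl⟩ := List.mem_map.1 ha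
        refine Or.inr (hX p ?_ hx)
        simp only [Multiset.mem_add, Multiset.mem_coe]
        simp only [List.mem_append] at hp
        exact Or.inl hp
      · exact Or.inl (Or.inl (Or.inl (Or.inl ⟨a, ha, hx⟩)))
    · exact Or.inr (Or.inr hx)

/-- In a state reached by applying a rule, the head variables have the only values that make the
guard true. -/
theorem Enabled.guard_holds (hCT : ClarkEquality CT) {r : ARule L κ ν}
    {H₁ H₂ : List (IdAtom L κ)} {S : Multiset (IdAtom L κ)} {X : Conf L κ ν}
    (h : Enabled CT r V H₁ H₂ S X) (M : Theory.ModelType.{u, v, max u v} CT) (e : ℕ → M)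
    (hE : (eqs ((H₁ ++ H₂).map Prod.fst) (r.kept ++ r.removed)).Holds e) (hX : X.con.Holds e) :
    r.guard.Holds e := by
  have hm : Matches ((H₁ ++ H₂).map Prod.fst) (r.kept ++ r.removed) := by
    rw [List.map_append]
    exact h.match₁.append h.match₂
  obtain ⟨e', h1, h2⟩ := h.guard M e hX
  rw [Con.holds_add, holds_eqs hm] at h2
  rw [holds_eqs hm] at hE
  suffices e' = e by
    rw [← this]
    exact h2.2
  -- The matched constraints contain no variable of the rule, so they have the same value under `e`
  -- and `e'`. Both valuations satisfy the equations with the head, whose value therefore agrees as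
  -- well, and by injectivity so do the head variables.
  have hH : ((H₁ ++ H₂).map Prod.fst).map (Atom.eval e) =
      ((H₁ ++ H₂).map Prod.fst).map (Atom.eval e') := by
    refine List.map_congr_left fun a ha => Atom.eval_congr fun x hx => (h1 x fun hxr => ?_).symm
    obtain ⟨p, hp, rfl⟩ := List.mem_map.1 ha
    refine Set.disjoint_left.1 h.fresh_state (Or.inl (Or.inl (Or.inl hxr))) (Or.inl ⟨p, ?_, hx⟩)
    rw [h.chr_eq, Multiset.coe_add]
    exact Multiset.mem_add.2 (Or.inl hp)
  rw [hE, h2.1, List.map_inj_left] at hH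
  funext x
  by_cases hx : x ∈ r.headVars
  · obtain ⟨a, ha, hx⟩ := hx
    exact (hCT.eq_of_eval_eq M (hH a ha) x hx).symm
  · exact h1 x hx

/-! ### Unfolding -/

theorem matches_map_subst {as bs : List (Atom L κ)} (θ : ℕ → L.Term ℕ) (h : Matches as bs) :
    Matches as (bs.map (Atom.subst θ)) := by
  unfold Matches at *
  rw [List.forall₂_map_right_iff]
  exact h.imp fun a b h => by simpa [Atom.subst] using h

theorem Matches.nil_iff {as bs : List (Atom L κ)} (h : Matches as bs) : as = [] ↔ bs = [] := by
  rw [← List.length_eq_zero_iff, ← List.length_eq_zero_iff, List.Forall₂.length_eq h]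

theorem mem_clean {B : Multiset (IdAtom L κ)} {T : Finset (Token ν)} {a : ν} {l : List ℕ} :
    (a, l) ∈ clean B T ↔ (a, l) ∈ T ∧ ∀ i ∈ l, i ∈ B.map Prod.snd := by
  simp [clean]

/-- A rule with an equivalent guard and the same head can be applied as well. -/
theorem Enabled.of_equivalent_guard (hV : V.Finite) {r r' : ARule L κ ν} (hname : r'.name = r.name)
    (hkept : r'.kept = r.kept) (hremoved : r'.removed = r.removed)
    (hguard : Equivalent CT r.guard r'.guard) {ρ : Equiv.Perm ℕ} {X : Conf L κ ν}
    {H₁ H₂ : List (IdAtom L κ)} {S : Multiset (IdAtom L κ)}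
    (h : Enabled CT (r.rename ρ) V H₁ H₂ S X) :
    ∃ σ, Enabled CT (r'.rename σ) V H₁ H₂ S X := by
  -- The rule `r'` may have variables that `r` lacks. They are made fresh while the variables of
  -- `r`, in particular those of the common head, are renamed as before.
  obtain ⟨σ, hσ, hσF⟩ := exists_perm_fresh (A := r.vars) (R := r'.vars \ r.vars)
    (F := V ∪ X.vars) r.finite_vars (r'.finite_vars.subset Set.sdiff_subset)
    (hV.union X.finite_vars) Set.disjoint_sdiff_right ρ
  have hd : Disjoint (r'.rename σ).vars (V ∪ X.vars) := by
    rw [ARule.vars_rename]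
    refine disjoint_image_of_forall fun x hx => ?_
    by_cases hx' : x ∈ r.vars
    · rw [hσ x hx']
      have hm : ρ x ∈ (r.rename ρ).vars := by
        rw [ARule.vars_rename]
        exact ⟨x, hx', rfl⟩
      rintro (h' | h')
      · exact Set.disjoint_left.1 h.fresh_start hm h'
      · exact Set.disjoint_left.1 h.fresh_state hm h'
    · exact hσF x ⟨hx, hx'⟩
  have h1 : (r'.rename σ).kept = (r.rename ρ).kept := by
    simp only [ARule.rename, hkept]
    exact List.map_congr_left fun a ha => Atom.rename_congr fun x hx =>
      hσ x (Or.inl (Or.inl (Or.inl ⟨a, List.mem_append_left _ ha, hx⟩)))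
  have h2 : (r'.rename σ).removed = (r.rename ρ).removed := by
    simp only [ARule.rename, hremoved]
    exact List.map_congr_left fun a ha => Atom.rename_congr fun x hx =>
      hσ x (Or.inl (Or.inl (Or.inl ⟨a, List.mem_append_right _ ha, hx⟩)))
  have h3 : Equivalent CT (r.rename ρ).guard (r'.rename σ).guard := by
    have := hguard.rename σ
    rw [Con.rename_congr fun x hx => hσ x (Or.inl (Or.inl (Or.inr hx)))] at this
    exact this
  refine ⟨σ, h.chr_eq, (Set.disjoint_union_right.1 hd).1, (Set.disjoint_union_right.1 hd).2,
    h1 ▸ h.match₁, h2 ▸ h.match₂, ?_, ?_⟩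
  · rw [show (r'.rename σ).headVars = (r.rename ρ).headVars by
      simp only [ARule.headVars, h1, h2], h1, h2]
    exact h.guard.mono (fun _ _ h => h) ((Equivalent.refl _).add h3).1
  · have := h.token
    simpa [ARule.rename, hname] using this

theorem SameRules.good {P Q : Set (ARule L κ ν)} (h : SameRules P Q) (hQ : ∀ r ∈ Q, r.Good) :
    ∀ r ∈ P, r.Good := by
  intro r hr
  obtain ⟨s, hs, ρ, rfl⟩ := h.1 r hr
  have := (hQ _ hs).rename ρ⁻¹
  rwa [ARule.rename_inv_rename] at this

variable [DecidableEq ν]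

theorem Unfolds.good {r v r' : ARule L κ ν} (h : Unfolds CT r v r') (hr : r.Good) (hv : v.Good) :
    r'.Good := by
  obtain ⟨K, S₁, S₂, θ, apart, body, match₁, match₂, dom, matching, token, satisfiable⟩ := h
  have hS : ∀ p ∈ K + (S₁ : Multiset (IdAtom L κ)), 1 ≤ p.2 := fun p hp =>
    hr.chr_pos p (by rw [body]; exact Multiset.mem_add.2 (Or.inl hp))
  refine ⟨hr.heads, ?_, ?_⟩
  · intro p hp
    rcases Multiset.mem_add.1 hp with hp | hp
    · exact hS p hp
    · obtain ⟨q, hq, rfl⟩ := Multiset.mem_map.1 hp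
      exact (hv.chr_pos q hq).trans (Nat.le_add_right _ _)
  · rintro ⟨a, l⟩ ht i hi
    simp only [Finset.mem_union, mem_clean, mem_shiftTokens] at ht
    rcases ht with (ht | ⟨l', hl', rfl⟩) | ht
    · exact hr.tokens_pos _ ht.1 i hi
    · obtain ⟨j, hj, rfl⟩ := List.mem_map.1 hi
      exact (hv.tokens_pos _ hl' j hj).trans (Nat.le_add_right _ _)
    · split_ifs at ht
      · rw [Finset.mem_singleton, Prod.mk.injEq] at ht
        obtain ⟨rfl, rfl⟩ := ht
        obtain ⟨p, hp, rfl⟩ := List.mem_map.1 hi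
        exact hS p (by simp [hp])
      · simp at ht

/-- An application of an unfolded rule amounts to an application of the rule followed by one of the
unfolding rule. -/
theorem Unfolds.decompose (hCT : ClarkEquality CT) {r v r' : ARule L κ ν}
    (hu : Unfolds CT r v r') (hr : r.Good) (hv : v.Good) (hV : V.Finite) {X : Conf L κ ν}
    {H₁ H₂ : List (IdAtom L κ)} {S : Multiset (IdAtom L κ)} {k : ℕ} (hk : X.Bounded k)
    (hen : Enabled CT r' V H₁ H₂ S X) :
    Enabled CT r V H₁ H₂ S X ∧ ∃ (σ : Equiv.Perm ℕ) (K₁ K₂ : List (IdAtom L κ))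
      (K : Multiset (IdAtom L κ)), Enabled CT (v.rename σ) V K₁ K₂ K (r.result k H₁ H₂ S X) ∧
        SimWith CT 1 1 ((v.rename σ).result (k + maxId r.chr r.tokens) K₁ K₂ K
          (r.result k H₁ H₂ S X)) (r'.result k H₁ H₂ S X) := by
  classical
  obtain ⟨K, S₁, S₂, θ, apart, body, match₁, match₂, dom, matching, token, satisfiable⟩ := hu
  set res := residualGuard CT (r.bi + r.guard) v.guard θ with hres
  set r' : ARule L κ ν :=
        { name := r.name
          kept := r.kept
          removed := r.removed
          guard := r.guard + res
          chr := K + (S₁ : Multiset (IdAtom L κ)) + shift (maxId r.chr r.tokens) v.chr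
          bi := v.bi + r.bi + eqs ((S₁ ++ S₂).map Prod.fst) (v.kept ++ v.removed)
          tokens := clean (K + (S₁ : Multiset (IdAtom L κ))) r.tokens ∪
            shiftTokens (maxId r.chr r.tokens) v.tokens ∪
            (if v.removed = [] then {(v.name, S₁.map Prod.snd)} else ∅) } with hr'
  have hm : Matches ((S₁ ++ S₂).map Prod.fst) (v.kept ++ v.removed) := by
    rw [List.map_append]
    exact match₁.append match₂
  -- The equations added to the body mention the head of `v` and the constraints of `r` that are
  -- consumed. So `r'` contains all variables of `r` and all of `v`, except possibly some that occur
  -- only in the guard of `v`.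
  have hhead : v.headVars ⊆ r'.vars := fun x hx => by
    refine Or.inr ?_
    simp only [hr', Con.vars_add, Set.mem_union]
    exact Or.inr ((mem_vars_eqs hm).2 (Or.inr hx))
  have hchr : chrVars v.chr ⊆ r'.vars := by
    rintro x ⟨p, hp, hx⟩
    refine Or.inl (Or.inr ⟨(p.1, p.2 + maxId r.chr r.tokens), ?_, hx⟩)
    exact Multiset.mem_add.2 (Or.inr (Multiset.mem_map_of_mem _ hp))
  have hbi : Con.vars v.bi ⊆ r'.vars := fun x hx => by
    refine Or.inr ?_
    simp only [hr', Con.vars_add, Set.mem_union]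
    exact Or.inl (Or.inl hx)
  have hsub : r.vars ⊆ r'.vars := by
    rintro x (((hx | hx) | ⟨p, hp, hx⟩) | hx)
    · exact Or.inl (Or.inl (Or.inl hx))
    · refine Or.inl (Or.inl (Or.inr ?_))
      simp only [hr', Con.vars_add, Set.mem_union]
      exact Or.inl hx
    · rw [body, Multiset.mem_add] at hp
      rcases hp with hp | hp
      · exact Or.inl (Or.inr ⟨p, Multiset.mem_add.2 (Or.inl hp), hx⟩)
      · refine Or.inr ?_
        simp only [hr', Con.vars_add, Set.mem_union]
        refine Or.inr ((mem_vars_eqs hm).2 (Or.inl ⟨p.1, ?_, hx⟩))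
        exact List.mem_map_of_mem (List.mem_append_right _ hp)
    · refine Or.inr ?_
      simp only [hr', Con.vars_add, Set.mem_union]
      exact Or.inl (Or.inr hx)
  have hen₁ : Enabled CT r V H₁ H₂ S X :=
    { chr_eq := hen.chr_eq
      fresh_start := hen.fresh_start.mono_left hsub
      fresh_state := hen.fresh_state.mono_left hsub
      match₁ := hen.match₁
      match₂ := hen.match₂
      guard := hen.guard.mono (fun _ _ h => h) (by
        intro M e he
        simp only [hr', Con.holds_add] at he ⊢
        exact ⟨he.1, he.2.1⟩)
      token := hen.token }
  refine ⟨hen₁, ?_⟩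
  set X₁ := r.result k H₁ H₂ S X with hX₁
  -- The freshness of `r'` says nothing about variables that occur only in the guard of `v`. These
  -- are moved away, and all variables of `r'` stay fixed, so that the head and the body of `v` do
  -- not change.
  obtain ⟨σ, hσ, hσF⟩ := exists_perm_fresh (A := r'.vars) (R := v.vars \ r'.vars)
    (F := V ∪ X₁.vars) r'.finite_vars (v.finite_vars.subset Set.sdiff_subset)
    (hV.union X₁.finite_vars) Set.disjoint_sdiff_right 1
  simp only [Equiv.Perm.one_apply] at hσ
  have hkept : (v.rename σ).kept = v.kept := by
    conv_rhs => rw [← List.map_id v.kept]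
    refine List.map_congr_left fun a ha => ?_
    rw [Atom.rename_congr (σ := 1), Atom.rename_one, id]
    exact fun x hx => hσ x (hhead ⟨a, List.mem_append_left _ ha, hx⟩)
  have hremoved : (v.rename σ).removed = v.removed := by
    conv_rhs => rw [← List.map_id v.removed]
    refine List.map_congr_left fun a ha => ?_
    rw [Atom.rename_congr (σ := 1), Atom.rename_one, id]
    exact fun x hx => hσ x (hhead ⟨a, List.mem_append_right _ ha, hx⟩)
  have hvbi : (v.rename σ).bi = v.bi := by
    simp only [ARule.rename]
    rw [Con.rename_congr (σ := 1), Con.rename_one]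
    exact fun x hx => hσ x (hbi hx)
  have hvchr : (v.rename σ).chr = v.chr := by
    conv_rhs => rw [← Multiset.map_id v.chr]
    refine Multiset.map_congr rfl fun p hp => ?_
    rw [Atom.rename_congr (σ := 1), Atom.rename_one, id]
    exact fun x hx => hσ x (hchr ⟨p, hp, hx⟩)
  have hfresh : Disjoint (v.rename σ).vars (V ∪ X₁.vars) := by
    rw [ARule.vars_rename]
    refine disjoint_image_of_forall fun x hx => ?_
    by_cases hx' : x ∈ r'.vars
    · rw [hσ x hx']
      rintro (h | h)
      · exact Set.disjoint_left.1 hen.fresh_start hx' h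
      · rcases hen₁.vars_result_subset k h with h | h
        · exact Set.disjoint_left.1 apart h hx
        · exact Set.disjoint_left.1 hen.fresh_state hx' h
    · exact hσF x ⟨hx, hx'⟩
  have hhv : (v.rename σ).headVars = v.headVars := by
    simp only [ARule.headVars, hkept, hremoved]
  let sh : IdAtom L κ → IdAtom L κ := fun p => (p.1, p.2 + k)
  have hfst : ∀ l : List (IdAtom L κ), (l.map sh).map Prod.fst = l.map Prod.fst := fun l => by
    simp [sh, Function.comp_def]
  have hsnd : ∀ l : List (IdAtom L κ), (l.map sh).map Prod.snd = (l.map Prod.snd).map (· + k) :=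
    fun l => by simp [sh, Function.comp_def]
  have hSpos : ∃ p, p ∈ S₁ ++ S₂ := by
    have h1 : (S₁ ++ S₂).map Prod.fst ≠ [] := fun h => hv.heads (hm.nil_iff.1 h)
    exact List.exists_mem_of_ne_nil _ fun h => h1 (by rw [h]; rfl)
  have hS1 : ∀ p ∈ S₁ ++ S₂, p ∈ r.chr := by
    intro p hp
    rw [body, add_assoc, Multiset.coe_add]
    exact Multiset.mem_add.2 (Or.inr hp)
  have hfsts : ((S₁.map sh ++ S₂.map sh).map Prod.fst) = (S₁ ++ S₂).map Prod.fst := by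
    rw [← List.map_append, hfst]
  have hsnds : ((S₁.map sh ++ S₂.map sh).map Prod.snd) =
      ((S₁ ++ S₂).map Prod.snd).map (· + k) := by
    rw [← List.map_append, hsnd]
  -- The constraints matched by `v` form a nonempty list, and their shifted identifiers exceed `k`.
  -- Hence the token that could block `v` is neither an old one nor the one created by `r`; it could
  -- only come from the body of `r`, which `token` excludes.
  have hbig : ∀ l : List ℕ, (∀ i ∈ l, i ≤ k) → l ≠ ((S₁ ++ S₂).map Prod.snd).map (· + k) := by
    rintro l hl rfl
    obtain ⟨p, hp⟩ := hSpos
    have := hl _ (List.mem_map_of_mem (List.mem_map_of_mem hp))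
    have := hr.chr_pos p (hS1 p hp)
    omega
  have hH₁ : ∀ i ∈ H₁.map Prod.snd, i ≤ k := by
    intro i hi
    obtain ⟨p, hp, rfl⟩ := List.mem_map.1 hi
    exact hk.chr p (by rw [hen.chr_eq]; simp [hp])
  have hnil : S₂ = [] ↔ v.removed = [] := by
    rw [← match₂.nil_iff, List.map_eq_nil_iff]
  refine ⟨σ, S₁.map sh, S₂.map sh, shift k K + (H₁ : Multiset (IdAtom L κ)) + S, ?_, ?_⟩
  · refine
      { chr_eq := ?_
        fresh_start := (Set.disjoint_union_right.1 hfresh).1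
        fresh_state := (Set.disjoint_union_right.1 hfresh).2
        match₁ := by rw [hfst, hkept]; exact match₁
        match₂ := by rw [hfst, hremoved]; exact match₂
        guard := ?_
        token := ?_ }
    · simp only [hX₁, ARule.result, body, shift, Multiset.map_add, Multiset.map_coe, sh]
      abel
    · rw [hfsts, hkept, hremoved, hhv]
      intro M e he
      simp only [hX₁, ARule.result, Con.holds_add] at he
      obtain ⟨hbi_e, hE, hX⟩ := he
      -- Enabledness of `r'` gives its guard only for some values of the head variables. Injectivity
      -- identifies these with the actual values, so the residual guard holds at `e` itself.
      have hg := hen.guard_holds hCT M e hE hX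
      have hagree : ∀ x ∈ r'.vars, (e ∘ σ) x = e x := fun x hx => by simp [hσ x hx]
      have hg' : r'.guard.Holds (e ∘ σ) :=
        (Con.holds_congr fun x hx => hagree x (Or.inl (Or.inl (Or.inr hx)))).2 hg
      have hbi' : r.bi.Holds (e ∘ σ) :=
        (Con.holds_congr fun x hx => hagree x (hsub (Or.inr hx))).2 hbi_e
      simp only [hr', Con.holds_add] at hg'
      have hmatch := matching M (e ∘ σ) (Con.holds_add.2 ⟨hbi', hg'.1⟩)
      rw [holds_eqs (matches_map_subst θ hm), List.map_map (f := Atom.subst θ)] at hmatch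
      -- The witness gives each head variable of `v` the value of its image under `θ`. Composition
      -- with `σ` accounts for the renamed variables of the guard of `v`.
      set e₁ : ℕ → M := fun x => (θ x).realize (e ∘ σ) with he₁
      let e₂ : ℕ → M := fun x => if x ∈ v.headVars then e₁ x else e x
      have he₂ : e₂ ∘ σ = e₁ := by
        funext x
        by_cases hx : x ∈ v.headVars
        · simp only [Function.comp, hσ x (hhead hx), e₂, if_pos hx]
        · have : σ x ∉ v.headVars := fun h => hx (by
            have := hσ _ (hhead h)
            rwa [σ.injective this] at h)
          simp only [Function.comp, e₂, if_neg this, he₁, dom x hx, Term.realize_var]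
      refine ⟨e₂, fun y hy => if_neg hy, ?_⟩
      rw [Con.holds_add, holds_eqs hm]
      constructor
      · refine Eq.trans (List.map_congr_left fun a ha => Atom.eval_congr fun x hx => ?_)
          (hmatch.trans (List.map_congr_left fun a ha => ?_))
        · obtain ⟨p, hp, rfl⟩ := List.mem_map.1 ha
          have hxr : x ∈ r.vars := Or.inl (Or.inr ⟨p, hS1 p hp, hx⟩)
          have hxv : x ∉ v.headVars := fun h =>
            Set.disjoint_left.1 apart hxr (Or.inl (Or.inl (Or.inl h)))
          rw [hagree x (hsub hxr)]
          exact if_neg hxv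
        · rw [Function.comp, Atom.eval_subst]
          refine Atom.eval_congr fun x hx => ?_
          exact (if_pos (show x ∈ v.headVars from ⟨a, ha, hx⟩)).symm
      · simp only [ARule.rename]
        rw [Con.holds_rename, he₂]
        intro c hc
        -- A constraint of the guard of `v` either follows from the body and guard of `r`, or was
        -- kept in the residual guard.
        by_cases hent : Entails CT (r.bi + r.guard) (Con.subst θ {c})
        · have := hent M (e ∘ σ) (Con.holds_add.2 ⟨hbi', hg'.1⟩)
          rw [Con.holds_subst] at this
          exact this c (by simp)
        · have := hg'.2
          rw [hres, residualGuard, Con.holds_subst] at this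
          exact this c (Multiset.mem_filter.2 ⟨hc, hent⟩)
    · rw [hsnds, hX₁, mem_result_tokens]
      rintro (h | ⟨-, -, h⟩ | ⟨l', hl', h⟩)
      · exact hbig _ (hk.tokens _ h) rfl
      · exact hbig _ hH₁ h.symm
      · rw [List.map_inj_right (add_left_injective k)] at h
        subst h
        exact token hl'
  · refine ⟨?_, ?_, ?_⟩
    · simp only [renameId_one_one, Multiset.map_id']
      simp only [ARule.result, hvchr, hr', shift, Multiset.map_add, Multiset.map_map,
        Multiset.map_coe, Function.comp_def, sh]
      have : ∀ p : IdAtom L κ, p.2 + maxId r.chr r.tokens + k = p.2 + (k + maxId r.chr r.tokens) :=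
        fun p => by omega
      simp only [this]
      abel
    · rw [Con.rename_one]
      simp only [hX₁, ARule.result, hvbi, hfsts, hkept, hremoved, hr']
      rw [show v.bi + (eqs ((S₁ ++ S₂).map Prod.fst) (v.kept ++ v.removed) +
          (r.bi + (eqs ((H₁ ++ H₂).map Prod.fst) (r.kept ++ r.removed) + X.con))) =
        v.bi + r.bi + eqs ((S₁ ++ S₂).map Prod.fst) (v.kept ++ v.removed) +
          (eqs ((H₁ ++ H₂).map Prod.fst) (r.kept ++ r.removed) + X.con) by abel]
      exact Equivalent.refl _
    · intro a l hl
      rw [Equiv.Perm.coe_one, List.map_id, mem_result_tokens, hX₁, mem_result_tokens,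
        mem_result_tokens]
      -- The tokens of `r` deleted by unfolding are invisible to `SimWith`. The identifiers of `X`
      -- are at most `k` and those coming from `v` exceed `k + maxId r.chr r.tokens`, so a live
      -- identifier between the two belongs to `K` or `S₁`.
      have hclean : ∀ l', (a, l') ∈ r.tokens → l'.map (· + k) = l →
          ∀ i ∈ l', i ∈ (K + (S₁ : Multiset (IdAtom L κ))).map Prod.snd := by
        rintro l' hl' rfl i hi
        have hi1 := hr.tokens_pos _ hl' i hi
        have hi2 : i ≤ maxId r.chr r.tokens := le_maxId_of_mem_token hl' hi
        obtain ⟨p, hp, hpi⟩ := Multiset.mem_map.1 (hl _ (List.mem_map_of_mem hi))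
        simp only [ARule.result, hvchr, Multiset.mem_add, shift, Multiset.mem_map,
          Multiset.mem_coe, List.mem_map] at hp
        have hXk : ∀ p, p ∈ (H₁ : Multiset (IdAtom L κ)) + H₂ + S → p.2 ≤ k := fun p hp =>
          hk.chr p (by rw [hen.chr_eq]; exact hp)
        rcases hp with (⟨q, hq, rfl⟩ | ⟨q, hq, rfl⟩) | ((⟨q, hq, rfl⟩ | hp) | hp)
        · have := hv.chr_pos q hq
          simp only at hpi
          omega
        · refine Multiset.mem_map.2 ⟨q, Multiset.mem_add.2 (Or.inr hq), ?_⟩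
          simp only [sh] at hpi
          omega
        · refine Multiset.mem_map.2 ⟨q, Multiset.mem_add.2 (Or.inl hq), ?_⟩
          simp only at hpi
          omega
        · have := hXk p (by simp [hp])
          omega
        · have := hXk p (by simp [hp])
          omega
      have htok : ∀ l', (a, l') ∈ r'.tokens ↔
          ((a, l') ∈ r.tokens ∧ ∀ i ∈ l', i ∈ (K + (S₁ : Multiset (IdAtom L κ))).map Prod.snd) ∨
          (∃ l'', (a, l'') ∈ v.tokens ∧ l''.map (· + maxId r.chr r.tokens) = l') ∨
          (v.removed = [] ∧ a = v.name ∧ l' = S₁.map Prod.snd) := by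
        intro l'
        simp only [hr', Finset.mem_union, mem_clean, mem_shiftTokens, or_assoc]
        refine or_congr_right (or_congr_right ?_)
        split_ifs with h <;> simp [h]
      simp only [htok, List.map_eq_nil_iff, hnil, hsnd]
      constructor
      · rintro ((h | h | ⟨l', h, rfl⟩) | ⟨h1, h2, h3⟩ | ⟨l', h, rfl⟩)
        · exact Or.inl h
        · exact Or.inr (Or.inl h)
        · exact Or.inr (Or.inr ⟨l', Or.inl ⟨h, hclean l' h rfl⟩, rfl⟩)
        · exact Or.inr (Or.inr ⟨_, Or.inr (Or.inr ⟨h1, h2, rfl⟩), h3.symm⟩)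
        · refine Or.inr (Or.inr ⟨_, Or.inr (Or.inl ⟨l', h, rfl⟩), ?_⟩)
          rw [List.map_map]
          refine List.map_congr_left fun i _ => ?_
          simp only [Function.comp]
          omega
      · rintro (h | h | ⟨l', ⟨h, -⟩ | ⟨l'', h, rfl⟩ | ⟨h1, h2, rfl⟩, rfl⟩)
        · exact Or.inl (Or.inl h)
        · exact Or.inl (Or.inr (Or.inl h))
        · exact Or.inl (Or.inr (Or.inr ⟨l', h, rfl⟩))
        · refine Or.inr (Or.inr ⟨l'', h, ?_⟩)
          rw [List.map_map]
          refine List.map_congr_left fun i _ => ?_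
          simp only [Function.comp]
          omega
        · exact Or.inr (Or.inl ⟨h1, h2, rfl⟩)

/-- An application of an unfolded rule is simulated by two applications of the given rules. -/
theorem Unfolds.fire (hCT : ClarkEquality CT) {Q : Set (ARule L κ ν)} (hQ : ∀ r ∈ Q, r.Good)
    {r v r' : ARule L κ ν} (hr : r ∈ Q) (hv : v ∈ Q) {ρv : Equiv.Perm ℕ}
    (hu : Unfolds CT r (v.rename ρv) r') (hV : V.Finite) {X : Conf L κ ν}
    {H₁ H₂ : List (IdAtom L κ)} {S : Multiset (IdAtom L κ)} {k : ℕ} (hk : X.Bounded k)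
    {ρ : Equiv.Perm ℕ} (hen : Enabled CT (r'.rename ρ) V H₁ H₂ S X) :
    ∃ X₁ X₂, Fire CT Q V X X₁ ∧ Fire CT Q V X₁ X₂ ∧
      Sim CT V X₂ ((r'.rename ρ).result k H₁ H₂ S X) := by
  -- The renaming of `r'` is moved onto the configuration, the application is decomposed there, and
  -- the result is renamed back.
  have hen' := hen.rename ρ⁻¹
  rw [ARule.rename_inv_rename] at hen'
  obtain ⟨h1, σ, K₁, K₂, K, h2, h3⟩ := hu.decompose hCT (hQ r hr) ((hQ v hv).rename ρv)
    (hV.image _) (hk.rename ρ⁻¹) hen'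
  have hbd := (h1.result_bounded (hk.rename ρ⁻¹)).rename ρ
  have hVV : ⇑ρ '' (⇑ρ⁻¹ '' V) = V := by
    ext x
    simp
  have h1' := h1.rename ρ
  have h2' := h2.rename ρ
  rw [hVV] at h1' h2'
  have e1 := r.result_rename k (H₁.map (renameId ρ⁻¹ 1)) (H₂.map (renameId ρ⁻¹ 1))
    (S.map (renameId ρ⁻¹ 1)) (X.rename ρ⁻¹) ρ
  have e' := r'.result_rename k (H₁.map (renameId ρ⁻¹ 1)) (H₂.map (renameId ρ⁻¹ 1))
    (S.map (renameId ρ⁻¹ 1)) (X.rename ρ⁻¹) ρ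
  rw [map_renameId_rename_inv, map_renameId_rename_inv, multiset_map_renameId_rename_inv,
    Conf.rename_rename_inv] at h1' e1 e'
  have e2 := ((v.rename ρv).rename σ).result_rename (k + maxId r.chr r.tokens) K₁ K₂ K
    (r.result k (H₁.map (renameId ρ⁻¹ 1)) (H₂.map (renameId ρ⁻¹ 1)) (S.map (renameId ρ⁻¹ 1))
      (X.rename ρ⁻¹)) ρ
  have e3 : ((v.rename ρv).rename σ).rename ρ = v.rename (ρ * (σ * ρv)) := by
    rw [ARule.rename_rename, ARule.rename_rename, mul_assoc]
  rw [e3] at h2' e2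
  refine ⟨_, _, ⟨r, hr, ρ, k, H₁, H₂, S, hk, h1', e1⟩,
    ⟨v, hv, _, _, _, _, _, hbd, h2', e2⟩, ?_⟩
  rw [← e']
  refine ⟨1, 1, fun _ _ => rfl, ?_⟩
  have := ((SimWith.rename ρ _).symm.trans h3).trans (SimWith.rename ρ _)
  simpa using this

/-! ### Weak safe replacement -/

theorem good_of_mem_unf {Q : Set (ARule L κ ν)} (hQ : ∀ r ∈ Q, r.Good) {r : ARule L κ ν}
    (hr : r ∈ Q) : ∀ s ∈ (Q \ {s | Variant r s}) ∪ Unf CT Q r, s.Good := by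
  rintro s (hs | ⟨v, hv, ρ, hu⟩)
  · exact hQ s hs.1
  · exact hu.good (hQ r hr) ((hQ v hv).rename ρ)

/-- A rule application in the new program is simulated in the old one. -/
theorem fire_simulated (hCT : ClarkEquality CT) (hV : V.Finite) {Q Q' : Set (ARule L κ ν)}
    (hQ : ∀ r ∈ Q, r.Good) {r : ARule L κ ν} (hr : r ∈ Q)
    (hQ' : SameRules Q' ((Q \ {s | Variant r s}) ∪ Unf CT Q r)) {X X' : Conf L κ ν}
    (h : Fire CT Q' V X X') :
    ∃ X₂, Relation.TransGen (Fire CT Q V) X X₂ ∧ Sim CT V X₂ X' := by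
  obtain ⟨r₀, hr₀, ρ₀, k, H₁, H₂, S, hk, hen, rfl⟩ := h
  obtain ⟨s, hs, ρ, rfl⟩ := hQ'.1 r₀ hr₀
  have hs' : ∃ σ, r₀ = (r₀.rename ρ).rename σ := ⟨ρ⁻¹, (ARule.rename_inv_rename _ _).symm⟩
  obtain ⟨σ, hσ⟩ := hs'
  rcases hs with hs | ⟨v, hv, ρv, hu⟩
  · refine ⟨_, .single ⟨r₀.rename ρ, hs.1, ρ₀ * σ, k, H₁, H₂, S, hk, ?_, rfl⟩, ?_⟩
    · rwa [← ARule.rename_rename, ← hσ]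
    · rw [← ARule.rename_rename, ← hσ]
      exact Sim.refl _
  · rw [hσ, ARule.rename_rename] at hen ⊢
    obtain ⟨X₁, X₂, h1, h2, h3⟩ := hu.fire hCT hQ hr hv hV hk hen
    exact ⟨X₂, .tail (.single h1) h2, h3⟩

/-- Weak safe replacement preserves the possibility of rule applications. -/
theorem exists_fire_of_fire (hV : V.Finite) {Q Q' : Set (ARule L κ ν)} {r : ARule L κ ν}
    (hr : WeaklySafe CT Q r) (hQ' : SameRules Q' ((Q \ {s | Variant r s}) ∪ Unf CT Q r))
    {X X' : Conf L κ ν} (h : Fire CT Q V X X') : ∃ Y, Fire CT Q' V X Y := by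
  have key : ∀ s ∈ (Q \ {s | Variant r s}) ∪ Unf CT Q r, ∀ (ρ : Equiv.Perm ℕ) (k : ℕ)
      (H₁ H₂ : List (IdAtom L κ)) (S : Multiset (IdAtom L κ)), X.Bounded k →
      Enabled CT (s.rename ρ) V H₁ H₂ S X → ∃ Y, Fire CT Q' V X Y := by
    intro s hs ρ k H₁ H₂ S hk hen
    obtain ⟨r₀, hr₀, σ, rfl⟩ := hQ'.2 s hs
    exact ⟨_, r₀, hr₀, ρ * σ, k, H₁, H₂, S, hk, by rwa [← ARule.rename_rename], rfl⟩
  obtain ⟨r₀, hr₀, ρ₀, k, H₁, H₂, S, hk, hen, rfl⟩ := h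
  by_cases hvar : Variant r r₀
  · obtain ⟨ρ, rfl⟩ := hvar
    -- Enabledness depends on the body only through freshness of variables, so the unfolding with an
    -- equivalent guard is enabled wherever the replaced rule is.
    obtain ⟨-, r', hr', hguard⟩ := hr
    have hu := hr'
    obtain ⟨v, hv, ρv, hu⟩ := hu
    have h3 : r'.name = r.name ∧ r'.kept = r.kept ∧ r'.removed = r.removed := by
      obtain ⟨⟩ := hu
      exact ⟨rfl, rfl, rfl⟩
    rw [ARule.rename_rename] at hen
    obtain ⟨σ, hσ⟩ := hen.of_equivalent_guard hV h3.1 h3.2.1 h3.2.2 hguard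
    exact key r' (Or.inr hr') σ k H₁ H₂ S hk hσ
  · exact key r₀ (Or.inl ⟨hr₀, hvar⟩) ρ₀ k H₁ H₂ S hk hen

end Unfold

/-! ### Derivations and their abstract configurations -/

section Concrete

variable {L : FirstOrder.Language.{u, v}} {κ : Type w} {ν : Type z} {CT : L.Theory} {V : Set ℕ}

/-! ### Annotation -/

theorem number_map (f : Atom L κ → Atom L κ) (l : List (Atom L κ)) :
    number (l.map f) = (number l).map fun p => (f p.1, p.2) := by
  simp [number, List.zipIdx_map, Prod.map_def]

theorem Rule.annotate_rename (r : Rule L κ ν) (ρ : Equiv.Perm ℕ) :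
    r.annotate.rename ρ = (r.rename ρ).annotate := by
  simp [Rule.annotate, ARule.rename, Rule.rename, number_map]

theorem map_fst_number (l : List (Atom L κ)) : (number l).map Prod.fst = l := by
  simp [number, List.zipIdx_map_fst]

theorem mem_number {l : List (Atom L κ)} {p : IdAtom L κ} (h : p ∈ number l) :
    1 ≤ p.2 ∧ p.2 ≤ l.length := by
  have := List.mem_zipIdx (x := p.1) (i := p.2) (k := 1) (xs := l) (by simpa [number] using h)
  omega

theorem nodup_number (l : List (Atom L κ)) : ((number l).map Prod.snd).Nodup := by
  simp [number, List.zipIdx_map_snd, List.nodup_range']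

theorem chrVars_number (l : List (Atom L κ)) : chrVars (number l) = {x | ∃ a ∈ l, x ∈ a.vars} := by
  ext x
  simp only [chrVars, Set.mem_ofPred_eq]
  have := map_fst_number l
  constructor
  · rintro ⟨p, hp, hx⟩
    refine ⟨p.1, ?_, hx⟩
    rw [← Multiset.mem_coe, ← this]
    exact Multiset.mem_map_of_mem _ hp
  · rintro ⟨a, ha, hx⟩
    rw [← Multiset.mem_coe, ← this] at ha
    obtain ⟨p, hp, rfl⟩ := Multiset.mem_map.1 ha
    exact ⟨p, hp, hx⟩

theorem Rule.vars_annotate (r : Rule L κ ν) : r.annotate.vars = r.vars := by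
  rw [ARule.vars_eq]
  simp only [Rule.annotate, chrVars_number]
  rw [Set.union_assoc]
  rfl

theorem maxId_number_le (l : List (Atom L κ)) :
    maxId (number l) (∅ : Finset (Token ν)) ≤ l.length := by
  refine max_le (Multiset.sup_le.2 fun i hi => ?_) (by simp)
  obtain ⟨p, hp, rfl⟩ := Multiset.mem_map.1 hi
  exact (mem_number hp).2

theorem Ann_good {P : Set (Rule L κ ν)} (hP : IsProgram P) : ∀ r ∈ Ann P, r.Good := by
  rintro _ ⟨r, hr, rfl⟩
  exact ⟨hP.heads r hr, fun p hp => (mem_number hp).1, by simp [Rule.annotate]⟩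

/-! ### Representation of goals and states -/

/-- `σ` is represented by `Y` if its goal is introduced with new identifiers and its built-in
constraints are solved. -/
def Represents (CT : L.Theory) (V : Set ℕ) (σ : State L κ ν) (Y : Conf L κ ν) : Prop :=
  ∃ D : Multiset (IdAtom L κ), D.map Prod.fst = σ.goalChr ∧ (D.map Prod.snd).Nodup ∧
    (∀ p ∈ D, σ.counter ≤ p.2) ∧ (∀ p ∈ σ.chr, p.2 < σ.counter) ∧
    (∀ t ∈ σ.tokens, ∀ i ∈ t.2, i < σ.counter) ∧
    Sim CT V ⟨σ.chr + D, σ.goalBi + σ.store, σ.tokens⟩ Y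

/-- The configuration in which the goal is introduced and solved. -/
def Goal.conf (G : Goal L κ) : Conf L κ ν := ⟨number G.chr, G.bi, ∅⟩

theorem Goal.represents (G : Goal L κ) : Represents CT V (G.start : State L κ ν) G.conf := by
  refine ⟨number G.chr, map_fst_number _, nodup_number _, fun p hp => (mem_number hp).1, ?_, ?_, ?_⟩
  · simp [Goal.start]
  · simp [Goal.start]
  · simpa [Goal.start, Goal.conf] using Sim.refl _

theorem Goal.conf_bounded (G : Goal L κ) : (G.conf : Conf L κ ν).Bounded G.chr.length :=
  ⟨fun _ hp => (mem_number hp).2, by simp [Goal.conf]⟩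

/-- `σ` is represented by `Y` if its built-in constraints are solved. -/
def ARepresents (CT : L.Theory) (V : Set ℕ) (σ : AState L κ ν) (Y : Conf L κ ν) : Prop :=
  Conf.Bounded ⟨σ.chr, σ.bi + σ.store, σ.tokens⟩ σ.counter ∧
    Sim CT V ⟨σ.chr, σ.bi + σ.store, σ.tokens⟩ Y

theorem Goal.arepresents (G : Goal L κ) : ARepresents CT V (G.astart : AState L κ ν) G.conf := by
  refine ⟨⟨(G.conf_bounded (ν := ν)).chr, by simp [Goal.astart]⟩, ?_⟩
  simpa [Goal.astart, Goal.conf] using Sim.refl _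

/-! ### Derivations of programs without annotations -/

variable [DecidableEq ν]

theorem solve_all (P : Set (Rule L κ ν)) (A : Multiset (Atom L κ)) (B : Con L)
    (S : Multiset (IdAtom L κ)) (C : Con L) (T : Finset (Token ν)) (n : ℕ) :
    Relation.ReflTransGen (NormalStep CT P V) ⟨A, B, S, C, T, n⟩ ⟨A, 0, S, B + C, T, n⟩ := by
  induction B using Multiset.induction generalizing C with
  | empty => simpa using Relation.ReflTransGen.refl
  | cons c B ih =>
    refine .head (Or.inl (Solve.intro c A B S C (c ::ₘ C) T n (Equivalent.refl _))) ?_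
    have := ih (c ::ₘ C)
    rwa [Multiset.add_cons, ← Multiset.cons_add] at this

theorem introduce_all (P : Set (Rule L κ ν)) (l : List (Atom L κ)) (B : Con L)
    (S : Multiset (IdAtom L κ)) (C : Con L) (T : Finset (Token ν)) (n : ℕ) :
    Relation.ReflTransGen (NormalStep CT P V) ⟨l, B, S, C, T, n⟩
      ⟨0, B, (l.zipIdx n : List (IdAtom L κ)) + S, C, T, n + l.length⟩ := by
  induction l generalizing S n with
  | nil => simpa using Relation.ReflTransGen.refl
  | cons h l ih =>
    refine .head (Or.inr (Or.inl (Introduce.intro h l B S C T n))) ?_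
    have := ih ((h, n) ::ₘ S) (n + 1)
    rw [Multiset.add_cons, ← Multiset.cons_add, Multiset.cons_coe] at this
    rw [List.zipIdx_cons, List.length_cons, add_comm l.length 1, ← add_assoc]
    exact this

/-- In a plain program the counter is the next identifier to be used, and numbering starts at `1`;
hence the shift by `n - 1`. -/
theorem shift_number (l : List (Atom L κ)) {n : ℕ} (hn : 1 ≤ n) :
    shift (n - 1) (number l) = (l.zipIdx n : List (IdAtom L κ)) := by
  have : n = 1 + (n - 1) := by omega
  conv_rhs => rw [this, List.zipIdx_eq_map_add]
  conv_lhs => rw [shift, number, Multiset.map_coe, List.zipIdx_eq_map_add]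
  rw [List.map_map]
  congr 1
  refine List.map_congr_left fun p _ => Prod.ext rfl ?_
  simp only [Function.comp]
  omega

theorem Enabled.apply {P : Set (Rule L κ ν)} {r : Rule L κ ν} (hr : r ∈ P) {ρ : Equiv.Perm ℕ}
    {H₁ H₂ : List (IdAtom L κ)} {R S : Multiset (IdAtom L κ)} {C : Con L} {T : Finset (Token ν)}
    (h : Enabled CT (r.annotate.rename ρ) V H₁ H₂ R ⟨S, C, T⟩) (n : ℕ) :
    Apply CT P V ⟨0, 0, S, C, T, n⟩
      ⟨((r.rename ρ).body.chr : Multiset (Atom L κ)) + 0, (r.rename ρ).body.bi + 0,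
        (H₁ : Multiset (IdAtom L κ)) + R,
        eqs ((H₁ ++ H₂).map Prod.fst) ((r.rename ρ).kept ++ (r.rename ρ).removed) + C,
        if H₂ = [] then insert ((r.rename ρ).name, H₁.map Prod.snd) T else T, n⟩ := by
  obtain rfl : S = _ := h.chr_eq
  rw [Rule.annotate_rename] at h
  refine Apply.intro r (r.rename ρ) ρ 0 0 H₁ H₂ R C T n hr rfl ?_ ?_ h.match₁ h.match₂ h.guard
    h.token
  · rw [← Rule.vars_annotate]
    exact h.fresh_start
  · rw [← Rule.vars_annotate]
    refine h.fresh_state.mono_right ?_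
    rintro x (((⟨a, ha, -⟩ | ⟨c, hc, -⟩) | hx) | hx)
    · simp at ha
    · simp at hc
    · exact Or.inl hx
    · exact Or.inr hx

/-- One `Apply`, then solving, then introducing. The goal is empty before and after, so `Apply` is
used only where a normal derivation allows it. -/
theorem Enabled.normal {P : Set (Rule L κ ν)} {r : Rule L κ ν} (hr : r ∈ P) {ρ : Equiv.Perm ℕ}
    {H₁ H₂ : List (IdAtom L κ)} {R S : Multiset (IdAtom L κ)} {C : Con L} {T : Finset (Token ν)}
    (h : Enabled CT (r.annotate.rename ρ) V H₁ H₂ R ⟨S, C, T⟩) {n : ℕ} (hn : 1 ≤ n)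
    {Y : Conf L κ ν} (hY : Y = (r.annotate.rename ρ).result (n - 1) H₁ H₂ R ⟨S, C, T⟩) :
    Relation.TransGen (NormalStep CT P V) ⟨0, 0, S, C, T, n⟩
      ⟨0, 0, Y.chr, Y.con, Y.tokens, n + r.body.chr.length⟩ := by
  refine Relation.TransGen.head' (Or.inr (Or.inr ⟨Or.inr rfl, h.apply hr n⟩)) ?_
  rw [add_zero, add_zero]
  refine (solve_all P _ _ _ _ _ _).trans ?_
  have := introduce_all (CT := CT) (V := V) P (r.rename ρ).body.chr 0
    ((H₁ : Multiset (IdAtom L κ)) + R)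
    ((r.rename ρ).body.bi + (eqs ((H₁ ++ H₂).map Prod.fst)
      ((r.rename ρ).kept ++ (r.rename ρ).removed) + C))
    (if H₂ = [] then insert ((r.rename ρ).name, H₁.map Prod.snd) T else T) n
  rw [← shift_number _ hn] at this
  subst hY
  rw [Rule.annotate_rename]
  simp only [ARule.result, Rule.annotate, add_assoc]
  simpa [shiftTokens, Rule.rename] using this

theorem Sim.fire_step {Q : Set (ARule L κ ν)} (hQ : ∀ r ∈ Q, r.Good) (hV : V.Finite)
    {X X' Y : Conf L κ ν} (hXY : Sim CT V X Y) (h : Fire CT Q V X X') :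
    ∃ Y', Fire CT Q V Y Y' ∧ Sim CT V X' Y' := by
  obtain ⟨m, hm⟩ := Y.exists_bounded
  obtain ⟨r₀, hr₀, ρ, H₁, H₂, S, hen, hsim⟩ := hXY.fire hQ hV h hm
  exact ⟨_, ⟨r₀, hr₀, ρ, m, H₁, H₂, S, hm, hen, rfl⟩, hsim⟩

/-- `Solve` and `Introduce` do not change what is represented. `Apply` carries over because the
constraints introduced early are mere context and the stronger store still entails the guard. -/
theorem Represents.step {P : Set (Rule L κ ν)} (hP : IsProgram P) (hV : V.Finite)
    {σ τ : State L κ ν} {Y : Conf L κ ν} (hσ : Represents CT V σ Y) (h : Step CT P V σ τ) :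
    ∃ Y', Relation.ReflTransGen (Fire CT (Ann P) V) Y Y' ∧ Represents CT V τ Y' := by
  obtain ⟨D, hD, hnodup, hge, hchr, htok, hsim⟩ := hσ
  rcases h with h | h | h
  · obtain ⟨c, A, B, S, C, C', T, n, h⟩ := h
    refine ⟨Y, .refl, D, hD, hnodup, hge, hchr, htok, Sim.trans (Sim.of_equivalent ?_) hsim⟩
    have := (Equivalent.refl (CT := CT) B).add h.symm
    rwa [Multiset.add_cons, ← Multiset.cons_add] at this
  · obtain ⟨h, A, B, S, C, T, n⟩ := h
    have hmem : h ∈ D.map Prod.fst := by rw [hD]; exact Multiset.mem_cons_self _ _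
    obtain ⟨⟨h, j⟩, hj, rfl⟩ := Multiset.mem_map.1 hmem
    obtain ⟨D, rfl⟩ := Multiset.exists_cons_of_mem hj
    simp only [Multiset.map_cons, Multiset.nodup_cons, Multiset.mem_cons, Multiset.cons_inj_right,
      forall_eq_or_imp] at hD hnodup hge hchr htok
    -- The constraint receives the identifier `n`, but the representation had given it some `j ≥ n`.
    -- Exchanging the two leaves the identifiers of the store and of the tokens alone, since these
    -- are smaller than `n`.
    have hswap : ∀ p ∈ D, n < Equiv.swap n j p.2 := by
      intro p hp
      have h1 := hge.2 p hp
      have h2 : p.2 ≠ j := fun h => hnodup.1 (h ▸ Multiset.mem_map_of_mem _ hp)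
      rcases eq_or_ne p.2 n with h3 | h3
      · rw [h3, Equiv.swap_apply_left]
        have := hge.1
        omega
      · rw [Equiv.swap_apply_of_ne_of_ne h3 h2]
        omega
    have hid : ∀ i, i < n → Equiv.swap n j i = i := fun i hi =>
      Equiv.swap_apply_of_ne_of_ne (by omega) (by have := hge.1; omega)
    refine ⟨Y, .refl, D.map (renameId 1 (Equiv.swap n j)), ?_, ?_, ?_, ?_, ?_, ?_⟩
    · simpa [renameId, Function.comp_def] using hD
    · have := hnodup.2.map (Equiv.swap n j).injective
      simpa [renameId, Function.comp_def] using this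
    · intro p hp
      obtain ⟨q, hq, rfl⟩ := Multiset.mem_map.1 hp
      exact hswap q hq
    · intro p hp
      rcases Multiset.mem_cons.1 hp with rfl | hp
      · exact Nat.lt_succ_self _
      · exact (hchr p hp).trans (Nat.lt_succ_self _)
    · exact fun t ht i hi => (htok t ht i hi).trans (Nat.lt_succ_self _)
    · refine Sim.trans (Sim.symm ⟨1, Equiv.swap n j, fun _ _ => rfl, ?_, ?_, ?_⟩) hsim
      · have hS : S.map (renameId 1 (Equiv.swap n j)) = S := by
          conv_rhs => rw [← Multiset.map_id S]
          exact Multiset.map_congr rfl fun p hp => by simp [renameId, hid _ (hchr p hp)]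
        rw [Multiset.map_add, Multiset.map_cons, hS]
        simp [renameId]
      · simpa using Equivalent.refl _
      · intro a l hl
        constructor
        · intro ht
          rw [List.map_congr_left fun i hi => hid i (htok _ ht i hi)]
          simpa using ht
        · intro ht
          have : ∀ i ∈ l, i < n := by
            intro i hi
            have h1 := htok _ ht _ (List.mem_map_of_mem hi)
            have h2 := hid _ h1
            rw [Equiv.swap_apply_self] at h2
            omega
          rw [List.map_congr_left fun i hi => hid i (this i hi)] at ht
          simpa using ht
  · obtain ⟨r₀, r, ρ, A, B, H₁, H₂, S, C, T, n, hr₀, rfl, fresh_start, fresh_state, match₁, match₂,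
      guard, token⟩ := h
    simp only at hD hge hchr htok hsim
    have hen : Enabled CT (r₀.annotate.rename ρ) V H₁ H₂ (S + D)
        ⟨(H₁ : Multiset (IdAtom L κ)) + H₂ + S + D, B + C, T⟩ := by
      rw [Rule.annotate_rename]
      refine ⟨add_assoc _ _ _, by rwa [Rule.vars_annotate], ?_, match₁, match₂,
        guard.mono (fun M e h => (Con.holds_add.1 h).2) fun _ _ h => h, token⟩
      rw [Rule.vars_annotate]
      refine fresh_state.mono_right ?_
      rintro x (⟨p, hp, hx⟩ | hx)
      · rcases Multiset.mem_add.1 hp with hp | hp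
        · exact Or.inl (Or.inr ⟨p, hp, hx⟩)
        · refine Or.inl (Or.inl (Or.inl ⟨p.1, ?_, hx⟩))
          rw [← hD]
          exact Multiset.mem_map_of_mem _ hp
      · rw [Con.vars_add] at hx
        rcases hx with hx | hx
        · exact Or.inl (Or.inl (Or.inr hx))
        · exact Or.inr hx
    obtain ⟨k, hk⟩ := Conf.exists_bounded
      (⟨(H₁ : Multiset (IdAtom L κ)) + H₂ + S + D, B + C, T⟩ : Conf L κ ν)
    -- Body identifiers shifted by `k + n` avoid everything in use and also lie above the counter
    -- `n`, as `Represents` requires of constraints not yet introduced.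
    have hk' := hk.mono (Nat.le_add_right k n)
    obtain ⟨Y', hY', hsim'⟩ := hsim.fire_step (Ann_good hP) hV
      ⟨r₀.annotate, ⟨r₀, hr₀, rfl⟩, ρ, k + n, H₁, H₂, S + D, hk', hen, rfl⟩
    refine ⟨Y', .single hY', shift (k + n) (number (r₀.rename ρ).body.chr) + D, ?_, ?_, ?_, ?_, ?_,
      Sim.trans ?_ hsim'⟩
    · rw [Multiset.map_add, hD, shift, Multiset.map_map]
      exact congrArg (· + A) (map_fst_number _)
    · rw [Multiset.map_add, Multiset.nodup_add]
      refine ⟨?_, hnodup, ?_⟩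
      · have := (nodup_number (r₀.rename ρ).body.chr).map (add_left_injective (k + n))
        simpa [shift, Function.comp_def] using this
      · rw [Multiset.disjoint_left]
        intro i hi hi'
        obtain ⟨p, hp, rfl⟩ := Multiset.mem_map.1 hi
        obtain ⟨q, hq, hqp⟩ := Multiset.mem_map.1 hi'
        obtain ⟨p', hp', rfl⟩ := Multiset.mem_map.1 hp
        have h1 := (mem_number hp').1
        have h2 := hk.chr q (Multiset.mem_add.2 (Or.inr hq))
        simp only at hqp
        omega
    · intro p hp
      rcases Multiset.mem_add.1 hp with hp | hp
      · obtain ⟨p, hp, rfl⟩ := Multiset.mem_map.1 hp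
        simp only
        omega
      · exact hge p hp
    · intro p hp
      refine hchr p ?_
      rcases Multiset.mem_add.1 hp with hp | hp
      · exact Multiset.mem_add.2 (Or.inl (Multiset.mem_add.2 (Or.inl hp)))
      · exact Multiset.mem_add.2 (Or.inr hp)
    · intro t ht i hi
      simp only at ht
      split_ifs at ht with h
      · rcases Finset.mem_insert.1 ht with rfl | ht
        · obtain ⟨p, hp, rfl⟩ := List.mem_map.1 hi
          exact hchr p (Multiset.mem_add.2 (Or.inl (Multiset.mem_add.2 (Or.inl hp))))
        · exact htok t ht i hi
      · exact htok t ht i hi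
    · rw [Rule.annotate_rename]
      refine ⟨1, 1, fun _ _ => rfl, ?_, ?_, ?_⟩
      · simp only [ARule.result, Rule.annotate, renameId_one_one, Multiset.map_id']
        abel
      · simp only [ARule.result, Rule.annotate, Con.rename_one]
        rw [show ((r₀.rename ρ).body.bi + B + (eqs ((H₁ ++ H₂).map Prod.fst)
            ((r₀.rename ρ).kept ++ (r₀.rename ρ).removed) + C)) =
          (r₀.rename ρ).body.bi + (eqs ((H₁ ++ H₂).map Prod.fst)
            ((r₀.rename ρ).kept ++ (r₀.rename ρ).removed) + (B + C)) by abel]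
        exact Equivalent.refl _
      · intro a l _
        simp [ARule.result, Rule.annotate, shiftTokens]

theorem Represents.steps {P : Set (Rule L κ ν)} (hP : IsProgram P) (hV : V.Finite)
    {σ τ : State L κ ν} {Y : Conf L κ ν} (hσ : Represents CT V σ Y)
    (h : Relation.ReflTransGen (Step CT P V) σ τ) :
    ∃ Y', Relation.ReflTransGen (Fire CT (Ann P) V) Y Y' ∧ Represents CT V τ Y' := by
  induction h with
  | refl => exact ⟨Y, .refl, hσ⟩
  | tail _ h ih =>
    obtain ⟨Y', h1, h2⟩ := ih
    obtain ⟨Y'', h3, h4⟩ := h2.step hP hV h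
    exact ⟨Y'', h1.trans h3, h4⟩

/-! ### Derivations of annotated programs -/

theorem asolve_all (Q : Set (ARule L κ ν)) (B : Con L)
    (S : Multiset (IdAtom L κ)) (C : Con L) (T : Finset (Token ν)) (n : ℕ) :
    Relation.ReflTransGen (AStep CT Q V) ⟨S, B, C, T, n⟩ ⟨S, 0, B + C, T, n⟩ := by
  induction B using Multiset.induction generalizing C with
  | empty => simpa using Relation.ReflTransGen.refl
  | cons c B ih =>
    refine .head (Or.inl (ASolve.intro c S B C (c ::ₘ C) T n (Equivalent.refl _))) ?_
    have := ih (c ::ₘ C)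
    rwa [Multiset.add_cons, ← Multiset.cons_add] at this

theorem Enabled.aapply {Q : Set (ARule L κ ν)} {r : ARule L κ ν} (hr : r ∈ Q) {ρ : Equiv.Perm ℕ}
    {H₁ H₂ : List (IdAtom L κ)} {R S : Multiset (IdAtom L κ)} {C : Con L} {T : Finset (Token ν)}
    (h : Enabled CT (r.rename ρ) V H₁ H₂ R ⟨S, C, T⟩) (n : ℕ) :
    AApply CT Q V ⟨S, 0, C, T, n⟩
      ⟨shift n (r.rename ρ).chr + (H₁ : Multiset (IdAtom L κ)) + R, (r.rename ρ).bi + 0,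
        eqs ((H₁ ++ H₂).map Prod.fst) ((r.rename ρ).kept ++ (r.rename ρ).removed) + C,
        (if H₂ = [] then insert ((r.rename ρ).name, H₁.map Prod.snd) T else T) ∪
          shiftTokens n (r.rename ρ).tokens,
        n + maxId (r.rename ρ).chr (r.rename ρ).tokens⟩ := by
  obtain rfl : S = _ := h.chr_eq
  refine AApply.intro r (r.rename ρ) ρ 0 H₁ H₂ R C T n hr rfl h.fresh_start ?_ h.match₁ h.match₂
    h.guard h.token
  refine h.fresh_state.mono_right ?_
  rintro x ((hx | ⟨c, hc, -⟩) | hx)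
  · exact Or.inl hx
  · simp at hc
  · exact Or.inr hx

theorem Enabled.asteps {Q : Set (ARule L κ ν)} {r : ARule L κ ν} (hr : r ∈ Q) {ρ : Equiv.Perm ℕ}
    {H₁ H₂ : List (IdAtom L κ)} {R S : Multiset (IdAtom L κ)} {C : Con L} {T : Finset (Token ν)}
    (h : Enabled CT (r.rename ρ) V H₁ H₂ R ⟨S, C, T⟩) {n : ℕ}
    {Y : Conf L κ ν} (hY : Y = (r.rename ρ).result n H₁ H₂ R ⟨S, C, T⟩) :
    Relation.ReflTransGen (AStep CT Q V) ⟨S, 0, C, T, n⟩ ⟨Y.chr, 0, Y.con, Y.tokens,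
      n + maxId (r.rename ρ).chr (r.rename ρ).tokens⟩ := by
  refine .head (Or.inr (h.aapply hr n)) ?_
  subst hY
  rw [add_zero]
  exact asolve_all Q _ _ _ _ _

/-- Bodies are introduced at once here, so only built-in constraints lag behind. The counter bounds
all identifiers and serves directly as the shift of the `Fire` step. -/
theorem ARepresents.step {Q : Set (ARule L κ ν)} (hQ : ∀ r ∈ Q, r.Good) (hV : V.Finite)
    {σ τ : AState L κ ν} {Y : Conf L κ ν} (hσ : ARepresents CT V σ Y) (h : AStep CT Q V σ τ) :
    ∃ Y', Relation.ReflTransGen (Fire CT Q V) Y Y' ∧ ARepresents CT V τ Y' := by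
  obtain ⟨hb, hsim⟩ := hσ
  rcases h with h | h
  · obtain ⟨c, S, B, C, C', T, n, h⟩ := h
    refine ⟨Y, .refl, ⟨hb.1, hb.2⟩, Sim.trans (Sim.of_equivalent ?_) hsim⟩
    have := (Equivalent.refl (CT := CT) B).add h.symm
    rwa [Multiset.add_cons, ← Multiset.cons_add] at this
  · obtain ⟨r₀, r, ρ, B, H₁, H₂, S, C, T, n, hr₀, rfl, fresh_start, fresh_state, match₁, match₂,
      guard, token⟩ := h
    simp only at hb hsim
    have hen : Enabled CT (r₀.rename ρ) V H₁ H₂ S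
        ⟨(H₁ : Multiset (IdAtom L κ)) + H₂ + S, B + C, T⟩ := by
      refine ⟨rfl, fresh_start, ?_, match₁, match₂,
        guard.mono (fun M e h => (Con.holds_add.1 h).2) fun _ _ h => h, token⟩
      refine fresh_state.mono_right ?_
      rintro x (hx | hx)
      · exact Or.inl (Or.inl hx)
      · rw [Con.vars_add] at hx
        rcases hx with hx | hx
        · exact Or.inl (Or.inr hx)
        · exact Or.inr hx
    obtain ⟨Y', hY', hsim'⟩ := hsim.fire_step hQ hV
      ⟨r₀, hr₀, ρ, n, H₁, H₂, S, hb, hen, rfl⟩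
    have hb' := hen.result_bounded hb
    refine ⟨Y', .single hY', ⟨hb'.1, hb'.2⟩, Sim.trans (Sim.of_equivalent ?_) hsim'⟩
    rw [show (r₀.rename ρ).bi + B + (eqs ((H₁ ++ H₂).map Prod.fst)
        ((r₀.rename ρ).kept ++ (r₀.rename ρ).removed) + C) =
      (r₀.rename ρ).bi + (eqs ((H₁ ++ H₂).map Prod.fst)
        ((r₀.rename ρ).kept ++ (r₀.rename ρ).removed) + (B + C)) by abel]
    exact Equivalent.refl _

theorem ARepresents.steps {Q : Set (ARule L κ ν)} (hQ : ∀ r ∈ Q, r.Good) (hV : V.Finite)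
    {σ τ : AState L κ ν} {Y : Conf L κ ν} (hσ : ARepresents CT V σ Y)
    (h : Relation.ReflTransGen (AStep CT Q V) σ τ) :
    ∃ Y', Relation.ReflTransGen (Fire CT Q V) Y Y' ∧ ARepresents CT V τ Y' := by
  induction h with
  | refl => exact ⟨Y, .refl, hσ⟩
  | tail _ h ih =>
    obtain ⟨Y', h1, h2⟩ := ih
    obtain ⟨Y'', h3, h4⟩ := h2.step hQ hV h
    exact ⟨Y'', h1.trans h3, h4⟩

end Concrete

/-! ### Answers, outcomes and the comparison of programs -/

section Answers

variable {L : FirstOrder.Language.{u, v}} {κ : Type w} {ν : Type z} {CT : L.Theory} {V : Set ℕ}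
  {E : Reading}

/-! ### Sameness of answers -/

theorem Same.symm {τ : Type*} {A A' : Multiset (Atom L κ × τ)} {D D' : Con L}
    (h : Same CT V E A D A' D') : Same CT V E A' D' A D := by
  rcases E with _ | _
  · obtain ⟨ρ, hV, hA, hD⟩ := h
    refine ⟨ρ⁻¹, fun x hx => Equiv.Perm.inv_eq_iff_eq.2 (hV x hx).symm, ?_, ?_⟩
    · rw [← hA, Multiset.map_map]
      simp [Atom.rename_rename]
    · have := hD.symm.rename ρ⁻¹
      simpa [Con.rename_rename] using this
  · exact fun M e => (h M e).symm

theorem Same.trans {τ : Type*} {A A' A'' : Multiset (Atom L κ × τ)} {D D' D'' : Con L}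
    (h : Same CT V E A D A' D') (h' : Same CT V E A' D' A'' D'') : Same CT V E A D A'' D'' := by
  rcases E with _ | _
  · obtain ⟨ρ, hV, hA, hD⟩ := h
    obtain ⟨σ, hV', hA', hD'⟩ := h'
    refine ⟨σ * ρ, fun x hx => by simp [hV x hx, hV' x hx], ?_, ?_⟩
    · rw [← hA', ← hA, Multiset.map_map]
      simp [Atom.rename_rename]
    · rw [← Con.rename_rename]
      exact (hD.rename σ).trans hD'
  · exact fun M e => (h M e).trans (h' M e)

theorem Same.inconsistent {τ : Type*} {A A' : Multiset (Atom L κ × τ)} {D D' : Con L}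
    (h : Same CT V E A D A' D') (hD : Inconsistent CT D) : Inconsistent CT D' := by
  rcases E with _ | _
  · obtain ⟨ρ, hV, hA, hE⟩ := h
    exact (hD.rename ρ).of_entails hE.2
  · intro M e he
    -- A solution of `D'` contributes a value, which must also come from a solution of `D`.
    have := (h M e).symm.subset ⟨e, fun _ _ => rfl, he, rfl⟩
    obtain ⟨e', -, he', -⟩ := this
    exact hD M e' he'

/-- Composing valuations with the inverse renaming carries the solutions of one side to those of the
other. So `Sim`, which is stated with renamings, serves both readings. -/
theorem Same.of_renaming {τ : Type*} {A A' : Multiset (Atom L κ × τ)} {D D' : Con L}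
    (h : Same CT V .renaming A D A' D') : Same CT V E A D A' D' := by
  have key : ∀ {A A' : Multiset (Atom L κ × τ)} {D D' : Con L},
      Same CT V .renaming A D A' D' → ∀ (M : Theory.ModelType.{u, v, max u v} CT) (e : ℕ → M) m,
      (∃ e' : ℕ → M, (∀ x ∈ V, e' x = e x) ∧ D.Holds e' ∧
        A.map (fun p => (p.1.eval e', p.2)) = m) →
      (∃ e' : ℕ → M, (∀ x ∈ V, e' x = e x) ∧ D'.Holds e' ∧
        A'.map (fun p => (p.1.eval e', p.2)) = m) := by
    rintro A A' D D' ⟨ρ, hV, hA, hD⟩ M e m ⟨e', h1, h2, h3⟩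
    have hinv : (e' ∘ ⇑ρ⁻¹) ∘ ρ = e' := by
      funext x
      simp
    refine ⟨e' ∘ ⇑ρ⁻¹, fun x hx => ?_, hD.1 M _ ?_, ?_⟩
    · rw [← h1 x hx, Function.comp, Equiv.Perm.inv_eq_iff_eq.2 (hV x hx).symm]
    · rwa [Con.holds_rename, hinv]
    · rw [← hA, Multiset.map_map, ← h3]
      refine Multiset.map_congr rfl fun p _ => ?_
      rw [Function.comp, Atom.eval_rename, hinv]
  rcases E with _ | _
  · exact h
  · intro M e
    ext m
    exact ⟨key h M e m, key h.symm M e m⟩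

/-- Lets identifiers be forgotten when passing from configurations to answers. -/
theorem Same.map_tag {τ τ' : Type*} (f : τ → τ') {A A' : Multiset (Atom L κ × τ)} {D D' : Con L}
    (h : Same CT V E A D A' D') : Same CT V E (A.map fun p => (p.1, f p.2)) D
      (A'.map fun p => (p.1, f p.2)) D' := by
  rcases E with _ | _
  · obtain ⟨ρ, hV, hA, hD⟩ := h
    refine ⟨ρ, hV, ?_, hD⟩
    rw [← hA]
    simp
  · have key : ∀ {A A' : Multiset (Atom L κ × τ)} {D D' : Con L},
        Same CT V .logical A D A' D' → ∀ (M : Theory.ModelType.{u, v, max u v} CT) (e : ℕ → M) m,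
        (∃ e' : ℕ → M, (∀ x ∈ V, e' x = e x) ∧ D.Holds e' ∧
          (A.map fun p => (p.1, f p.2)).map (fun p => (p.1.eval e', p.2)) = m) →
        (∃ e' : ℕ → M, (∀ x ∈ V, e' x = e x) ∧ D'.Holds e' ∧
          (A'.map fun p => (p.1, f p.2)).map (fun p => (p.1.eval e', p.2)) = m) := by
      rintro A A' D D' h M e m ⟨e', h1, h2, h3⟩
      obtain ⟨e'', h1', h2', h3'⟩ := (h M e).subset ⟨e', h1, h2, rfl⟩
      refine ⟨e'', h1', h2', ?_⟩
      rw [← h3]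
      have := congrArg (Multiset.map fun p : (κ × List M) × τ => (p.1, f p.2)) h3'
      simpa [Function.comp_def] using this
    intro M e
    ext m
    exact ⟨key h M e m, key (Same.symm h) M e m⟩

theorem AnswerEquiv.symm {a b : Answer L κ} (h : AnswerEquiv CT E V a b) :
    AnswerEquiv CT E V b a := h.imp And.symm Same.symm

/-- In the mixed cases sameness transports inconsistency. -/
theorem AnswerEquiv.trans {a b c : Answer L κ} (h : AnswerEquiv CT E V a b)
    (h' : AnswerEquiv CT E V b c) : AnswerEquiv CT E V a c := by
  rcases h with h | h <;> rcases h' with h' | h'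
  · exact Or.inl ⟨h.1, h'.2⟩
  · exact Or.inl ⟨h.1, h'.inconsistent h.2⟩
  · exact Or.inl ⟨h.symm.inconsistent h'.1, h'.2⟩
  · exact Or.inr (h.trans h')

/-- The answer given by a final configuration. -/
def Conf.answer (X : Conf L κ ν) : Answer L κ := ⟨X.chr.map Prod.fst, X.con⟩

theorem Sim.answerEquiv {X Y : Conf L κ ν} (h : Sim CT V X Y) :
    AnswerEquiv CT E V X.answer Y.answer := by
  obtain ⟨ρ, π, hV, h⟩ := h
  refine Or.inr (Same.of_renaming ⟨ρ, hV, ?_, h.con⟩)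
  simp only [Conf.answer, ← h.chr, Multiset.map_map]
  rfl

theorem inconsistent_fail : Inconsistent CT (Answer.fail : Answer L κ).bi := by
  intro M e he
  exact he ⊥ (by simp [Answer.fail])

/-- The state with the given constraints and an empty goal. -/
def Conf.state (X : Conf L κ ν) (n : ℕ) : State L κ ν := ⟨0, 0, X.chr, X.con, X.tokens, n⟩

def Conf.astate (X : Conf L κ ν) (n : ℕ) : AState L κ ν := ⟨X.chr, 0, X.con, X.tokens, n⟩

theorem Goal.vars_start (G : Goal L κ) : (G.start : State L κ ν).vars = G.vars := by
  ext x
  simp [State.vars, Goal.start, Goal.vars, Con.vars]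

theorem Goal.finite_vars (G : Goal L κ) : G.vars.Finite :=
  (finite_listVars G.chr).union (Con.finite_vars G.bi)

theorem Goal.wellFormed_start (G : Goal L κ) : (G.start : State L κ ν).WellFormed :=
  ⟨by simp [Goal.start], by simp [Goal.start], by simp [Goal.start]⟩

theorem Conf.same_of_tagged {X Y : Conf L κ ν} {m n : ℕ} {π : Equiv.Perm ℕ}
    (h : Same CT V E ((X.state m).tagged π) ((X.state m).goalBi + (X.state m).store)
      ((Y.state n).tagged 1) ((Y.state n).goalBi + (Y.state n).store)) :
    AnswerEquiv CT E V X.answer Y.answer := by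
  have := h.map_tag fun _ => ()
  simp only [State.tagged, Conf.state, Multiset.map_zero, zero_add, Multiset.map_map] at this
  refine Or.inr ?_
  simp only [Conf.answer, Multiset.map_map]
  exact this

/-! ### Outcomes -/

variable [DecidableEq ν]

/-- No transition weakens the built-in store. -/
theorem Step.failed {P : Set (Rule L κ ν)} {σ τ : State L κ ν} (h : Step CT P V σ τ)
    (hσ : σ.Failed CT) : τ.Failed CT := by
  rcases h with ⟨c, A, B, S, C, C', T, n, h⟩ | ⟨h, A, B, S, C, T, n⟩ | h
  · exact hσ.of_entails fun M e he => (Con.holds_cons.1 (h.2 M e he)).2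
  · exact hσ
  · obtain ⟨r₀, r, ρ, A, B, H₁, H₂, S, C, T, n, hr₀, hr, h1, h2, h3, h4, h5, h6⟩ := h
    exact hσ.of_entails fun M e he => (Con.holds_add.1 he).2

theorem NormalStep.step {P : Set (Rule L κ ν)} {σ τ : State L κ ν} (h : NormalStep CT P V σ τ) :
    Step CT P V σ τ := h.imp_right (Or.imp_right And.right)

theorem steps_failed {P : Set (Rule L κ ν)} {σ τ : State L κ ν}
    (h : Relation.ReflTransGen (Step CT P V) σ τ) (hσ : σ.Failed CT) : τ.Failed CT := by
  induction h with
  | refl => exact hσ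
  | tail _ h ih => exact h.failed ih

/-- A configuration in which derivations may end. -/
def Ends (CT : L.Theory) (Q : Set (ARule L κ ν)) (V : Set ℕ) (X : Conf L κ ν) : Prop :=
  Inconsistent CT X.con ∨ ∀ Y, ¬ Fire CT Q V X Y

/-- A configuration in which a derivation from `G` may end. -/
def Outcome (CT : L.Theory) (Q : Set (ARule L κ ν)) (V : Set ℕ) (G : Goal L κ) (X : Conf L κ ν) :
    Prop :=
  Relation.ReflTransGen (Fire CT Q V) G.conf X ∧ Ends CT Q V X

theorem Sim.ends {Q : Set (ARule L κ ν)} (hQ : ∀ r ∈ Q, r.Good) (hV : V.Finite) {X Y : Conf L κ ν}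
    (h : Sim CT V X Y) (hX : Ends CT Q V X) : Ends CT Q V Y := by
  rcases hX with hX | hX
  · exact Or.inl (h.inconsistent hX)
  · refine Or.inr fun Z hZ => ?_
    obtain ⟨Z', hZ', -⟩ := h.symm.fire_step hQ hV hZ
    exact hX Z' hZ'

/-- The invariant is that identifiers stay below the counter. It survives because the counter
advances by the length of the body, which bounds the identifiers in its numbering. -/
theorem Sim.normal_of_fire {P : Set (Rule L κ ν)} (hP : IsProgram P) (hV : V.Finite)
    {X Y Y' : Conf L κ ν} (h : Sim CT V X Y) (hY : Fire CT (Ann P) V Y Y') {n : ℕ} (hn : 1 ≤ n)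
    (hX : X.Bounded (n - 1)) :
    ∃ X' n', Relation.TransGen (NormalStep CT P V) (X.state n) (X'.state n') ∧ 1 ≤ n' ∧
      X'.Bounded (n' - 1) ∧ Sim CT V X' Y' := by
  obtain ⟨_, ⟨r, hr, rfl⟩, ρ, H₁, H₂, S, hen, hsim⟩ := h.symm.fire (Ann_good hP) hV hY hX
  refine ⟨_, _, hen.normal hr hn rfl, by omega, ?_, hsim.symm⟩
  refine (hen.result_bounded hX).mono ?_
  have : maxId (r.annotate.rename ρ).chr (r.annotate.rename ρ).tokens ≤ r.body.chr.length := by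
    rw [ARule.maxId_rename]
    exact maxId_number_le _
  omega

theorem Sim.normal_of_transGen {P : Set (Rule L κ ν)} (hP : IsProgram P) (hV : V.Finite)
    {X Y Y' : Conf L κ ν} (h : Sim CT V X Y) (hY : Relation.TransGen (Fire CT (Ann P) V) Y Y')
    {n : ℕ} (hn : 1 ≤ n) (hX : X.Bounded (n - 1)) :
    ∃ X' n', Relation.TransGen (NormalStep CT P V) (X.state n) (X'.state n') ∧ 1 ≤ n' ∧
      X'.Bounded (n' - 1) ∧ Sim CT V X' Y' := by
  induction hY with
  | single hY => exact h.normal_of_fire hP hV hY hn hX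
  | tail _ hY ih =>
    obtain ⟨X₁, n₁, h1, h2, h3, h4⟩ := ih
    obtain ⟨X₂, n₂, h5, h6, h7, h8⟩ := h4.normal_of_fire hP hV hY h2 h3
    exact ⟨X₂, n₂, h1.trans h5, h6, h7, h8⟩

theorem Goal.normal_start (P : Set (Rule L κ ν)) (G : Goal L κ) :
    Relation.ReflTransGen (NormalStep CT P V) G.start (G.conf.state (1 + G.chr.length)) := by
  have h1 := introduce_all (CT := CT) (V := V) P G.chr G.bi 0 0 ∅ 1
  have h2 := solve_all (CT := CT) (V := V) P 0 G.bi (number G.chr) 0 ∅ (1 + G.chr.length)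
  rw [add_zero] at h1 h2
  exact h1.trans h2

/-- The outcomes of a program are reached by normal derivations. -/
theorem Outcome.normal {P : Set (Rule L κ ν)} (hP : IsProgram P) (hV : V.Finite) {G : Goal L κ}
    {Y : Conf L κ ν} (h : Outcome CT (Ann P) V G Y) :
    ∃ X n, Relation.ReflTransGen (NormalStep CT P V) G.start (X.state n) ∧ Sim CT V X Y ∧
      (Inconsistent CT X.con ∨ ∀ τ, ¬ Step CT P V (X.state n) τ) := by
  have hb : (G.conf : Conf L κ ν).Bounded (1 + G.chr.length - 1) := by
    simpa using G.conf_bounded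
  have : ∃ X n, Relation.ReflTransGen (NormalStep CT P V) G.start (X.state n) ∧ Sim CT V X Y := by
    rcases Relation.reflTransGen_iff_eq_or_transGen.1 h.1 with h | h
    · exact ⟨_, _, G.normal_start P, h ▸ Sim.refl _⟩
    · obtain ⟨X, n, h1, -, -, h2⟩ := (Sim.refl _).normal_of_transGen hP hV h (by omega) hb
      exact ⟨X, n, (G.normal_start P).trans h1.to_reflTransGen, h2⟩
  obtain ⟨X, n, hX, hsim⟩ := this
  refine ⟨X, n, hX, hsim, (hsim.symm.ends (Ann_good hP) hV h.2).imp_right fun hX τ hτ => ?_⟩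
  -- With an empty goal only `Apply` is possible, and it would give a `Fire` step.
  generalize hσ : X.state n = σ at hτ
  rcases hτ with ⟨c, A, B, S, C, C', T, n, -⟩ | ⟨h, A, B, S, C, T, n⟩ | hτ
  · simp [Conf.state] at hσ
  · simp [Conf.state] at hσ
  · obtain ⟨r₀, r, ρ, A, B, H₁, H₂, S, C, T, n, hr₀, rfl, h1, h2, h3, h4, h5, h6⟩ := hτ
    simp only [Conf.state, State.mk.injEq] at hσ
    obtain ⟨-, -, hS, hC, hT, -⟩ := hσ
    obtain ⟨k, hk⟩ := X.exists_bounded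
    refine hX _ ⟨r₀.annotate, ⟨r₀, hr₀, rfl⟩, ρ, k, H₁, H₂, S, hk, ?_, rfl⟩
    rw [Rule.annotate_rename]
    refine ⟨hS, by rwa [Rule.vars_annotate], ?_, h3, h4, by rw [hC]; exact h5,
      by rw [hT]; exact h6⟩
    rw [Rule.vars_annotate]
    refine h2.mono_right ?_
    rintro x (hx | hx)
    · rw [hS] at hx
      exact Or.inl (Or.inr hx)
    · rw [hC] at hx
      exact Or.inr hx

theorem Outcome.computed {P : Set (Rule L κ ν)} (hP : IsProgram P) {G : Goal L κ}
    (hV : G.vars.Finite) {Y : Conf L κ ν} (h : Outcome CT (Ann P) G.vars G Y) :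
    ∃ b, Computed CT P G b ∧ AnswerEquiv CT E G.vars b Y.answer := by
  obtain ⟨X, n, hX, hsim, hfin⟩ := h.normal hP hV
  have hX' : Relation.ReflTransGen (Step CT P G.vars) G.start (X.state n) :=
    Relation.ReflTransGen.mono (fun _ _ h => NormalStep.step h) _ _ hX
  rcases hfin with hfin | hfin
  · exact ⟨_, .failure _ hX' hfin, Or.inl ⟨inconsistent_fail, hsim.inconsistent hfin⟩⟩
  · exact ⟨_, .success _ _ _ _ hX' hfin, hsim.answerEquiv⟩

theorem Computed.outcome {P : Set (Rule L κ ν)} (hP : IsProgram P) {G : Goal L κ}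
    (hV : G.vars.Finite) {b : Answer L κ} (h : Computed CT P G b) :
    ∃ Y : Conf L κ ν, Outcome CT (Ann P) G.vars G Y ∧ AnswerEquiv CT E G.vars b Y.answer := by
  cases h with
  | success K d T n h final =>
    obtain ⟨Y, hY, D, hD, -, -, -, -, hsim⟩ := G.represents.steps hP hV h
    obtain rfl : D = 0 := Multiset.map_eq_zero.1 hD
    simp only [add_zero, zero_add] at hsim
    refine ⟨Y, ⟨hY, hsim.ends (Ann_good hP) hV (Or.inr ?_)⟩, hsim.answerEquiv⟩
    rintro Z ⟨_, ⟨r, hr, rfl⟩, ρ, k, H₁, H₂, S, hk, hen, -⟩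
    exact final _ (Or.inr (Or.inr (hen.apply hr n)))
  | failure σ h failed =>
    obtain ⟨Y, hY, D, hD, -, -, -, -, hsim⟩ := G.represents.steps hP hV h
    have hY' : Inconsistent CT Y.con := hsim.inconsistent
      (Inconsistent.of_entails failed fun M e he => (Con.holds_add.1 he).2)
    exact ⟨Y, ⟨hY, Or.inl hY'⟩, Or.inl ⟨inconsistent_fail, hY'⟩⟩

/-- Each `Fire` step is replayed with the counter as its shift; `Sim.fire` permits this because the
counter bounds all identifiers. -/
theorem Outcome.acomputed {Q : Set (ARule L κ ν)} (hQ : ∀ r ∈ Q, r.Good) {G : Goal L κ}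
    (hV : G.vars.Finite) {Y : Conf L κ ν} (h : Outcome CT Q G.vars G Y) :
    ∃ b, AComputed CT Q G b ∧ AnswerEquiv CT E G.vars b Y.answer := by
  have : ∃ X n, Relation.ReflTransGen (AStep CT Q G.vars) G.astart (X.astate n) ∧
      X.Bounded n ∧ Sim CT G.vars X Y := by
    obtain ⟨h, -⟩ := h
    induction h with
    | refl =>
      refine ⟨_, _, ?_, G.conf_bounded, Sim.refl _⟩
      have := asolve_all (CT := CT) (V := G.vars) Q G.bi (number G.chr) 0 ∅ G.chr.length
      rwa [add_zero] at this
    | tail _ h ih =>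
      obtain ⟨X, n, h1, h2, h3⟩ := ih
      obtain ⟨r, hr, ρ, H₁, H₂, S, hen, hsim⟩ := h3.symm.fire hQ hV h h2
      exact ⟨_, _, h1.trans (hen.asteps hr rfl), hen.result_bounded h2, hsim.symm⟩
  obtain ⟨X, n, hX, -, hsim⟩ := this
  rcases hsim.symm.ends hQ hV h.2 with hfin | hfin
  · exact ⟨_, .failure _ hX hfin, Or.inl ⟨inconsistent_fail, hsim.inconsistent hfin⟩⟩
  · refine ⟨_, .success _ _ _ _ hX ?_, hsim.answerEquiv⟩
    intro τ hτ
    generalize hσ : (⟨X.chr, 0, X.con, X.tokens, n⟩ : AState L κ ν) = σ at hτ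
    rcases hτ with ⟨c, S, B, C, C', T, n, -⟩ | hτ
    · simp at hσ
    · obtain ⟨r₀, r, ρ, B, H₁, H₂, S, C, T, n, hr₀, rfl, h1, h2, h3, h4, h5, h6⟩ := hτ
      simp only [AState.mk.injEq] at hσ
      obtain ⟨hS, -, hC, hT, -⟩ := hσ
      obtain ⟨k, hk⟩ := X.exists_bounded
      refine hfin _ ⟨r₀, hr₀, ρ, k, H₁, H₂, S, hk, ⟨hS, h1, h2.mono_right ?_, h3, h4,
        by rw [hC]; exact h5, by rw [hT]; exact h6⟩, rfl⟩
      rintro x (hx | hx)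
      · rw [hS] at hx
        exact Or.inl (Or.inl hx)
      · rw [hC] at hx
        exact Or.inr hx

theorem AComputed.outcome {Q : Set (ARule L κ ν)} (hQ : ∀ r ∈ Q, r.Good) {G : Goal L κ}
    (hV : G.vars.Finite) {b : Answer L κ} (h : AComputed CT Q G b) :
    ∃ Y : Conf L κ ν, Outcome CT Q G.vars G Y ∧ AnswerEquiv CT E G.vars b Y.answer := by
  cases h with
  | success K d T n h final =>
    obtain ⟨Y, hY, -, hsim⟩ := G.arepresents.steps hQ hV h
    simp only [zero_add] at hsim
    refine ⟨Y, ⟨hY, hsim.ends hQ hV (Or.inr ?_)⟩, hsim.answerEquiv⟩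
    rintro Z ⟨r, hr, ρ, k, H₁, H₂, S, hk, hen, -⟩
    exact final _ (Or.inr (hen.aapply hr n))
  | failure σ h failed =>
    obtain ⟨Y, hY, -, hsim⟩ := G.arepresents.steps hQ hV h
    have hY' : Inconsistent CT Y.con := hsim.inconsistent
      (Inconsistent.of_entails failed fun M e he => (Con.holds_add.1 he).2)
    exact ⟨Y, ⟨hY, Or.inl hY'⟩, Or.inl ⟨inconsistent_fail, hY'⟩⟩

/-! ### Confluence and termination -/

/-- The outcomes of a confluent program are the same. -/
theorem Outcome.answerEquiv {P : Set (Rule L κ ν)} (hP : IsProgram P)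
    (hconf : NormalConfluent CT E P) {G : Goal L κ} {Y₁ Y₂ : Conf L κ ν}
    (h₁ : Outcome CT (Ann P) G.vars G Y₁) (h₂ : Outcome CT (Ann P) G.vars G Y₂) :
    AnswerEquiv CT E G.vars Y₁.answer Y₂.answer := by
  obtain ⟨X₁, n₁, hX₁, hsim₁, hfin₁⟩ := h₁.normal hP G.finite_vars
  obtain ⟨X₂, n₂, hX₂, hsim₂, hfin₂⟩ := h₂.normal hP G.finite_vars
  suffices AnswerEquiv CT E G.vars X₁.answer X₂.answer from
    (hsim₁.symm.answerEquiv.trans this).trans hsim₂.answerEquiv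
  have hconf := hconf G.start (X₁.state n₁) (X₂.state n₂) G.wellFormed_start
  rw [G.vars_start] at hconf
  obtain ⟨τ₁, τ₂, hτ₁, hτ₂, h⟩ := hconf hX₁ hX₂
  -- Confluence joins the two ends by further derivations, but from a final state nothing moves, and
  -- from a failed one only failed states are reached.
  have key : ∀ {X : Conf L κ ν} {n : ℕ} {τ : State L κ ν},
      (Inconsistent CT X.con ∨ ∀ τ, ¬ Step CT P G.vars (X.state n) τ) →
      Relation.ReflTransGen (Step CT P G.vars) (X.state n) τ →
      (Inconsistent CT X.con ∧ τ.Failed CT) ∨ τ = X.state n := by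
    intro X n τ hfin hτ
    rcases hfin with hfin | hfin
    · exact Or.inl ⟨hfin, steps_failed hτ hfin⟩
    · rcases hτ.cases_head with h | ⟨_, h, -⟩
      · exact Or.inr h.symm
      · exact absurd h (hfin _)
  have hadd : ∀ {τ : State L κ ν}, τ.Failed CT → Inconsistent CT (τ.goalBi + τ.store) :=
    fun h => Inconsistent.of_entails h fun M e he => (Con.holds_add.1 he).2
  have hadd' : ∀ {X : Conf L κ ν} {n : ℕ},
      Inconsistent CT ((X.state n).goalBi + (X.state n).store) → Inconsistent CT X.con :=
    fun h => Inconsistent.of_entails h fun M e he => Con.holds_add.2 ⟨Con.holds_zero, he⟩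
  rcases h with ⟨hf₁, hf₂⟩ | ⟨π, -, hsame⟩
  · refine Or.inl ⟨?_, ?_⟩
    · rcases key hfin₁ hτ₁ with h | rfl
      · exact h.1
      · exact hf₁
    · rcases key hfin₂ hτ₂ with h | rfl
      · exact h.1
      · exact hf₂
  -- If only one side is known to have failed, sameness makes the other one inconsistent too.
  · rcases key hfin₁ hτ₁ with h1 | rfl <;> rcases key hfin₂ hτ₂ with h2 | rfl
    · exact Or.inl ⟨h1.1, h2.1⟩
    · exact Or.inl ⟨h1.1, hadd' (hsame.inconsistent (hadd h1.2))⟩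
    · exact Or.inl ⟨hadd' (hsame.symm.inconsistent (hadd h2.2)), h2.1⟩
    · exact Conf.same_of_tagged hsame

/-- The successors of a state in normal derivations that do not fail. -/
def ConsistentStep (CT : L.Theory) (P : Set (Rule L κ ν)) (V : Set ℕ) (τ σ : State L κ ν) : Prop :=
  NormalStep CT P V σ τ ∧ ¬ τ.Failed CT

/-- An infinite chain would be an infinite normal computation; since failure persists, none of its
states is failed. -/
theorem NormalTerminating.acc {P : Set (Rule L κ ν)} (h : NormalTerminating CT P) (G : Goal L κ) :
    Acc (ConsistentStep CT P G.vars) G.start := by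
  by_contra hacc
  obtain ⟨f, h0, hf⟩ := not_acc_iff_exists_descending_chain.1 hacc
  refine h ⟨f, h0 ▸ G.wellFormed_start, fun i hi => (hf i).2 ((hf i).1.step.failed hi), fun i => ?_⟩
  rw [h0, G.vars_start]
  exact (hf i).1

/-- Failure persists, so a derivation that ends unfailed passes through no failed state. -/
theorem transGen_consistentStep {P : Set (Rule L κ ν)} {σ τ : State L κ ν}
    (h : Relation.TransGen (NormalStep CT P V) σ τ) (hτ : ¬ τ.Failed CT) :
    Relation.TransGen (ConsistentStep CT P V) τ σ := by
  induction h with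
  | single h => exact .single ⟨h, hτ⟩
  | tail _ h ih => exact .head ⟨h, hτ⟩ (ih fun hf => hτ (h.step.failed hf))

/-- Every rule application of `Q` is simulated by `Q'`. -/
def Simulates (CT : L.Theory) (V : Set ℕ) (Q' Q : Set (ARule L κ ν)) : Prop :=
  ∀ X X', Fire CT Q V X X' → ∃ X₂, Relation.TransGen (Fire CT Q' V) X X₂ ∧ Sim CT V X₂ X'

theorem Sim.transGen {Q : Set (ARule L κ ν)} (hQ : ∀ r ∈ Q, r.Good) (hV : V.Finite)
    {X X' Y : Conf L κ ν} (h : Sim CT V X Y) (hX : Relation.TransGen (Fire CT Q V) X X') :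
    ∃ Y', Relation.TransGen (Fire CT Q V) Y Y' ∧ Sim CT V X' Y' := by
  induction hX with
  | single hX =>
    obtain ⟨Y', h1, h2⟩ := h.fire_step hQ hV hX
    exact ⟨Y', .single h1, h2⟩
  | tail _ hX ih =>
    obtain ⟨Y₁, h1, h2⟩ := ih
    obtain ⟨Y', h3, h4⟩ := h2.fire_step hQ hV hX
    exact ⟨Y', .tail h1 h3, h4⟩

theorem Simulates.transGen {Q Q' : Set (ARule L κ ν)} (hQ' : ∀ r ∈ Q', r.Good) (hV : V.Finite)
    (h : Simulates CT V Q' Q) {X Y Y' : Conf L κ ν} (hXY : Sim CT V X Y)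
    (hY : Relation.TransGen (Fire CT Q V) Y Y') :
    ∃ X', Relation.TransGen (Fire CT Q' V) X X' ∧ Sim CT V X' Y' := by
  have one : ∀ {X Y Y'}, Sim CT V X Y → Fire CT Q V Y Y' →
      ∃ X', Relation.TransGen (Fire CT Q' V) X X' ∧ Sim CT V X' Y' := by
    intro X Y Y' hXY hY
    obtain ⟨Y₂, h1, h2⟩ := h Y Y' hY
    obtain ⟨X', h3, h4⟩ := hXY.symm.transGen hQ' hV h1
    exact ⟨X', h3, h4.symm.trans h2⟩
  induction hY with
  | single hY => exact one hXY hY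
  | tail _ hY ih =>
    obtain ⟨X₁, h1, h2⟩ := ih
    obtain ⟨X₂, h3, h4⟩ := one h2 hY
    exact ⟨X₂, h1.trans h3, h4⟩

/-- The configuration of `Q` is shadowed by a state of `P`. Each step of `Q` moves the shadow by at
least one normal step, so well-founded induction on the shadow ends the derivation of `Q`, unless it
fails before. -/
theorem exists_outcome {P : Set (Rule L κ ν)} (hP : IsProgram P) (hterm : NormalTerminating CT P)
    {Q : Set (ARule L κ ν)} (G : Goal L κ) (hQ : Simulates CT G.vars (Ann P) Q) :
    ∃ Y, Outcome CT Q G.vars G Y := by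
  have hV := G.finite_vars
  have key : ∀ σ : State L κ ν, Acc (Relation.TransGen (ConsistentStep CT P G.vars)) σ →
      ∀ X n Y, X.state n = σ → 1 ≤ n → X.Bounded (n - 1) → Sim CT G.vars X Y →
        ∃ Y', Relation.ReflTransGen (Fire CT Q G.vars) Y Y' ∧ Ends CT Q G.vars Y' := by
    intro σ hσ
    induction hσ with
    | intro σ _ ih =>
      rintro X n Y rfl hn hX hsim
      by_cases hY : ∃ Y', Fire CT Q G.vars Y Y'
      · obtain ⟨Y', hY⟩ := hY
        obtain ⟨X₂, h1, h2⟩ := hQ.transGen (Ann_good hP) hV hsim (.single hY)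
        obtain ⟨X', n', h3, h4, h5, h6⟩ := (Sim.refl X).normal_of_transGen hP hV h1 hn hX
        have h7 := h6.trans h2
        -- If the shadow fails, then `Y'` is inconsistent and the derivation of `Q` ends there.
        by_cases hfail : Inconsistent CT X'.con
        · exact ⟨Y', .single hY, Or.inl (h7.inconsistent hfail)⟩
        · obtain ⟨Y'', h8, h9⟩ := ih _ (transGen_consistentStep h3 hfail) X' n' Y' rfl h4 h5 h7
          exact ⟨Y'', .head hY h8, h9⟩
      · exact ⟨Y, .refl, Or.inr fun Y' hY' => hY ⟨Y', hY'⟩⟩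
  by_cases hG : Inconsistent CT (G.conf : Conf L κ ν).con
  · exact ⟨_, .refl, Or.inl hG⟩
  -- The introduced and solved goal is consistent here and is reached normally from the start, so it
  -- inherits accessibility.
  have hacc : Acc (Relation.TransGen (ConsistentStep CT P G.vars))
      ((G.conf : Conf L κ ν).state (1 + G.chr.length)) := by
    rcases Relation.reflTransGen_iff_eq_or_transGen.1
      (G.normal_start (CT := CT) (V := G.vars) P) with h | h
    · rw [h]
      exact (hterm.acc G).transGen
    · exact (hterm.acc G).transGen.inv (transGen_consistentStep h hG)
  exact key _ hacc _ _ _ rfl (by omega) (by simpa using G.conf_bounded) (Sim.refl _)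

/-- The simulation reproduces the derivation in `Q'`. The end is an end for `Q'` too: it is
inconsistent, or `Q` is stuck there and by `hfire` so is `Q'`. -/
theorem Outcome.of_simulates {Q Q' : Set (ARule L κ ν)} (hQ' : ∀ r ∈ Q', r.Good) (hV : V.Finite)
    (h : Simulates CT V Q' Q) (hfire : ∀ X X', Fire CT Q' V X X' → ∃ Y, Fire CT Q V X Y)
    {G : Goal L κ} {Y : Conf L κ ν} (hY : Outcome CT Q V G Y) :
    ∃ X, Outcome CT Q' V G X ∧ Sim CT V X Y := by
  have hends : Ends CT Q' V Y := hY.2.imp_right fun h Z hZ => (hfire Y Z hZ).elim fun _ => h _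
  rcases Relation.reflTransGen_iff_eq_or_transGen.1 hY.1 with h' | h'
  · subst h'
    exact ⟨_, ⟨.refl, hends⟩, Sim.refl _⟩
  · obtain ⟨X, h1, h2⟩ := h.transGen hQ' hV (Sim.refl _) h'
    exact ⟨X, ⟨h1.to_reflTransGen, h2.symm.ends hQ' hV hends⟩, h2⟩

/-- The two invariants point in opposite directions: derivations are traced back to `Ann P`, while
the ability to fire is passed on from `Ann P` to the later programs. -/
theorem IsWUSequence.simulates (hCT : ClarkEquality CT) (hV : V.Finite) {P : Set (Rule L κ ν)}
    (hP : IsProgram P) {n : ℕ} {Q : ℕ → Set (ARule L κ ν)} (hQ : IsWUSequence CT (Ann P) n Q) :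
    ∀ i ≤ n, (∀ r ∈ Q i, r.Good) ∧ Simulates CT V (Ann P) (Q i) ∧
      ∀ X X', Fire CT (Ann P) V X X' → ∃ Y, Fire CT (Q i) V X Y := by
  intro i hi
  induction i with
  | zero =>
    rw [hQ.1]
    exact ⟨Ann_good hP, fun X X' h => ⟨X', .single h, Sim.refl _⟩, fun X X' h => ⟨X', h⟩⟩
  | succ i ih =>
    obtain ⟨h1, h2, h3⟩ := ih (by omega)
    obtain ⟨r, hr, hsame⟩ := hQ.2 i (by omega)
    refine ⟨hsame.good (good_of_mem_unf h1 hr.1), fun X X' h => ?_, fun X X' h => ?_⟩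
    · obtain ⟨X₂, h4, h5⟩ := fire_simulated hCT hV h1 hr.1 hsame h
      obtain ⟨X₃, h6, h7⟩ := h2.transGen (Ann_good hP) hV (Sim.refl X) h4
      exact ⟨X₃, h6, h7.trans h5⟩
    · obtain ⟨Y, hY⟩ := h3 X X' h
      exact exists_fire_of_fire hV hr hsame hY

end Answers

end CHR

theorem mainTheorem6 {L : FirstOrder.Language.{u, v}} {κ : Type w} {ν : Type z} [DecidableEq ν]
    (CT : L.Theory) (hCT : CHR.ClarkEquality CT) (E : CHR.Reading)
    (P : Set (CHR.Rule L κ ν)) (hP : CHR.IsProgram P)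
    (hterm : CHR.NormalTerminating CT P) (hconf : CHR.NormalConfluent CT E P)
    (n : ℕ) (Q : ℕ → Set (CHR.ARule L κ ν)) (hQ : CHR.IsWUSequence CT (CHR.Ann P) n Q)
    (G : CHR.Goal L κ) :
    CHR.QA CT E P G = CHR.AQA CT E (Q n) G := by
  have hV := G.finite_vars
  obtain ⟨hgood, hsim, hfire⟩ := hQ.simulates hCT hV hP n le_rfl
  ext a
  constructor
  · rintro ⟨b, hb, hba⟩
    obtain ⟨Y₁, hY₁, hbY⟩ := hb.outcome (E := E) hP hV
    -- Any outcome of the last program will do: it is the same as an outcome `Y₂` of `P`, and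
    -- confluence equates the answer of `Y₂` with that of `Y₁`.
    obtain ⟨Y, hY⟩ := CHR.exists_outcome hP hterm G hsim
    obtain ⟨Y₂, hY₂, hYY⟩ := hY.of_simulates (CHR.Ann_good hP) hV hsim hfire
    obtain ⟨b', hb', hbY'⟩ := hY.acomputed (E := E) hgood hV
    refine ⟨b', hb', hbY'.trans (hYY.symm.answerEquiv.trans ?_)⟩
    exact (hY₂.answerEquiv hP hconf hY₁).trans (hbY.symm.trans hba)
  -- Soundness is carried by the simulation alone.
  · rintro ⟨b, hb, hba⟩
    obtain ⟨Y, hY, hbY⟩ := hb.outcome (E := E) hgood hV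
    obtain ⟨Y₂, hY₂, hYY⟩ := hY.of_simulates (CHR.Ann_good hP) hV hsim hfire
    obtain ⟨b', hb', hbY'⟩ := hY₂.computed (E := E) hP hV
    exact ⟨b', hb', hbY'.trans (hYY.answerEquiv.trans (hbY.symm.trans hba))⟩
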